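/- **Setting.** Let $q$ be a prime, $d\mid 256$, $\mathcal R_q=\mathbb Z_q[X]/(X^d+1)$, $\kappa,\lambda\ge 0$, $\omega\ge 1$ integers, and $n=\kappa+\lambda+3$. Norms of elements and vectors over $\mathcal R_q$ are those of the centred integer coefficient vectors; $\sigma_{-1}$ is the automorphism $X\mapsto X^{-1}$. Let $\chi$ be a distribution on $\{-1,0,1\}$ (applied to every coefficient independently), let $\mathcal C$ be a distribution on $\{c\in\mathcal R_q:\|c\|_1\le\omega\}$, let $\mathcal D_{\mathfrak s}$ be the discrete Gaussian on $\mathbb Z$ with centre $0$ and standard deviation $\mathfrak s$, and let $\mathrm{Bin}_1$ give $-1,0,1$ with probabilities $\frac14,\frac12,\frac14$. Put $$\mathfrak s_1=11\omega\sqrt{(4\kappa+2\lambda+6)d},\quad \mathfrak s_2=11\omega\sqrt{(\kappa+\lambda+3)d},\quad \mathfrak s_3=11\sqrt{337}\cdot 2(\kappa+\lambda+3)d,$$ $$B_1=\mathfrak s_1\sqrt{4(2\kappa+\lambda+3)d},\quad B_2=\mathfrak s_2\sqrt{2(\kappa+\lambda+3)d},\quad B_3=\sqrt{256}\,\mathfrak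 s_3 .$$ The public parameters are $\mathbf A\in\mathcal R_q^{\kappa\times n}$ and a commitment key $\mathbf A_3\in\mathcal R_q^{\kappa\times 2(2\kappa+\lambda+3)}$, $\mathbf A_4\in\mathcal R_q^{\kappa\times n}$, $\mathbf B'\in\mathcal R_q^{256/d\times n}$, $\mathbf B''\in\mathcal R_q^{1\times n}$. For $\mathbf m=\mathbf s_1\|\mathbf e_1\|\mathbf s_2\|\mathbf e_2$ with $\mathbf s_b\in\mathcal R_q^{\kappa}$, $\mathbf e_b\in\mathcal R_q^{n}$ write $\tilde{\mathbf A}\mathbf m=(\mathbf A^T\mathbf s_1+\mathbf e_1,\ \mathbf A^T\mathbf s_2+\mathbf e_2)$. The public key is $\mathbf{pk}\in\mathcal R_q^{2n}$. The honest prover holds $\mathbf m$ with coefficients in $\{-1,0,1\}$ and $\tilde{\mathbf A}\mathbf m=\mathbf{pk}$. **Rejection step.** $\mathrm{Rej}(\vec z,\vec v,\mathfrak s)$ continues with probability $\min\bigl(1,\frac13\exp\frac{-2\langle \vec z,\vec v\rangle+\|\vec v\|^2}{2\mathfrak s^2}\bigr)$; otherwise the prover aborts. **Protocol $\pi^{KW}$.**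 1. The prover samples $\mathbf s\leftarrow\chi^{nd}$, $g\in\mathcal R_q$ uniform with constant coefficient $0$, $\mathbf y_1\leftarrow\mathcal D_{\mathfrak s_1}^{2(2\kappa+\lambda+3)d}$, $\mathbf y_2\leftarrow\mathcal D_{\mathfrak s_2}^{nd}$, $\mathbf y_3\leftarrow\mathcal D_{\mathfrak s_3}^{256}$ and sends $f=\mathbf A_3\mathbf m+\mathbf A_4\mathbf s$, $\mathbf u_1=\mathbf B'\mathbf s+\mathbf y_3$, $u_2=\mathbf B''\mathbf s+g$. 2. The verifier sends $\mathbf R\leftarrow\mathrm{Bin}_1^{256\times 2(2\kappa+\lambda+3)d}$. The prover computes $\vec z_3=\vec y_3+\mathbf R\vec m$ (with $\mathbf R\vec m$ reduced mod $q$ to centred representatives), runs $\mathrm{Rej}(\vec z_3,\mathbf R\vec m,\mathfrak s_3)$ and sends $\mathbf z_3$. 3. The verifier sends uniform $\delta_1,\dots,\delta_{256}\in\mathbb Z_q$. Let $\mathbf r_j$ be the polynomial vector whose coefficients are the $j$-th row of $\mathbf R$, and $\mathbf e_j\in\mathcal R_q^{256/d}$ the one whose coefficients are the $j$-th unit vector.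 For $\mathbf a\in\mathcal R_q^{2(2\kappa+\lambda+3)}$, $\mathbf b\in\mathcal R_q^{256/d}$, $t\in\mathcal R_q$ put $L(\mathbf a,\mathbf b,t)=\sum_j\delta_j\sigma_{-1}(\mathbf r_j)^T\mathbf a+\sum_j\delta_j\sigma_{-1}(\mathbf e_j)^T\mathbf b+t$. The prover sends $h=L(\mathbf m,\mathbf y_3,g)-\sum_j\delta_j\sigma_{-1}(\mathbf e_j)^T\mathbf z_3$, $\mathbf w=\mathbf A_3\mathbf y_1+\mathbf A_4\mathbf y_2$, and $\mathbf v=\bigl(\tilde{\mathbf A}\mathbf y_1,\ L(\mathbf y_1,-\mathbf B'\mathbf y_2,-\mathbf B''\mathbf y_2)\bigr)$. 4. The verifier sends $c\leftarrow\mathcal C$. The prover computes $\mathbf z_1=\mathbf y_1+c\mathbf m$, $\mathbf z_2=\mathbf y_2+c\mathbf s$, runs $\mathrm{Rej}(\mathbf z_1,c\mathbf m,\mathfrak s_1)$ and $\mathrm{Rej}(\mathbf z_2,c\mathbf s,\mathfrak s_2)$ (on integer coefficient vectors, $c\mathbf m$ and $c\mathbf s$ being lifted to centred representatives), and sends $\mathbf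 z_1,\mathbf z_2$. 5. The verifier accepts iff $\|\mathbf z_1\|\le B_1$, $\|\mathbf z_2\|\le B_2$, $\|\mathbf z_3\|_\infty\le B_3$, the constant coefficient of $h$ is $0$, $\mathbf A_3\mathbf z_1+\mathbf A_4\mathbf z_2=\mathbf w+cf$, and $\mathbf v=\bigl(\tilde{\mathbf A}\mathbf z_1-c\,\mathbf{pk},\ L(\mathbf z_1,c\mathbf u_1-\mathbf B'\mathbf z_2,cu_2-\mathbf B''\mathbf z_2)-c(h+\sum_j\delta_j\sigma_{-1}(\mathbf e_j)^T\mathbf z_3)\bigr)$. **Relation.** A witness for $(\mathbf{pk},f)$ is a triple $(\bar c,\mathbf m,\mathbf s)$ with $\bar c$ invertible, $\|\bar c\|_1\le2\omega$, $f=\mathbf A_3\mathbf m+\mathbf A_4\mathbf s$, $\|\bar c\mathbf m\|\le 2B_1$, $\|\bar c\mathbf s\|\le 2B_2$, $\tilde{\mathbf A}\mathbf m=\mathbf{pk}$ and $\|\mathbf m\|_\infty\le 2B_3$. A *polynomial-time machine* is a fixed program, independent of all parameters, over arrays of elements of $\mathcal R_q$, using ring operations (including inversion of units, $\sigma_{-1}$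 and taking constant coefficients), the samplers above (uniform on $\mathcal R_q$, $\chi$, $\mathrm{Bin}_1$, $\mathcal D_{\mathfrak s_i}$, $\mathcal C$), zero tests, bounded loops and, for an oracle machine, calls to a prover with fixed coins, and taking at most $C(\kappa+\lambda+d)^C$ such steps for some constant $C$. **Theorem.** $\pi^{KW}$ is complete, knowledge sound and honest-verifier zero-knowledge, in the following sense. 1. *Completeness.* For all parameters, all commitment keys and every honest $\mathbf m$: the prover does not abort with probability at least $\frac1{27}-2^{-100}$, and conditioned on this the verifier accepts with probability at least $$1-\Bigl(2^{-(2\kappa+\lambda+3)d/4}+2^{-(\kappa+\lambda+3)d/8}+2^9e^{-128}+2^{-100}\Bigr).$$ 2. *Knowledge soundness.* Let $\eta=\sup_{c\in\operatorname{supp}\mathcal C}\Pr_{c'\leftarrow\mathcal C}[c-c'\text{ is not invertible}]$ and $\mathrm{err}=\eta+\frac1q+2^{-256}$. There are a polynomial-time oracle machine $\mathcal K$ and constants $e,C\geq 1$ such that for all parameters, all $\mathbf A$, $\mathbf{pk}$, all commitment keys and every probabilistic prover $\mathcal P^*$ that makes the verifier accept with probability $\varepsilon>\mathrm{err}$, $\mathcal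 K$ with black-box (rewinding) access to $\mathcal P^*$ satisfies $$\Pr[\mathcal K\text{ outputs a witness for }(\mathbf{pk},f)]\ \ge\ \frac{(\varepsilon-\mathrm{err})^e}{C(\kappa+\lambda+d)^C}-\Pr[\mathcal K\text{ outputs a solution of }\mathrm{MSIS}],$$ where $f$ is the commitment sent by $\mathcal P^*$, and a solution of $\mathrm{MSIS}$ is a vector $\mathbf x\in\mathcal R_q^{5\kappa+3\lambda+9}$ with $[\mathbf A_3\,|\,\mathbf A_4]\mathbf x=0$ and $0<\|\mathbf x\|\le 8\omega\sqrt{B_1^2+B_2^2}$. 3. *Honest-verifier zero-knowledge.* There are a polynomial-time simulator $\mathcal S$ and a polynomial-time reduction $\mathcal Q$ such that for all parameters, all $\mathbf A$, $\mathbf{pk}$, every honest $\mathbf m$ and every distinguisher $\mathcal D$: the advantage of $\mathcal D$ in telling a uniform commitment key with the transcript of an honest non-aborting execution from a uniform commitment key with the transcript output by $\mathcal S$ on input $\mathbf A,\mathbf{pk}$ and the commitment key is at most $2^{-100}$ plus the advantage of $\mathcal D\circ\mathcal Q$ in telling $(\mathbf M,\mathbf M\mathbf s)$ from $(\mathbf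 M,\mathbf t)$, for uniform $\mathbf M\in\mathcal R_q^{(\kappa+256/d+1)\times(\kappa+\lambda+3)}$, $\mathbf s\leftarrow\chi^{(\kappa+\lambda+3)d}$ and uniform $\mathbf t$ (dual Module-LWE). Here $\mathcal Q$ gets the instance together with $\mathbf A,\mathbf{pk},\mathbf m$. -/

import Mathlib

noncomputable section

namespace KeyWF

/-! ### Parameters and the ring `R_q = ℤ_q[X]/(X^d + 1)` -/

/-- Numerical parameters: a prime modulus `q`, a ring degree `d` dividing `256` (so that a vector
of `256` integers is exactly a vector of `256 / d` polynomials), the module ranks `κ` and `λ`, and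
the bound `ω` on the `ℓ₁`-norm of challenges. -/
structure Params where
  q : ℕ
  d : ℕ
  kap : ℕ
  lam : ℕ
  om : ℕ
  q_prime : q.Prime
  d_dvd : d ∣ 256
  om_pos : 0 < om

namespace Params

/-- The length `κ + λ + 3` of commitment randomness and of public keys. -/
abbrev n (P : Params) : ℕ := P.kap + P.lam + 3

/-- The number `256 / d` of polynomials that hold `256` coefficients. -/
abbrev nb (P : Params) : ℕ := 256 / P.d

/-- The size in which running times are measured. -/
def size (P : Params) : ℕ := P.kap + P.lam + P.d

theorem d_pos (P : Params) : 0 < P.d := Nat.pos_of_dvd_of_pos P.d_dvd (by norm_num)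

instance (P : Params) : Fact P.q.Prime := ⟨P.q_prime⟩

instance (P : Params) : NeZero P.q := ⟨P.q_prime.ne_zero⟩

instance (P : Params) : NeZero P.d := ⟨P.d_pos.ne'⟩

end Params

/-- The ring `R_q`. -/
abbrev Rq (P : Params) : Type := AdjoinRoot (Polynomial.X ^ P.d + 1 : Polynomial (ZMod P.q))

theorem monic_modulus (P : Params) :
    (Polynomial.X ^ P.d + 1 : Polynomial (ZMod P.q)).Monic := by
  simpa using Polynomial.monic_X_pow_add_C (1 : ZMod P.q) P.d_pos.ne'

/-- The class of `X`. -/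
def xx (P : Params) : Rq P := AdjoinRoot.root _

/-- The coefficient of `X ^ k` in the representative of degree `< d`. -/
def coef {P : Params} (a : Rq P) (k : Fin P.d) : ZMod P.q :=
  (AdjoinRoot.modByMonicHom (monic_modulus P) a).coeff k

/-- The ring element with given coefficients. -/
def ofCoef {P : Params} (a : Fin P.d → ZMod P.q) : Rq P :=
  ∑ k, algebraMap (ZMod P.q) (Rq P) (a k) * xx P ^ (k : ℕ)

/-- Reduction modulo `q` of an integer coefficient vector. -/
def ofInt {P : Params} (a : Fin P.d → ℤ) : Rq P := ofCoef fun k => (a k : ZMod P.q)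

/-- The centred integer coefficients, in `(-q/2, q/2]`. -/
def lift {P : Params} (a : Rq P) (k : Fin P.d) : ℤ := (coef a k).valMinAbs

/-- The constant coefficient. -/
def cst {P : Params} (a : Rq P) : ZMod P.q := coef a 0

theorem xx_pow (P : Params) : xx P ^ P.d = -1 := by
  have h := AdjoinRoot.eval₂_root (Polynomial.X ^ P.d + 1 : Polynomial (ZMod P.q))
  simp only [Polynomial.eval₂_add, Polynomial.eval₂_pow, Polynomial.eval₂_X,
    Polynomial.eval₂_one] at h
  exact eq_neg_of_add_eq_zero_left h

theorem conj_root (P : Params) : (-xx P ^ (P.d - 1)) ^ P.d = -1 := by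
  rw [neg_pow, ← pow_mul, mul_comm (P.d - 1), pow_mul, xx_pow, ← pow_add,
    show P.d + (P.d - 1) = 2 * (P.d - 1) + 1 by have := P.d_pos; omega, pow_add, pow_mul]
  simp

/-- The automorphism `σ₋₁` of `R_q`, that maps `X` to `X⁻¹ = -X ^ (d - 1)`. -/
def conj (P : Params) : Rq P →ₐ[ZMod P.q] Rq P :=
  AdjoinRoot.liftAlgHom _ (Algebra.ofId _ _) (-xx P ^ (P.d - 1)) (by
    simp [conj_root P])

/-- `‖a‖₁` for a ring element. -/
def l1 {P : Params} (a : Rq P) : ℝ := ∑ k, |(lift a k : ℝ)|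

/-- `‖a‖₂` for a vector of ring elements. -/
def l2 {P : Params} {ι : Type} [Fintype ι] (a : ι → Rq P) : ℝ :=
  Real.sqrt (∑ i, ∑ k, (lift (a i) k : ℝ) ^ 2)

/-- `‖a‖_∞` for a vector of ring elements. -/
def linf {P : Params} {ι : Type} [Fintype ι] (a : ι → Rq P) : ℕ :=
  Finset.univ.sup fun i => Finset.univ.sup fun k => (lift (a i) k).natAbs

/-! ### Probability -/

/-- The probability of an event. -/
def pr {α : Type} (p : PMF α) (E : α → Prop) : ℝ := (p.toOuterMeasure {a | E a}).toReal

theorem tsum_fin_prod {α : Type} (p : PMF α) :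
    ∀ m : ℕ, ∑' f : Fin m → α, ∏ i, p (f i) = 1
  | 0 => by simp
  | m + 1 => by
    rw [← (Fin.consEquiv fun _ : Fin (m + 1) => α).tsum_eq]
    simp only [Fin.consEquiv, Equiv.coe_fn_mk, Fin.prod_univ_succ, Fin.cons_zero, Fin.cons_succ]
    rw [ENNReal.tsum_prod (f := fun a (f : Fin m → α) => p a * ∏ i, p (f i))]
    simp_rw [ENNReal.tsum_mul_left, tsum_fin_prod p m, mul_one]
    exact p.tsum_coe

theorem tsum_pi_prod {α ι : Type} [Fintype ι] (p : PMF α) :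
    ∑' f : ι → α, ∏ i, p (f i) = 1 := by
  classical
  let E : (ι → α) ≃ (Fin (Fintype.card ι) → α) :=
    Equiv.arrowCongr (Fintype.equivFin ι) (Equiv.refl α)
  have h (f : ι → α) : ∏ i, p (f i) = ∏ j, p (E f j) :=
    Fintype.prod_equiv (Fintype.equivFin ι) (fun i => p (f i)) (fun j => p (E f j))
      fun i => by simp [E]
  rw [← tsum_fin_prod p (Fintype.card ι), tsum_congr h]
  exact E.tsum_eq fun g => ∏ j, p (g j)

/-- Independent identically distributed samples, indexed by a finite type. -/
def iid {α : Type} (p : PMF α) (ι : Type) [Fintype ι] : PMF (ι → α) :=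
  ⟨fun f => ∏ i, p (f i), by rw [← tsum_pi_prod (ι := ι) p]; exact ENNReal.summable.hasSum⟩

/-- The weight `exp (-z² / (2 s²))`. -/
def gaussWeight (s : ℝ) (z : ℤ) : ℝ := Real.exp (-(z : ℝ) ^ 2 / (2 * s ^ 2))

theorem summable_gaussWeight {s : ℝ} (hs : 0 < s) : Summable (gaussWeight s) := by
  have hn : Summable fun m : ℕ => Real.exp (-(m : ℝ) ^ 2 / (2 * s ^ 2)) := by
    have hr : Real.exp (-(1 / (2 * s ^ 2))) < 1 := by
      have : 0 < 1 / (2 * s ^ 2) := by positivity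
      have h := Real.exp_lt_exp.2 (show -(1 / (2 * s ^ 2)) < 0 by linarith)
      rwa [Real.exp_zero] at h
    refine Summable.of_nonneg_of_le (fun _ => (Real.exp_pos _).le) (fun m => ?_)
      (summable_geometric_of_lt_one (Real.exp_pos _).le hr)
    rw [← Real.exp_nat_mul]
    refine Real.exp_le_exp.2 ?_
    rw [neg_div, mul_neg, neg_le_neg_iff, mul_one_div]
    gcongr
    rcases Nat.eq_zero_or_pos m with h | h
    · simp [h]
    · have : (1 : ℝ) ≤ m := by exact_mod_cast h
      nlinarith
  refine Summable.of_nat_of_neg ?_ ?_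
  · simpa [gaussWeight] using hn
  · simpa [gaussWeight] using hn

/-- The discrete Gaussian distribution on `ℤ` with centre `0` and standard deviation `s`. Its
independent copies form the discrete Gaussian on `ℤ^ℓ`. -/
def gauss (s : ℝ) (hs : 0 < s) : PMF ℤ :=
  PMF.normalize (fun z => ENNReal.ofReal (gaussWeight s z))
    (fun h => by
      have h0 := (ENNReal.tsum_eq_zero.1 h) 0
      rw [ENNReal.ofReal_eq_zero] at h0
      exact absurd h0 (not_le.2 (Real.exp_pos _)))
    (by
      rw [← ENNReal.ofReal_tsum_of_nonneg (f := gaussWeight s) (fun _ => (Real.exp_pos _).le)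
        (summable_gaussWeight hs)]
      exact ENNReal.ofReal_ne_top)

/-- The centred binomial distribution `Bin₁`: `-1`, `0`, `1` with probability `1/4`, `1/2`, `1/4`. -/
def bin1 : PMF ℤ :=
  (PMF.uniformOfFintype (Fin 2 × Fin 2)).map fun b => ((b.1 : ℕ) : ℤ) - ((b.2 : ℕ) : ℤ)

/-- The distributions fixed with the parameters: `χ` on `{-1, 0, 1}`, and the challenge
distribution on ring elements of `ℓ₁`-norm at most `ω`. -/
structure Dists (P : Params) where
  chi : PMF ℤ
  chi_supp : ∀ z ∈ chi.support, z = -1 ∨ z = 0 ∨ z = 1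
  chal : PMF (Rq P)
  chal_supp : ∀ c ∈ chal.support, l1 c ≤ P.om

/-- A polynomial with independent integer coefficients, reduced modulo `q`. -/
def polyOf (P : Params) (p : PMF ℤ) : PMF (Rq P) := (iid p (Fin P.d)).map ofInt

/-- The uniform distribution on `R_q`. -/
def unif (P : Params) : PMF (Rq P) := (iid (PMF.uniformOfFintype (ZMod P.q)) (Fin P.d)).map ofCoef

/-- The uniform distribution on the elements of `R_q` with constant coefficient `0`. -/
def unifZero (P : Params) : PMF (Rq P) :=
  (unif P).map fun a => a - algebraMap (ZMod P.q) (Rq P) (cst a)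

/-- Integer coefficient vectors of a vector of polynomials, with discrete Gaussian entries. -/
def gaussVec (P : Params) (s : ℝ) (hs : 0 < s) (ι : Type) [Fintype ι] :
    PMF (ι → Fin P.d → ℤ) := iid (iid (gauss s hs) (Fin P.d)) ι

/-- A coin that is `true` with probability `p`. -/
def coin (p : ENNReal) (h : p ≤ 1) : PMF Bool :=
  PMF.ofFintype (fun b => cond b p (1 - p)) (by simp [h])

/-- Rejection sampling with repetition rate `M = 3`; the value is `true` when the sample is kept,
which happens with probability `min 1 (exp ((-2⟨z,v⟩ + ‖v‖²) / (2 s²)) / M)`. -/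
def rej {P : Params} {ι : Type} [Fintype ι] (z v : ι → Fin P.d → ℤ) (s : ℝ) : PMF Bool :=
  coin
    (min 1 (ENNReal.ofReal (1 / 3 *
      Real.exp ((-2 * (∑ i, ∑ k, (z i k : ℝ) * v i k) + ∑ i, ∑ k, (v i k : ℝ) ^ 2) / (2 * s ^ 2)))))
    (min_le_left _ _)

/-! ### The statement, the protocol messages and the relations -/

/-- Positions of the secret vector `s₁ ‖ e₁ ‖ s₂ ‖ e₂`: `(b, inl i)` is the entry `i` of the `b`-th
secret, `(b, inr j)` is the entry `j` of the `b`-th error. -/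
abbrev KeyIdx (P : Params) : Type := Fin 2 × (Fin P.kap ⊕ Fin P.n)

/-- The `256` positions `j`, written as (polynomial, coefficient). -/
abbrev RowIdx (P : Params) : Type := Fin P.nb × Fin P.d

/-- The linear map `(s₁, e₁, s₂, e₂) ↦ (Aᵀ s₁ + e₁, Aᵀ s₂ + e₂)`. -/
def keyMap {P : Params} (A : Matrix (Fin P.kap) (Fin P.n) (Rq P)) (m : KeyIdx P → Rq P) :
    Fin 2 × Fin P.n → Rq P :=
  fun p => (A.transpose.mulVec fun i => m (p.1, Sum.inl i)) p.2 + m (p.1, Sum.inr p.2)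

/-- The public commitment parameters `A₃, A₄, B', B''`. -/
structure CommKey (P : Params) where
  A3 : Matrix (Fin P.kap) (KeyIdx P) (Rq P)
  A4 : Matrix (Fin P.kap) (Fin P.n) (Rq P)
  B1 : Matrix (Fin P.nb) (Fin P.n) (Rq P)
  B2 : Fin P.n → Rq P

/-- Uniform commitment parameters. -/
def unifCommKey (P : Params) : PMF (CommKey P) := do
  let A3 ← iid (iid (unif P) (KeyIdx P)) (Fin P.kap)
  let A4 ← iid (iid (unif P) (Fin P.n)) (Fin P.kap)
  let B1 ← iid (iid (unif P) (Fin P.n)) (Fin P.nb)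
  let B2 ← iid (unif P) (Fin P.n)
  pure ⟨A3, A4, B1, B2⟩

/-- A transcript. The prover sends `f, u1, u2`; receives `R`, given by the polynomial vectors `r_j`
whose coefficient vectors are the rows of `R`; sends `z3`; receives the scalars `dd`; sends
`h, w, v`, where `v` has the part `vTop` and the last entry `vBot`; receives `c`; sends `z1, z2`. -/
structure Transcript (P : Params) where
  f : Fin P.kap → Rq P
  u1 : Fin P.nb → Rq P
  u2 : Rq P
  R : RowIdx P → KeyIdx P → Rq P
  z3 : Fin P.nb → Rq P
  dd : RowIdx P → ZMod P.q
  h : Rq P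
  w : Fin P.kap → Rq P
  vTop : Fin 2 × Fin P.n → Rq P
  vBot : Rq P
  c : Rq P
  z1 : KeyIdx P → Rq P
  z2 : Fin P.n → Rq P

/-- `a ⬝ b = ∑ i, a i * b i`, with `σ₋₁` applied to the entries of `a`. -/
def conjDot {P : Params} {ι : Type} [Fintype ι] (a b : ι → Rq P) : Rq P :=
  ∑ i, conj P (a i) * b i

/-- The vector `e_j` whose coefficient vector is the `j`-th unit vector. -/
def unitVec {P : Params} (j : RowIdx P) : Fin P.nb → Rq P :=
  Pi.single j.1 (xx P ^ (j.2 : ℕ))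

/-- The last row of the matrix `T`, applied to `(a, b, g)`. -/
def lastRow {P : Params} (R : RowIdx P → KeyIdx P → Rq P) (dd : RowIdx P → ZMod P.q)
    (a : KeyIdx P → Rq P) (b : Fin P.nb → Rq P) (g : Rq P) : Rq P :=
  ∑ j, dd j • conjDot (R j) a + ∑ j, dd j • conjDot (unitVec j) b + g

/-- The product of the matrix `R` with the coefficient vector of `m`. -/
def rowProd {P : Params} (R : RowIdx P → KeyIdx P → Rq P) (m : KeyIdx P → Rq P) (j : RowIdx P) :
    ZMod P.q :=
  ∑ i, ∑ k, coef (R j i) k * coef (m i) k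

/-- The standard deviation `𝔰₁ = 11 ω √((4κ + 2λ + 6) d)`. -/
def sd1 (P : Params) : ℝ := 11 * P.om * Real.sqrt ((4 * P.kap + 2 * P.lam + 6) * P.d)

/-- The standard deviation `𝔰₂ = 11 ω √((κ + λ + 3) d)`. -/
def sd2 (P : Params) : ℝ := 11 * P.om * Real.sqrt ((P.kap + P.lam + 3) * P.d)

/-- The standard deviation `𝔰₃ = 11 √337 · 2 (κ + λ + 3) d`. -/
def sd3 (P : Params) : ℝ := 11 * Real.sqrt 337 * (2 * (P.kap + P.lam + 3) * P.d)

theorem sd1_pos (P : Params) : 0 < sd1 P := by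
  have h1 : (0 : ℝ) < P.om := by exact_mod_cast P.om_pos
  have h2 : (0 : ℝ) < P.d := by exact_mod_cast P.d_pos
  unfold sd1; positivity

theorem sd2_pos (P : Params) : 0 < sd2 P := by
  have h1 : (0 : ℝ) < P.om := by exact_mod_cast P.om_pos
  have h2 : (0 : ℝ) < P.d := by exact_mod_cast P.d_pos
  unfold sd2; positivity

theorem sd3_pos (P : Params) : 0 < sd3 P := by
  have h2 : (0 : ℝ) < P.d := by exact_mod_cast P.d_pos
  unfold sd3; positivity

/-- The bound `𝔰₁ √(4 (2κ + λ + 3) d)` on `‖z1‖`. -/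
def bd1 (P : Params) : ℝ := sd1 P * Real.sqrt (4 * (2 * P.kap + P.lam + 3) * P.d)

/-- The bound `𝔰₂ √(2 (κ + λ + 3) d)` on `‖z2‖`. -/
def bd2 (P : Params) : ℝ := sd2 P * Real.sqrt (2 * (P.kap + P.lam + 3) * P.d)

/-- The bound `√(2k) 𝔰₃` on `‖z3‖_∞`, with `k = 128`. -/
def bd3 (P : Params) : ℝ := Real.sqrt (2 * 128) * sd3 P

/-- The checks of the verifier. -/
structure Verify {P : Params} (A : Matrix (Fin P.kap) (Fin P.n) (Rq P))
    (pk : Fin 2 × Fin P.n → Rq P) (ck : CommKey P) (t : Transcript P) : Prop where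
  norm1 : l2 t.z1 ≤ bd1 P
  norm2 : l2 t.z2 ≤ bd2 P
  norm3 : (linf t.z3 : ℝ) ≤ bd3 P
  const : cst t.h = 0
  opening : ck.A3.mulVec t.z1 + ck.A4.mulVec t.z2 = t.w + t.c • t.f
  top : t.vTop = keyMap A t.z1 - t.c • pk
  bot : t.vBot =
    lastRow t.R t.dd t.z1 (t.c • t.u1 - ck.B1.mulVec t.z2) (t.c * t.u2 - dotProduct ck.B2 t.z2)
      - t.c * (t.h + ∑ j, t.dd j • conjDot (unitVec j) t.z3)

/-- The relation of the honest prover: the public key is built from a secret vector with entries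
in the range `{-1, 0, 1}` of `χ`. -/
def HonestRel {P : Params} (A : Matrix (Fin P.kap) (Fin P.n) (Rq P))
    (pk : Fin 2 × Fin P.n → Rq P) (m : KeyIdx P → Rq P) : Prop :=
  linf m ≤ 1 ∧ keyMap A m = pk

/-- The relation enforced by the protocol, for the commitment `f`: a weak opening `(c̄, m, s)` of
`f` to a short secret vector `m = s₁ ‖ e₁ ‖ s₂ ‖ e₂` behind the public key. -/
structure RelKW {P : Params} (A : Matrix (Fin P.kap) (Fin P.n) (Rq P))
    (pk : Fin 2 × Fin P.n → Rq P) (ck : CommKey P) (f : Fin P.kap → Rq P)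
    (cbar : Rq P) (m : KeyIdx P → Rq P) (s : Fin P.n → Rq P) : Prop where
  unit : IsUnit cbar
  norm_c : l1 cbar ≤ 2 * P.om
  opening : ck.A3.mulVec m + ck.A4.mulVec s = f
  norm_m : l2 (cbar • m) ≤ 2 * bd1 P
  norm_s : l2 (cbar • s) ≤ 2 * bd2 P
  key : keyMap A m = pk
  short : (linf m : ℝ) ≤ 2 * bd3 P

/-- `z` solves the Module-SIS instance `M` with norm bound `β`. -/
def IsMSIS {P : Params} {ι μ : Type} [Fintype μ] (M : Matrix ι μ (Rq P)) (β : ℝ)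
    (z : μ → Rq P) : Prop :=
  0 < l2 z ∧ l2 z ≤ β ∧ M.mulVec z = 0

/-- The Module-SIS norm bound `8 ω √(B₁² + B₂²)`. -/
def msisBound (P : Params) : ℝ := 8 * P.om * Real.sqrt (bd1 P ^ 2 + bd2 P ^ 2)

/-- The advantage of `adv` against the dual (knapsack) Module-LWE problem with matrices indexed by
`ρ × μ`: to tell `(M, M s)`, with `s` from `χ`, from `(M, u)`, with `u` uniform. -/
def mlweAdv {P : Params} (D : Dists P) {ρ μ : Type} [Fintype ρ] [Fintype μ]
    (adv : Matrix ρ μ (Rq P) → (ρ → Rq P) → PMF Bool) : ℝ :=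
  |pr (do
      let M ← iid (iid (unif P) μ) ρ
      let s ← iid (polyOf P D.chi) μ
      adv M (Matrix.mulVec M s)) (· = true)
    - pr (do
      let M ← iid (iid (unif P) μ) ρ
      let u ← iid (unif P) ρ
      adv M u) (· = true)|

/-! ### The honest execution -/

/-- An execution between the honest prover, with secret vector `m`, and the honest verifier; the
value is `none` when the prover aborts in one of the rejection steps. -/
def honestRun {P : Params} (D : Dists P) (A : Matrix (Fin P.kap) (Fin P.n) (Rq P))
    (ck : CommKey P) (m : KeyIdx P → Rq P) : PMF (Option (Transcript P)) := do
  let s ← iid (polyOf P D.chi) (Fin P.n)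
  let g ← unifZero P
  let y1i ← gaussVec P (sd1 P) (sd1_pos P) (KeyIdx P)
  let y2i ← gaussVec P (sd2 P) (sd2_pos P) (Fin P.n)
  let y3i ← gaussVec P (sd3 P) (sd3_pos P) (Fin P.nb)
  let y1 : KeyIdx P → Rq P := fun i => ofInt (y1i i)
  let y2 : Fin P.n → Rq P := fun i => ofInt (y2i i)
  let y3 : Fin P.nb → Rq P := fun i => ofInt (y3i i)
  let f := ck.A3.mulVec m + ck.A4.mulVec s
  let u1 := ck.B1.mulVec s + y3
  let u2 := dotProduct ck.B2 s + g
  let R ← iid (iid (polyOf P bin1) (KeyIdx P)) (RowIdx P)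
  let v3 : Fin P.nb → Fin P.d → ℤ := fun b k => (rowProd R m (b, k)).valMinAbs
  let z3i := y3i + v3
  let ok3 ← rej z3i v3 (sd3 P)
  if ok3 = false then pure none else do
  let z3 : Fin P.nb → Rq P := fun i => ofInt (z3i i)
  let dd ← iid (PMF.uniformOfFintype (ZMod P.q)) (RowIdx P)
  let x : Rq P := ∑ j, dd j •
    (conjDot (R j) m + conjDot (unitVec j) y3 - conjDot (unitVec j) z3)
  let h := g + x
  let w := ck.A3.mulVec y1 + ck.A4.mulVec y2
  let vTop := keyMap A y1
  let vBot := lastRow R dd y1 (-(ck.B1.mulVec y2)) (-(dotProduct ck.B2 y2))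
  let c ← D.chal
  let v1 : KeyIdx P → Fin P.d → ℤ := fun i => lift (c * m i)
  let v2 : Fin P.n → Fin P.d → ℤ := fun i => lift (c * s i)
  let z1i := y1i + v1
  let z2i := y2i + v2
  let ok1 ← rej z1i v1 (sd1 P)
  if ok1 = false then pure none else do
  let ok2 ← rej z2i v2 (sd2 P)
  if ok2 = false then pure none else
  pure (some
    { f := f, u1 := u1, u2 := u2, R := R, z3 := z3, dd := dd, h := h, w := w, vTop := vTop,
      vBot := vBot, c := c, z1 := fun i => ofInt (z1i i), z2 := fun i => ofInt (z2i i) })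

/-- The completeness error. -/
def complErr (P : Params) : ℝ :=
  (2 : ℝ) ^ (-((2 * P.kap + P.lam + 3) * P.d / 4 : ℝ))
    + (2 : ℝ) ^ (-((P.kap + P.lam + 3) * P.d / 8 : ℝ))
    + 2 ^ 9 * Real.exp (-128) + 1 / 2 ^ 100

/-! ### Malicious provers -/

/-- A prover with fixed coins and fixed input: its next-message functions. A probabilistic prover
is a distribution on these. -/
structure Prover (P : Params) where
  f : Fin P.kap → Rq P
  u1 : Fin P.nb → Rq P
  u2 : Rq P
  z3 : (RowIdx P → KeyIdx P → Rq P) → Fin P.nb → Rq P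
  msg3 : (RowIdx P → KeyIdx P → Rq P) → (RowIdx P → ZMod P.q) →
    Rq P × (Fin P.kap → Rq P) × (Fin 2 × Fin P.n → Rq P) × Rq P
  msg4 : (RowIdx P → KeyIdx P → Rq P) → (RowIdx P → ZMod P.q) → Rq P →
    (KeyIdx P → Rq P) × (Fin P.n → Rq P)

/-- The transcript of a prover with given challenges. -/
def Prover.transcript {P : Params} (a : Prover P) (R : RowIdx P → KeyIdx P → Rq P)
    (dd : RowIdx P → ZMod P.q) (c : Rq P) : Transcript P :=
  { f := a.f, u1 := a.u1, u2 := a.u2, R := R, z3 := a.z3 R, dd := dd,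
    h := (a.msg3 R dd).1, w := (a.msg3 R dd).2.1, vTop := (a.msg3 R dd).2.2.1,
    vBot := (a.msg3 R dd).2.2.2, c := c, z1 := (a.msg4 R dd c).1, z2 := (a.msg4 R dd c).2 }

/-- The transcript of a probabilistic prover with the honest verifier. -/
def play {P : Params} (D : Dists P) (adv : PMF (Prover P)) : PMF (Transcript P) := do
  let a ← adv
  let R ← iid (iid (polyOf P bin1) (KeyIdx P)) (RowIdx P)
  let dd ← iid (PMF.uniformOfFintype (ZMod P.q)) (RowIdx P)
  let c ← D.chal
  pure (a.transcript R dd c)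

/-- The largest probability, over challenges `c`, that `c - c'` is not invertible for an
independent challenge `c'`. -/
def nonInv {P : Params} (D : Dists P) : ℝ :=
  (⨆ c ∈ D.chal.support, D.chal.toOuterMeasure {c' | ¬ IsUnit (c - c')}).toReal

/-- The knowledge error. -/
def knowErr {P : Params} (D : Dists P) : ℝ := nonInv D + 1 / P.q + 1 / 2 ^ 256

/-! ### Probabilistic polynomial-time machines

Algorithms are finite programs that do not depend on the parameters. They act on arrays of elements
of `R_q` and use ring operations, the samplers of the protocol, conditionals, loops whose bounds are
polynomial expressions in the parameters and the enclosing loop counters, and possibly calls to a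
prover with fixed coins. -/

/-- Index and loop-bound expressions: polynomials in `κ`, `λ`, `d`, `256 / d` and loop counters. -/
inductive Idx : Type
  | lit (k : ℕ)
  | kap
  | lam
  | deg
  | blocks
  | var (x : ℕ)
  | add (a b : Idx)
  | mul (a b : Idx)

/-- The value of an index expression. -/
def Idx.val (P : Params) (env : ℕ → ℕ) : Idx → ℕ
  | lit k => k
  | kap => P.kap
  | lam => P.lam
  | deg => P.d
  | blocks => P.nb
  | var x => env x
  | add a b => a.val P env + b.val P env
  | mul a b => a.val P env * b.val P env

/-- A cell: the number of an array, and a list of indices. -/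
abbrev Loc : Type := ℕ × List Idx

/-- Programs. `gauss i` samples a polynomial with discrete Gaussian coefficients of standard
deviation `𝔰₁` (for `i = 0`), `𝔰₂` (for `i = 1`) or `𝔰₃` (for `i = 2`). `query a` runs the prover on the
challenges `R, d, c` stored in the arrays `a, a + 1, a + 2` and stores its messages
`f, u1, u2, z3, h, w, vTop, vBot, z1, z2` in the arrays `a + 3, …, a + 12`. -/
inductive Prog : Type
  | skip
  | seq (p r : Prog)
  | set (dst a : Loc)
  | one (dst : Loc)
  | gen (dst : Loc)
  | add (dst a b : Loc)
  | mul (dst a b : Loc)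
  | neg (dst a : Loc)
  | inv (dst a : Loc)
  | conj (dst a : Loc)
  | cst (dst a : Loc)
  | unif (dst : Loc)
  | gauss (i : Fin 3) (dst : Loc)
  | tern (dst : Loc)
  | bin (dst : Loc)
  | chal (dst : Loc)
  | ifz (a : Loc) (p r : Prog)
  | loop (x : ℕ) (bound : Idx) (p : Prog)
  | query (a : ℕ)

/-- Memory: arrays of ring elements. -/
abbrev Mem (P : Params) : Type := ℕ → List ℕ → Rq P

/-- The number of steps, in the worst case over conditionals: one step for each ring operation,
sampled ring element, test, loop iteration and query. -/
def Prog.steps (P : Params) : Prog → (ℕ → ℕ) → ℕ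
  | skip, _ => 0
  | seq p r, env => p.steps P env + r.steps P env
  | ifz _ p r, env => 1 + max (p.steps P env) (r.steps P env)
  | loop x b p, env =>
    1 + ∑ i ∈ Finset.range (b.val P env), (1 + p.steps P (Function.update env x i))
  | _, _ => 1

/-- Finite index types with the lists of natural numbers by which they address array cells. -/
class Addr (ι : Type) where
  addr : ι → List ℕ

instance : Addr Unit := ⟨fun _ => []⟩

instance (k : ℕ) : Addr (Fin k) := ⟨fun i => [(i : ℕ)]⟩

instance {ι μ : Type} [Addr ι] [Addr μ] : Addr (ι × μ) :=
  ⟨fun p => Addr.addr p.1 ++ Addr.addr p.2⟩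

instance {ι μ : Type} [Addr ι] [Addr μ] : Addr (ι ⊕ μ) :=
  ⟨Sum.elim (fun i => 0 :: Addr.addr i) (fun j => 1 :: Addr.addr j)⟩

/-- The array that holds a family of ring elements. -/
def store {P : Params} {ι : Type} [Addr ι] (v : ι → Rq P) : List ℕ → Rq P :=
  Function.extend Addr.addr v 0

/-- The family of ring elements held by an array. -/
def load {P : Params} (ι : Type) [Addr ι] (a : List ℕ → Rq P) : ι → Rq P :=
  fun i => a (Addr.addr i)

/-- The array that holds a single ring element. -/
def store1 {P : Params} (v : Rq P) : List ℕ → Rq P := store fun _ : Unit => v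

/-- The single ring element held by an array. -/
def load1 {P : Params} (a : List ℕ → Rq P) : Rq P := load Unit a ()

/-- The effect of a query on the memory. -/
def Prover.answer {P : Params} (o : Prover P) (a : ℕ) (mem : Mem P) : Mem P :=
  let R : RowIdx P → KeyIdx P → Rq P := fun j i => load (RowIdx P × KeyIdx P) (mem a) (j, i)
  let dd : RowIdx P → ZMod P.q := fun j => KeyWF.cst (load (RowIdx P) (mem (a + 1)) j)
  let t := o.transcript R dd (load1 (mem (a + 2)))
  fun k =>
    if k = a + 3 then store t.f
    else if k = a + 4 then store t.u1
    else if k = a + 5 then store1 t.u2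
    else if k = a + 6 then store t.z3
    else if k = a + 7 then store1 t.h
    else if k = a + 8 then store t.w
    else if k = a + 9 then store t.vTop
    else if k = a + 10 then store1 t.vBot
    else if k = a + 11 then store t.z1
    else if k = a + 12 then store t.z2
    else mem k

/-- The content of a cell. -/
def rd {P : Params} (env : ℕ → ℕ) (mem : Mem P) (l : Loc) : Rq P :=
  mem l.1 (l.2.map (Idx.val P env))

/-- Overwriting a cell. -/
def wr {P : Params} (env : ℕ → ℕ) (mem : Mem P) (l : Loc) (v : Rq P) : Mem P :=
  Function.update mem l.1 (Function.update (mem l.1) (l.2.map (Idx.val P env)) v)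

open Classical in
/-- The execution of a program, with the prover `o` as oracle if there is one (otherwise queries do
nothing): the distribution of the final memory. -/
def Prog.run {P : Params} (D : Dists P) (o : Option (Prover P)) :
    Prog → (ℕ → ℕ) → Mem P → PMF (Mem P)
  | skip, _, mem => pure mem
  | seq p r, env, mem => (p.run D o env mem).bind (r.run D o env)
  | set dst a, env, mem => pure (wr env mem dst (rd env mem a))
  | one dst, env, mem => pure (wr env mem dst 1)
  | gen dst, env, mem => pure (wr env mem dst (xx P))
  | add dst a b, env, mem => pure (wr env mem dst (rd env mem a + rd env mem b))
  | mul dst a b, env, mem => pure (wr env mem dst (rd env mem a * rd env mem b))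
  | neg dst a, env, mem => pure (wr env mem dst (-rd env mem a))
  | inv dst a, env, mem => pure (wr env mem dst (Ring.inverse (rd env mem a)))
  | conj dst a, env, mem => pure (wr env mem dst (KeyWF.conj P (rd env mem a)))
  | cst dst a, env, mem =>
    pure (wr env mem dst (algebraMap (ZMod P.q) (Rq P) (KeyWF.cst (rd env mem a))))
  | unif dst, env, mem => (KeyWF.unif P).map (wr env mem dst)
  | gauss i dst, env, mem =>
    (polyOf P (if i = 0 then KeyWF.gauss (sd1 P) (sd1_pos P)
      else if i = 1 then KeyWF.gauss (sd2 P) (sd2_pos P)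
      else KeyWF.gauss (sd3 P) (sd3_pos P))).map (wr env mem dst)
  | tern dst, env, mem => (polyOf P D.chi).map (wr env mem dst)
  | bin dst, env, mem => (polyOf P bin1).map (wr env mem dst)
  | chal dst, env, mem => D.chal.map (wr env mem dst)
  | ifz a p r, env, mem => if rd env mem a = 0 then p.run D o env mem else r.run D o env mem
  | loop x b p, env, mem =>
    (List.range (b.val P env)).foldlM
      (fun mem' i => p.run D o (Function.update env x i) mem') mem
  | query a, _, mem => pure (o.elim mem fun pr' => pr'.answer a mem)

/-- The program runs in time polynomial in the parameters, with exponent and constant `C`. -/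
def Prog.PolyTime (p : Prog) (C : ℕ) : Prop :=
  ∀ P : Params, p.steps P 0 ≤ C * P.size ^ C

/-- The memory that holds a statement: `A`, `pk`, `A₃`, `A₄`, `B'`, `B''` in the arrays `0, …, 5`. -/
def inputMem {P : Params} (A : Matrix (Fin P.kap) (Fin P.n) (Rq P))
    (pk : Fin 2 × Fin P.n → Rq P) (ck : CommKey P) : Mem P := fun k =>
  if k = 0 then store fun p : Fin P.kap × Fin P.n => A p.1 p.2
  else if k = 1 then store pk
  else if k = 2 then store fun p : Fin P.kap × KeyIdx P => ck.A3 p.1 p.2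
  else if k = 3 then store fun p : Fin P.kap × Fin P.n => ck.A4 p.1 p.2
  else if k = 4 then store fun p : Fin P.nb × Fin P.n => ck.B1 p.1 p.2
  else if k = 5 then store ck.B2
  else 0

/-- Reading commitment parameters from the arrays `2, …, 5`. -/
def readCommKey {P : Params} (mem : Mem P) : CommKey P where
  A3 i j := load (Fin P.kap × KeyIdx P) (mem 2) (i, j)
  A4 i j := load (Fin P.kap × Fin P.n) (mem 3) (i, j)
  B1 i j := load (Fin P.nb × Fin P.n) (mem 4) (i, j)
  B2 := load _ (mem 5)

/-- Reading a transcript from the arrays `10, …, 22`. -/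
def readTranscript {P : Params} (mem : Mem P) : Transcript P where
  f := load _ (mem 10)
  u1 := load _ (mem 11)
  u2 := load1 (mem 12)
  R j i := load (RowIdx P × KeyIdx P) (mem 13) (j, i)
  z3 := load _ (mem 14)
  dd j := cst (load (RowIdx P) (mem 15) j)
  h := load1 (mem 16)
  w := load _ (mem 17)
  vTop := load _ (mem 18)
  vBot := load1 (mem 19)
  c := load1 (mem 20)
  z1 := load _ (mem 21)
  z2 := load _ (mem 22)

/-! ### The experiments -/

/-- The extractor `K` run on a statement with black-box access to a prover: its coins are sampled
once and stay fixed, and `K` may run it again and again on challenges of its choice. The result is the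
prover with these coins and the final memory of `K`. -/
def extraction {P : Params} (D : Dists P) (K : Prog) (A : Matrix (Fin P.kap) (Fin P.n) (Rq P))
    (pk : Fin 2 × Fin P.n → Rq P) (ck : CommKey P) (adv : PMF (Prover P)) :
    PMF (Prover P × Mem P) := do
  let a ← adv
  let mem ← K.run D (some a) 0 (inputMem A pk ck)
  pure (a, mem)

/-- The extractor outputs (in the arrays `10, 11, 12`) a witness of the relation, for the
commitment `f` sent by the prover. -/
def FindsWitness {P : Params} (A : Matrix (Fin P.kap) (Fin P.n) (Rq P))
    (pk : Fin 2 × Fin P.n → Rq P) (ck : CommKey P) (o : Prover P × Mem P) : Prop :=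
  RelKW A pk ck o.1.f (load1 (o.2 10)) (load _ (o.2 11)) (load _ (o.2 12))

/-- The extractor outputs (in the array `13`) a solution of the Module-SIS instance `[A₃ | A₄]`. -/
def FindsMSIS {P : Params} (ck : CommKey P) (o : Prover P × Mem P) : Prop :=
  IsMSIS (Matrix.fromCols ck.A3 ck.A4) (msisBound P) (load (KeyIdx P ⊕ Fin P.n) (o.2 13))

/-- The output of the distinguisher `dist` on uniform commitment parameters and the transcript of
an honest execution, or `none` if the prover aborts. -/
def realView {P : Params} (D : Dists P) (A : Matrix (Fin P.kap) (Fin P.n) (Rq P))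
    (m : KeyIdx P → Rq P) (dist : CommKey P → Transcript P → PMF Bool) : PMF (Option Bool) := do
  let ck ← unifCommKey P
  let o ← honestRun D A ck m
  match o with
  | none => pure none
  | some t => (dist ck t).map some

/-- The output of the distinguisher on uniform commitment parameters and the transcript that the
simulator `S` computes from the statement. -/
def simView {P : Params} (D : Dists P) (S : Prog) (A : Matrix (Fin P.kap) (Fin P.n) (Rq P))
    (pk : Fin 2 × Fin P.n → Rq P) (dist : CommKey P → Transcript P → PMF Bool) : PMF Bool := do
  let ck ← unifCommKey P
  let mem ← S.run D none 0 (inputMem A pk ck)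
  dist ck (readTranscript mem)

/-- The distinguishing advantage, for honest executions conditioned on not aborting. -/
def hvzkAdv {P : Params} (D : Dists P) (S : Prog) (A : Matrix (Fin P.kap) (Fin P.n) (Rq P))
    (pk : Fin 2 × Fin P.n → Rq P) (m : KeyIdx P → Rq P)
    (dist : CommKey P → Transcript P → PMF Bool) : ℝ :=
  |pr (realView D A m dist) (· = some true) / pr (realView D A m dist) (fun o => o.isSome = true)
    - pr (simView D S A pk dist) (· = true)|

/-- The row indices of the Module-LWE instance for the stacked matrix `(A₄, B', B'')`. -/
abbrev LweRow (P : Params) : Type := Fin P.kap ⊕ (Fin P.nb ⊕ Unit)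

/-- The Module-LWE adversary that lets the program `Q` turn its instance `(M, t)` (in the arrays
`7` and `8`), the statement and the witness (in the arrays `0`, `1` and `6`) into commitment
parameters and a transcript, and then calls the distinguisher once. -/
def lweAdversary {P : Params} (D : Dists P) (Q : Prog) (A : Matrix (Fin P.kap) (Fin P.n) (Rq P))
    (pk : Fin 2 × Fin P.n → Rq P) (m : KeyIdx P → Rq P)
    (dist : CommKey P → Transcript P → PMF Bool)
    (M : Matrix (LweRow P) (Fin P.n) (Rq P)) (t : LweRow P → Rq P) : PMF Bool := do
  let mem ← Q.run D none 0 fun k =>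
    if k = 0 then store fun p : Fin P.kap × Fin P.n => A p.1 p.2
    else if k = 1 then store pk
    else if k = 6 then store m
    else if k = 7 then store fun p : LweRow P × Fin P.n => M p.1 p.2
    else if k = 8 then store t
    else 0
  dist (readCommKey mem) (readTranscript mem)

end KeyWF

end

/-! Completeness and zero-knowledge rest on one comparison. After rejection, a response `y + v` has
at every point at most a third of the mass of a centred Gaussian (`ex_acc_le`), and if `‖v‖ ≤ 𝔰 /
11` it is kept with probability at least `(1 - exp (-72)) / 3` (`le_ex_acc`). Moreover the messages
`w` and `v` are forced by the verifier's equations, so an honest transcript is a function of `m`,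
the challenges, the responses, `h` and the products `A₄ s`, `B' s`, `B'' s` (`honestTrans_eq`).
Hence non-aborting honest transcripts have at most `1 / 27` of the mass of hybrid transcripts, whose
responses are centred Gaussians independent of `m` and `s` (`ex_honestRun_le`), while their total
mass is at least `(1 - 4 exp (-72)) / 27`.

Completeness: the shifts are short because `‖c m‖ ≤ ‖c‖₁ ‖m‖` (`l2_mul_le`) and because a random
projection `R m` is short with overwhelming probability (`ex_projInt_le`). A hybrid transcript
satisfies all equations, so it is rejected only if a Gaussian response is too long
(`pr_hybRun_not_verify`). The tail bounds come from the sub-Gaussianity of the discrete Gaussian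
(`ex_gauss_exp_le`, by Poisson summation) and from the exponential moment of the square of a
sub-Gaussian variable (`ex_exp_sq_le`).

Knowledge soundness: two accepting runs with the same `R` and `δ` and with `c - c'` invertible yield
an opening `(c - c', m, s)` of `f` that satisfies every part of the relation except possibly the
bound on `‖m‖_∞`. The extractor computes two such openings from independent `(R, δ)`. If they
differ, their cross-multiplied difference solves Module-SIS (`Opens.isMSIS`). If they agree, the
common opening is compatible with challenges independent of the pair that produced it, and for a
long `m` this has probability at most `2⁻²⁵⁶ + 1 / q` (`ex_compat_le`). Each pair of runs costs a
square, so a prover with fixed coins that is accepted with probability `ε` is handled with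
probability at least `(ε - err)⁴` (`pow_four_le_ex_extractor`), and Jensen's inequality averages
this over the coins.

Zero-knowledge: conditioning on not aborting moves the distinguisher's output probability by at most
`2⁻¹⁰⁰` from its hybrid value (`abs_realView_sub_le`). Hybrid transcripts use the randomness `s`
only through `A₄ s`, `B' s`, `B'' s`, a Module-LWE vector; once this vector is uniform it hides the
secret, and the transcript is the simulated one (`ex_mask`, `mlweAdv_eq`).

The extractor, simulator and reduction must be explicit programs. Every program runs in polynomial
time (`Prog.exists_polyTime`), and a small compiler for array expressions (`Exp.compile_run`,
`assign_run`, `ex_sampleArr`) reduces the correctness of these programs to identities between ring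
elements. -/

noncomputable section

namespace KeyWF

open scoped ENNReal

/-! ### Expectations of extended nonnegative functions -/

/-- The expectation of `F` under `p`. -/
def ex {α : Type} (p : PMF α) (F : α → ℝ≥0∞) : ℝ≥0∞ := ∑' a, p a * F a

section Ex

variable {α β γ : Type}

theorem ex_pure (a : α) (F : α → ℝ≥0∞) : ex (pure a) F = F a := by
  classical
  unfold ex
  rw [tsum_eq_single a]
  · have : (pure a : PMF α) a = 1 := by
      change PMF.pure a a = 1
      simp
    rw [this, one_mul]
  · intro b hb
    have : (pure a : PMF α) b = 0 := by
      change PMF.pure a b = 0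
      simp [hb]
    rw [this, zero_mul]

theorem ex_mul_left (p : PMF α) (c : ℝ≥0∞) (F : α → ℝ≥0∞) :
    ex p (fun a => c * F a) = c * ex p F := by
  unfold ex
  rw [← ENNReal.tsum_mul_left]
  exact tsum_congr fun a => by ring

theorem ex_mul_right (p : PMF α) (c : ℝ≥0∞) (F : α → ℝ≥0∞) :
    ex p (fun a => F a * c) = ex p F * c := by
  simp_rw [mul_comm _ c, ex_mul_left]

theorem ex_const (p : PMF α) (c : ℝ≥0∞) : ex p (fun _ => c) = c := by
  unfold ex
  rw [ENNReal.tsum_mul_right, p.tsum_coe, one_mul]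

theorem ex_add (p : PMF α) (F G : α → ℝ≥0∞) :
    ex p (fun a => F a + G a) = ex p F + ex p G := by
  unfold ex
  simp_rw [mul_add]
  exact ENNReal.tsum_add

theorem ex_mono_support {p : PMF α} {F G : α → ℝ≥0∞} (h : ∀ a ∈ p.support, F a ≤ G a) :
    ex p F ≤ ex p G := by
  refine ENNReal.tsum_le_tsum fun a => ?_
  by_cases ha : a ∈ p.support
  · exact mul_le_mul_right (h a ha) _
  · rw [PMF.mem_support_iff, not_not] at ha
    simp [ha]

theorem ex_mono {p : PMF α} {F G : α → ℝ≥0∞} (h : ∀ a, F a ≤ G a) : ex p F ≤ ex p G :=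
  ex_mono_support fun a _ => h a

theorem ex_congr_support {p : PMF α} {F G : α → ℝ≥0∞} (h : ∀ a ∈ p.support, F a = G a) :
    ex p F = ex p G :=
  le_antisymm (ex_mono_support fun a ha => (h a ha).le) (ex_mono_support fun a ha => (h a ha).ge)

theorem ex_congr {p : PMF α} {F G : α → ℝ≥0∞} (h : ∀ a, F a = G a) : ex p F = ex p G :=
  ex_congr_support fun a _ => h a

theorem ex_le_const {p : PMF α} {F : α → ℝ≥0∞} {c : ℝ≥0∞} (h : ∀ a, F a ≤ c) : ex p F ≤ c :=
  (ex_mono h).trans (ex_const p c).le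

theorem ex_bind (p : PMF α) (f : α → PMF β) (F : β → ℝ≥0∞) :
    ex (p >>= f) F = ex p fun a => ex (f a) F := by
  change ex (p.bind f) F = _
  unfold ex
  simp_rw [PMF.bind_apply, ← ENNReal.tsum_mul_right, ← ENNReal.tsum_mul_left]
  rw [ENNReal.tsum_comm]
  exact tsum_congr fun a => tsum_congr fun b => by ring

theorem ex_map (p : PMF α) (f : α → β) (F : β → ℝ≥0∞) :
    ex (p.map f) F = ex p fun a => F (f a) := by
  have h := ex_bind p (fun a => pure (f a)) F
  simp_rw [ex_pure] at h
  exact h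

theorem ex_comm (p : PMF α) (q : PMF β) (F : α → β → ℝ≥0∞) :
    (ex p fun a => ex q fun b => F a b) = ex q fun b => ex p fun a => F a b := by
  unfold ex
  simp_rw [← ENNReal.tsum_mul_left]
  rw [ENNReal.tsum_comm]
  exact tsum_congr fun a => tsum_congr fun b => by ring

/-- The indicator of an event. -/
def ind (E : Prop) : ℝ≥0∞ := by classical exact if E then 1 else 0

theorem ind_of {E : Prop} (h : E) : ind E = 1 := by simp [ind, h]

theorem ind_not {E : Prop} (h : ¬E) : ind E = 0 := by simp [ind, h]

theorem ind_le_one (E : Prop) : ind E ≤ 1 := by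
  by_cases h : E
  · rw [ind_of h]
  · simp [ind_not h]

theorem ind_mono {E E' : Prop} (h : E → E') : ind E ≤ ind E' := by
  by_cases hE : E
  · rw [ind_of hE, ind_of (h hE)]
  · simp [ind_not hE]

theorem ind_add_ind_not (E : Prop) : ind E + ind (¬E) = 1 := by
  by_cases h : E
  · rw [ind_of h, ind_not (not_not.2 h), add_zero]
  · rw [ind_of h, ind_not h, zero_add]

theorem ind_or_le (E E' : Prop) : ind (E ∨ E') ≤ ind E + ind E' := by
  by_cases h : E
  · rw [ind_of h, ind_of (Or.inl h)]; exact le_self_add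
  · rw [ind_not h, zero_add]; exact ind_mono fun h' => h'.resolve_left h

theorem ex_ind_add_not (p : PMF α) (E : α → Prop) :
    ex p (fun a => ind (E a)) + ex p (fun a => ind (¬E a)) = 1 := by
  rw [← ex_add]
  simp_rw [ind_add_ind_not]
  exact ex_const p 1

theorem toOuterMeasure_eq_ex (p : PMF α) (E : α → Prop) :
    p.toOuterMeasure {a | E a} = ex p fun a => ind (E a) := by
  classical
  rw [PMF.toOuterMeasure_apply]
  unfold ex
  refine tsum_congr fun a => ?_
  beta_reduce
  by_cases h : E a
  · rw [ind_of h, Set.indicator_of_mem (by exact h), mul_one]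
  · rw [ind_not h, Set.indicator_of_notMem (by exact h), mul_zero]

theorem pr_eq (p : PMF α) (E : α → Prop) : pr p E = (ex p fun a => ind (E a)).toReal := by
  rw [pr, toOuterMeasure_eq_ex]

theorem ex_ind_le_one (p : PMF α) (E : α → Prop) : (ex p fun a => ind (E a)) ≤ 1 :=
  ex_le_const fun _ => ind_le_one _

theorem ex_ind_ne_top (p : PMF α) (E : α → Prop) : (ex p fun a => ind (E a)) ≠ ⊤ :=
  ne_top_of_le_ne_top ENNReal.one_ne_top (ex_ind_le_one p E)

theorem ofReal_pr (p : PMF α) (E : α → Prop) :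
    ENNReal.ofReal (pr p E) = ex p fun a => ind (E a) := by
  rw [pr_eq, ENNReal.ofReal_toReal (ex_ind_ne_top p E)]

theorem ex_ind_eq [DecidableEq α] (p : PMF α) (a : α) : (ex p fun b => ind (b = a)) = p a := by
  unfold ex
  rw [tsum_eq_single a]
  · beta_reduce
    rw [ind_of rfl, mul_one]
  · intro b hb
    beta_reduce
    rw [ind_not hb, mul_zero]

theorem PMF_ext_ex {p q : PMF α} (h : ∀ F, ex p F = ex q F) : p = q := by
  classical
  ext a
  rw [← ex_ind_eq p, ← ex_ind_eq q, h]

/-- Markov's inequality. -/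
theorem ex_ind_le_of_le {p : PMF α} {E : α → Prop} {F : α → ℝ≥0∞} {c : ℝ≥0∞}
    (hF : ∀ a, E a → 1 ≤ c * F a) : (ex p fun a => ind (E a)) ≤ c * ex p F := by
  rw [← ex_mul_left]
  refine ex_mono fun a => ?_
  by_cases h : E a
  · rw [ind_of h]; exact hF a h
  · rw [ind_not h]; exact zero_le

/-- Jensen's inequality for the square. -/
theorem sq_ex_le (p : PMF α) (F : α → ℝ≥0∞) (hF : ∀ a, F a ≤ 1) :
    ex p F ^ 2 ≤ ex p fun a => F a ^ 2 := by
  obtain ⟨e, he⟩ : ∃ e, e = ex p F := ⟨_, rfl⟩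
  rw [← he]
  have he1 : e ≤ 1 := he.le.trans (ex_le_const hF)
  have het : e ^ 2 ≠ ⊤ :=
    ENNReal.pow_ne_top (ne_top_of_le_ne_top ENNReal.one_ne_top he1)
  have h : ex p (fun a => 2 * e * F a) ≤ ex p fun a => e ^ 2 + F a ^ 2 := by
    refine ex_mono fun a => ?_
    have h1 : F a ≠ ⊤ := ne_top_of_le_ne_top ENNReal.one_ne_top (hF a)
    have h2 : e ≠ ⊤ := ne_top_of_le_ne_top ENNReal.one_ne_top he1
    generalize F a = f at h1
    clear he
    lift e to NNReal using h2
    lift f to NNReal using h1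
    norm_cast
    exact two_mul_le_add_sq e f
  rw [ex_mul_left, ex_add, ex_const, ← he] at h
  have h3 : e ^ 2 + e ^ 2 ≤ e ^ 2 + ex p fun a => F a ^ 2 := by
    refine le_trans (le_of_eq ?_) h
    ring
  exact (ENNReal.add_le_add_iff_left het).1 h3

/-- Jensen's inequality for squares, used twice. It averages the extractor's success over the coins
of the prover. -/
theorem pow_four_ex_le (p : PMF α) (F : α → ℝ≥0∞) (hF : ∀ a, F a ≤ 1) :
    ex p F ^ 4 ≤ ex p fun a => F a ^ 4 := by
  have h1 := sq_ex_le p F hF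
  have h2 := sq_ex_le p (fun a => F a ^ 2) fun a => pow_le_one' (hF a) 2
  calc ex p F ^ 4 = (ex p F ^ 2) ^ 2 := by ring
    _ ≤ (ex p fun a => F a ^ 2) ^ 2 := by gcongr
    _ ≤ _ := h2
    _ = _ := by congr 1; funext a; ring

/-- Subtraction is truncated at `0`, which can only raise the values under the expectation. -/
theorem ex_tsub_le (p : PMF α) (F : α → ℝ≥0∞) (c : ℝ≥0∞) :
    ex p F - c ≤ ex p fun a => F a - c := by
  rw [tsub_le_iff_right]
  nth_rewrite 2 [← ex_const p c]
  rw [← ex_add]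
  exact ex_mono fun a => le_tsub_add

end Ex

/-! ### Independent samples -/

section Iid

variable {α β ι μ : Type} [Fintype ι] [Fintype μ]

theorem tsum_fin_pi : ∀ (m : ℕ) (g : Fin m → α → ℝ≥0∞),
    ∑' f : Fin m → α, ∏ i, g i (f i) = ∏ i, ∑' a, g i a
  | 0, g => by simp
  | m + 1, g => by
    rw [← (Fin.consEquiv fun _ : Fin (m + 1) => α).tsum_eq]
    simp only [Fin.consEquiv, Equiv.coe_fn_mk, Fin.prod_univ_succ, Fin.cons_zero, Fin.cons_succ]
    rw [ENNReal.tsum_prod (f := fun a (f : Fin m → α) => g 0 a * ∏ i : Fin m, g i.succ (f i))]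
    simp_rw [ENNReal.tsum_mul_left, tsum_fin_pi m fun i => g i.succ, ENNReal.tsum_mul_right]

theorem tsum_pi (g : ι → α → ℝ≥0∞) :
    ∑' f : ι → α, ∏ i, g i (f i) = ∏ i, ∑' a, g i a := by
  classical
  let E : (ι → α) ≃ (Fin (Fintype.card ι) → α) :=
    Equiv.arrowCongr (Fintype.equivFin ι) (Equiv.refl α)
  have h (f : ι → α) : ∏ i, g i (f i) = ∏ j, g ((Fintype.equivFin ι).symm j) (E f j) :=
    Fintype.prod_equiv (Fintype.equivFin ι) _ _ fun i => by simp [E]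
  rw [tsum_congr h, E.tsum_eq fun f : Fin (Fintype.card ι) → α => ∏ j, g ((Fintype.equivFin ι).symm j) (f j), tsum_fin_pi]
  exact Fintype.prod_equiv (Fintype.equivFin ι).symm _ _ fun _ => rfl

theorem iid_apply (p : PMF α) (f : ι → α) : iid p ι f = ∏ i, p (f i) := rfl

theorem ex_iid_prod (p : PMF α) (g : ι → α → ℝ≥0∞) :
    ex (iid p ι) (fun f => ∏ i, g i (f i)) = ∏ i, ex p (g i) := by
  unfold ex
  rw [← tsum_pi (ι := ι) (fun i a => p a * g i a)]
  exact tsum_congr fun f => by rw [iid_apply, Finset.prod_mul_distrib]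

theorem ind_forall {ι : Type} [Fintype ι] (E : ι → Prop) : ind (∀ i, E i) = ∏ i, ind (E i) := by
  by_cases h : ∀ i, E i
  · rw [ind_of h]
    exact (Finset.prod_eq_one fun i _ => ind_of (h i)).symm
  · rw [ind_not h]
    push Not at h
    obtain ⟨i, hi⟩ := h
    exact (Finset.prod_eq_zero (Finset.mem_univ i) (ind_not hi)).symm

theorem ex_iid_forall (p : PMF α) (E : ι → α → Prop) :
    ex (iid p ι) (fun f => ind (∀ i, E i (f i))) = ∏ i, ex p fun a => ind (E i a) := by
  simp_rw [ind_forall]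
  exact ex_iid_prod p fun i a => ind (E i a)

theorem ex_iid_map (p : PMF α) (f : α → β) (F : (ι → β) → ℝ≥0∞) :
    ex (iid (p.map f) ι) F = ex (iid p ι) fun v => F fun i => f (v i) := by
  classical
  have h : iid (p.map f) ι = (iid p ι).map fun v i => f (v i) := by
    ext w
    rw [iid_apply, ← ex_ind_eq ((iid p ι).map fun v i => f (v i)), ex_map]
    simp_rw [funext_iff]
    rw [ex_iid_forall p fun i a => f a = w i]
    refine Finset.prod_congr rfl fun i _ => ?_
    rw [← ex_ind_eq (p.map f), ex_map]
  rw [h, ex_map]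

/-- This is the tool for conditioning on all coordinates but one: a single random entry of `R` or
`δ` is exposed while the others stay frozen. It holds because point masses of a product law factor
over the coordinates. -/
theorem ex_iid_update [DecidableEq ι] (p : PMF α) (i : ι) (F : (ι → α) → ℝ≥0∞) :
    (ex p fun x => ex (iid p ι) fun v => F (Function.update v i x)) = ex (iid p ι) F := by
  classical
  have h : (p >>= fun x => (iid p ι).map fun v => Function.update v i x) = iid p ι := by
    ext w
    rw [← ex_ind_eq (p >>= fun x => (iid p ι).map fun v => Function.update v i x), ex_bind]
    simp_rw [ex_map]
    have h1 (x : α) (v : ι → α) : ind (Function.update v i x = w)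
        = ind (x = w i) * ind (∀ j, j ≠ i → v j = w j) := by
      by_cases hx : x = w i ∧ ∀ j, j ≠ i → v j = w j
      · rw [ind_of hx.1, ind_of hx.2, ind_of, one_mul]
        exact Function.update_eq_iff.2 ⟨hx.1, fun j hj => hx.2 j hj⟩
      · rw [ind_not (fun h => hx (by
          obtain ⟨h1, h2⟩ := Function.update_eq_iff.1 h
          exact ⟨h1, fun j hj => h2 j hj⟩))]
        rw [not_and_or] at hx
        rcases hx with hx | hx <;> simp [ind_not hx]
    simp_rw [h1, ex_mul_left, ex_mul_right, ex_ind_eq]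
    rw [ex_iid_forall p fun j a => j ≠ i → a = w j, iid_apply,
      ← Finset.mul_prod_erase _ _ (Finset.mem_univ i),
      ← Finset.mul_prod_erase (Finset.univ) (fun j => p (w j)) (Finset.mem_univ i)]
    congr 1
    have h2 : ex p (fun a => ind (i ≠ i → a = w i)) = 1 := by
      simp_rw [ne_eq, not_true, false_imp_iff, ind_of True.intro]
      exact ex_const p 1
    rw [h2, one_mul]
    refine Finset.prod_congr rfl fun j hj => ?_
    rw [← ex_ind_eq p]
    simp [Finset.ne_of_mem_erase hj]
  conv_rhs => rw [← h]
  rw [ex_bind]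
  simp_rw [ex_map]

theorem ex_iid_curry (p : PMF α) (F : (ι → μ → α) → ℝ≥0∞) :
    ex (iid (iid p μ) ι) F = ex (iid p (ι × μ)) fun v => F fun i j => v (i, j) := by
  unfold ex
  rw [← (Equiv.curry ι μ α).tsum_eq]
  refine tsum_congr fun v => ?_
  congr 1
  simp_rw [iid_apply, Fintype.prod_prod_type]
  rfl

theorem ex_iid_sum (p : PMF α) (F : (ι ⊕ μ → α) → ℝ≥0∞) :
    ex (iid p (ι ⊕ μ)) F = ex (iid p ι) fun a => ex (iid p μ) fun b => F (Sum.elim a b) := by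
  unfold ex
  rw [← (Equiv.sumArrowEquivProdArrow ι μ α).symm.tsum_eq, ENNReal.tsum_prod']
  refine tsum_congr fun a => ?_
  rw [← ENNReal.tsum_mul_left]
  refine tsum_congr fun b => ?_
  rw [← mul_assoc]
  congr 1
  simp [iid_apply, Equiv.sumArrowEquivProdArrow]

theorem ex_iid_unit (p : PMF α) (F : (Unit → α) → ℝ≥0∞) :
    ex (iid p Unit) F = ex p fun a => F fun _ => a := by
  unfold ex
  rw [← (Equiv.funUnique Unit α).symm.tsum_eq]
  exact tsum_congr fun a => by simp [iid_apply]; rfl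

theorem mem_support_iid {p : PMF α} {v : ι → α} (h : v ∈ (iid p ι).support) (i : ι) :
    v i ∈ p.support := by
  rw [PMF.mem_support_iff, iid_apply] at h
  rw [PMF.mem_support_iff]
  exact fun h0 => h (Finset.prod_eq_zero (Finset.mem_univ i) h0)

/-- A distribution that is invariant under a translation has invariant independent copies. -/
theorem ex_iid_shift [AddGroup α] {p : PMF α} (hp : ∀ b F, ex p (fun a => F (a + b)) = ex p F)
    (w : ι → α) (F : (ι → α) → ℝ≥0∞) :
    ex (iid p ι) (fun v => F (v + w)) = ex (iid p ι) F := by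
  classical
  have hp' (a b : α) : p (a - b) = p a := by
    rw [← ex_ind_eq p a, ← hp b, ← ex_ind_eq p (a - b)]
    simp_rw [eq_sub_iff_add_eq]
  unfold ex
  rw [← (Equiv.subRight w).tsum_eq]
  refine tsum_congr fun v => ?_
  simp only [Equiv.subRight_apply, sub_add_cancel]
  congr 1
  simp_rw [iid_apply, Pi.sub_apply, hp']

end Iid

/-! ### Coefficients of ring elements -/

section Ring

variable {P : Params}

theorem coef_add (a b : Rq P) (k : Fin P.d) : coef (a + b) k = coef a k + coef b k := by
  simp [coef]

theorem coef_smul (r : ZMod P.q) (a : Rq P) (k : Fin P.d) : coef (r • a) k = r * coef a k := by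
  simp [coef]

theorem coef_zero (k : Fin P.d) : coef (0 : Rq P) k = 0 := by
  simp [coef]

theorem coef_neg (a : Rq P) (k : Fin P.d) : coef (-a) k = -coef a k := by
  simp [coef]

theorem coef_sub (a b : Rq P) (k : Fin P.d) : coef (a - b) k = coef a k - coef b k := by
  simp [coef]

theorem coef_sum {ι : Type} (s : Finset ι) (a : ι → Rq P) (k : Fin P.d) :
    coef (∑ i ∈ s, a i) k = ∑ i ∈ s, coef (a i) k := by
  classical
  induction s using Finset.induction_on with
  | empty => simp [coef_zero]
  | insert i s hi ih => rw [Finset.sum_insert hi, Finset.sum_insert hi, coef_add, ih]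

theorem natDegree_modulus (P : Params) :
    (Polynomial.X ^ P.d + 1 : Polynomial (ZMod P.q)).natDegree = P.d := by
  simpa using Polynomial.natDegree_X_pow_add_C (n := P.d) (r := (1 : ZMod P.q))

theorem coef_xx_pow {j : ℕ} (hj : j < P.d) (k : Fin P.d) :
    coef (xx P ^ j) k = if j = k then 1 else 0 := by
  have h : xx P ^ j = AdjoinRoot.mk _ (Polynomial.X ^ j) := by
    simp [xx]
  rw [coef, h, AdjoinRoot.modByMonicHom_mk, (Polynomial.modByMonic_eq_self_iff
    (monic_modulus P)).2]
  · rw [Polynomial.coeff_X_pow]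
    simp only [eq_comm]
  · rw [Polynomial.degree_X_pow, Polynomial.degree_eq_natDegree (monic_modulus P).ne_zero,
      natDegree_modulus]
    exact_mod_cast hj

theorem ofCoef_eq (a : Fin P.d → ZMod P.q) : ofCoef a = ∑ k, a k • xx P ^ (k : ℕ) := by
  simp [ofCoef, Algebra.smul_def]

theorem coef_ofCoef (a : Fin P.d → ZMod P.q) (k : Fin P.d) : coef (ofCoef a) k = a k := by
  rw [ofCoef_eq, coef_sum]
  simp_rw [coef_smul, coef_xx_pow (Fin.is_lt _), Fin.val_inj]
  simp

theorem ofCoef_coef (a : Rq P) : ofCoef (coef a) = a := by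
  have h := AdjoinRoot.mk_leftInverse (monic_modulus P) a
  rw [ofCoef_eq]
  conv_rhs => rw [← h]
  set p := AdjoinRoot.modByMonicHom (monic_modulus P) a with hp
  have hdeg : p.natDegree < P.d := by
    obtain ⟨f, rfl⟩ := AdjoinRoot.mk_surjective a
    rw [hp, AdjoinRoot.modByMonicHom_mk]
    have h2 := natDegree_modulus P
    refine (Polynomial.natDegree_modByMonic_lt f (monic_modulus P) fun h1 => ?_).trans_eq h2
    rw [h1, Polynomial.natDegree_one] at h2
    exact P.d_pos.ne h2
  conv_rhs => rw [Polynomial.as_sum_range' p P.d hdeg]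
  rw [map_sum, Finset.sum_range]
  refine Finset.sum_congr rfl fun k _ => ?_
  rw [← Polynomial.C_mul_X_pow_eq_monomial, map_mul, map_pow, AdjoinRoot.mk_C, AdjoinRoot.mk_X,
    Algebra.smul_def]
  rfl

theorem coef_injective {a b : Rq P} (h : ∀ k, coef a k = coef b k) : a = b := by
  rw [← ofCoef_coef a, ← ofCoef_coef b, funext h]

theorem eq_sum_xx (a : Rq P) : a = ∑ k, coef a k • xx P ^ (k : ℕ) := by
  rw [← ofCoef_eq, ofCoef_coef]

theorem coef_algebraMap (r : ZMod P.q) (k : Fin P.d) :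
    coef (algebraMap (ZMod P.q) (Rq P) r) k = if k = 0 then r else 0 := by
  rw [Algebra.algebraMap_eq_smul_one, ← pow_zero (xx P), coef_smul, coef_xx_pow P.d_pos]
  simp only [← Fin.val_eq_zero_iff, eq_comm (a := 0)]
  simp

theorem cst_algebraMap (r : ZMod P.q) : cst (algebraMap (ZMod P.q) (Rq P) r) = r := by
  rw [cst, coef_algebraMap, if_pos rfl]

theorem cst_add (a b : Rq P) : cst (a + b) = cst a + cst b := coef_add a b 0

theorem cst_sub (a b : Rq P) : cst (a - b) = cst a - cst b := coef_sub a b 0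

theorem cst_smul (r : ZMod P.q) (a : Rq P) : cst (r • a) = r * cst a := coef_smul r a 0

theorem cst_sum {ι : Type} (s : Finset ι) (a : ι → Rq P) :
    cst (∑ i ∈ s, a i) = ∑ i ∈ s, cst (a i) := coef_sum s a 0

/-- The negacyclic shift: the top coefficient wraps around with a sign since `X ^ d = -1`.
Multiplication by `X` is therefore an isometry for the Euclidean norm, which leads to `l2_mul_le`.
-/
theorem coef_xx_mul (a : Rq P) (k : Fin P.d) :
    coef (xx P * a) k
      = if (k : ℕ) = 0 then -coef a ⟨P.d - 1, Nat.sub_lt P.d_pos one_pos⟩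
        else coef a ⟨k - 1, (Nat.sub_le _ _).trans_lt k.2⟩ := by
  have h1 (j : Fin P.d) : coef (xx P * xx P ^ (j : ℕ)) k
      = if (k : ℕ) = 0 then (if (j : ℕ) = P.d - 1 then -1 else 0)
        else (if (j : ℕ) = k - 1 then 1 else 0) := by
    rw [← pow_succ']
    have hk := k.2
    have hj := j.2
    by_cases h : (j : ℕ) + 1 < P.d
    · rw [coef_xx_pow h]
      split_ifs <;> first | rfl | omega
    · have h' : (j : ℕ) + 1 = P.d := by omega
      rw [h', xx_pow, coef_neg, ← pow_zero (xx P), coef_xx_pow P.d_pos]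
      split_ifs <;> first | rfl | omega | simp
  conv_lhs => rw [eq_sum_xx a, Finset.mul_sum, coef_sum]
  simp_rw [mul_smul_comm, coef_smul, h1]
  split_ifs with h
  · rw [Finset.sum_eq_single ⟨P.d - 1, Nat.sub_lt P.d_pos one_pos⟩]
    · simp
    · intro j _ hj
      rw [if_neg fun h => hj (Fin.ext h), mul_zero]
    · simp
  · rw [Finset.sum_eq_single ⟨k - 1, (Nat.sub_le _ _).trans_lt k.2⟩]
    · simp
    · intro j _ hj
      rw [if_neg fun h => hj (Fin.ext h), mul_zero]
    · simp

/-! ### The automorphism and constant coefficients of products -/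

theorem conj_xx : conj P (xx P) = -xx P ^ (P.d - 1) := by
  simp [conj, xx]

theorem conj_xx_mul : conj P (xx P) * xx P = 1 := by
  rw [conj_xx, neg_mul, ← pow_succ, Nat.sub_add_cancel P.d_pos, xx_pow, neg_neg]

/-- It is enough to test monomials `X ^ l`. For `l ≥ j` the product is `X ^ (l - j)`; for `l < j` it
is `-X ^ (d - (j - l))`, which has no constant term. -/
theorem cst_conj_xx_mul : ∀ (j : ℕ) (_ : j < P.d) (b : Rq P) ,
    ∀ i : Fin P.d, (i : ℕ) = j → cst (conj P (xx P ^ j) * b) = coef b i := by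
  intro j hj b i hi
  have h1 (l : Fin P.d) : cst (conj P (xx P ^ j) * xx P ^ (l : ℕ)) = if l = i then 1 else 0 := by
    rw [map_pow, cst]
    rcases le_or_gt j l with hl | hl
    · obtain ⟨r, hr⟩ := Nat.exists_eq_add_of_le hl
      have hr' : r < P.d := by omega
      rw [hr, pow_add, ← mul_assoc, ← mul_pow, conj_xx_mul, one_pow, one_mul, coef_xx_pow hr']
      have h0 : ((0 : Fin P.d) : ℕ) = 0 := by simp
      have h2 : r = ((0 : Fin P.d) : ℕ) ↔ l = i := by
        rw [h0, Fin.ext_iff, hi]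
        omega
      simp only [h2]
    · have h2 : conj P (xx P) ^ j * xx P ^ (l : ℕ) = conj P (xx P) ^ (j - l) := by
        conv_lhs => rw [show j = (j - l) + l by omega, pow_add, mul_assoc, ← mul_pow, conj_xx_mul,
          one_pow, mul_one]
      have h3 : conj P (xx P) ^ (j - l) = -xx P ^ (P.d - (j - l)) := by
        have h4 : conj P (xx P) ^ (j - l) * (xx P ^ (j - l) * xx P ^ (P.d - (j - l)))
            = xx P ^ (P.d - (j - l)) := by
          rw [← mul_assoc, ← mul_pow, conj_xx_mul, one_pow, one_mul]
        rw [← pow_add, show j - l + (P.d - (j - l)) = P.d by omega, xx_pow] at h4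
        rw [← h4, mul_neg, mul_one, neg_neg]
      have hd : P.d - (j - l) < P.d := by omega
      rw [h2, h3, coef_neg, coef_xx_pow hd, if_neg, if_neg, neg_zero]
      · intro h; rw [h] at hl; omega
      · simp only [Fin.val_zero]; omega
  conv_lhs => rw [eq_sum_xx b, Finset.mul_sum, cst_sum]
  simp_rw [mul_smul_comm, cst_smul, h1]
  simp

/-- This is the reason for `σ₋₁` in the protocol: integer inner products of coefficient vectors
become constant coefficients of ring products, so that claims about `R m` can be checked by
equations over `R_q`. -/
theorem cst_conj_mul (a b : Rq P) : cst (conj P a * b) = ∑ k, coef a k * coef b k := by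
  conv_lhs => rw [eq_sum_xx a, map_sum, Finset.sum_mul, cst_sum]
  refine Finset.sum_congr rfl fun k _ => ?_
  rw [map_smul, smul_mul_assoc, cst_smul, cst_conj_xx_mul k k.2 b k rfl]

theorem cst_conjDot {ι : Type} [Fintype ι] (a b : ι → Rq P) :
    cst (conjDot a b) = ∑ i, ∑ k, coef (a i) k * coef (b i) k := by
  rw [conjDot, cst_sum]
  exact Finset.sum_congr rfl fun i _ => cst_conj_mul _ _

theorem cst_conjDot_row (R : RowIdx P → KeyIdx P → Rq P) (m : KeyIdx P → Rq P) (j : RowIdx P) :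
    cst (conjDot (R j) m) = rowProd R m j := cst_conjDot _ _

theorem conjDot_unitVec (j : RowIdx P) (b : Fin P.nb → Rq P) :
    conjDot (unitVec j) b = conj P (xx P ^ (j.2 : ℕ)) * b j.1 := by
  rw [conjDot, Finset.sum_eq_single j.1]
  · simp [unitVec]
  · intro i _ hi
    simp [unitVec, Pi.single_eq_of_ne hi]
  · simp

theorem cst_conjDot_unitVec (j : RowIdx P) (b : Fin P.nb → Rq P) :
    cst (conjDot (unitVec j) b) = coef (b j.1) j.2 := by
  rw [conjDot_unitVec, cst_conj_xx_mul _ j.2.2 _ j.2 rfl]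

section ConjDot

variable {ι : Type} [Fintype ι]

theorem conjDot_add (a b c : ι → Rq P) : conjDot a (b + c) = conjDot a b + conjDot a c := by
  simp [conjDot, mul_add, Finset.sum_add_distrib]

theorem conjDot_smul (a b : ι → Rq P) (c : Rq P) : conjDot a (c • b) = c * conjDot a b := by
  simp only [conjDot, Finset.mul_sum, Pi.smul_apply, smul_eq_mul]
  exact Finset.sum_congr rfl fun i _ => by ring

theorem conjDot_neg (a b : ι → Rq P) : conjDot a (-b) = -conjDot a b := by
  simp [conjDot]

end ConjDot

/-- The linear form of the third round is linear. -/
theorem lastRow_add (R : RowIdx P → KeyIdx P → Rq P) (dd : RowIdx P → ZMod P.q)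
    (a a' : KeyIdx P → Rq P) (b b' : Fin P.nb → Rq P) (g g' : Rq P) :
    lastRow R dd (a + a') (b + b') (g + g') = lastRow R dd a b g + lastRow R dd a' b' g' := by
  simp only [lastRow, conjDot_add, smul_add, Finset.sum_add_distrib]
  ring

theorem lastRow_smul (R : RowIdx P → KeyIdx P → Rq P) (dd : RowIdx P → ZMod P.q) (c : Rq P)
    (a : KeyIdx P → Rq P) (b : Fin P.nb → Rq P) (g : Rq P) :
    lastRow R dd (c • a) (c • b) (c * g) = c * lastRow R dd a b g := by
  simp only [lastRow, conjDot_smul, mul_add, Finset.mul_sum, mul_smul_comm]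

theorem lastRow_neg (R : RowIdx P → KeyIdx P → Rq P) (dd : RowIdx P → ZMod P.q)
    (a : KeyIdx P → Rq P) (b : Fin P.nb → Rq P) (g : Rq P) :
    lastRow R dd (-a) (-b) (-g) = -lastRow R dd a b g := by
  simp only [lastRow, conjDot_neg, smul_neg, Finset.sum_neg_distrib]
  ring

theorem lastRow_sub (R : RowIdx P → KeyIdx P → Rq P) (dd : RowIdx P → ZMod P.q)
    (a a' : KeyIdx P → Rq P) (b b' : Fin P.nb → Rq P) (g g' : Rq P) :
    lastRow R dd (a - a') (b - b') (g - g') = lastRow R dd a b g - lastRow R dd a' b' g' := by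
  simp only [sub_eq_add_neg, lastRow_add, lastRow_neg]

theorem cst_lastRow (R : RowIdx P → KeyIdx P → Rq P) (dd : RowIdx P → ZMod P.q)
    (a : KeyIdx P → Rq P) (b : Fin P.nb → Rq P) (g : Rq P) :
    cst (lastRow R dd a b g) = ∑ j, dd j * (rowProd R a j + coef (b j.1) j.2) + cst g := by
  simp only [lastRow, cst_add, cst_sum, cst_smul, cst_conjDot_row, cst_conjDot_unitVec, mul_add,
    Finset.sum_add_distrib]

theorem keyMap_add (A : Matrix (Fin P.kap) (Fin P.n) (Rq P)) (m m' : KeyIdx P → Rq P) :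
    keyMap A (m + m') = keyMap A m + keyMap A m' := by
  funext p
  simp only [keyMap, Matrix.mulVec, dotProduct, Pi.add_apply, mul_add, Finset.sum_add_distrib]
  ring

theorem keyMap_smul (A : Matrix (Fin P.kap) (Fin P.n) (Rq P)) (c : Rq P) (m : KeyIdx P → Rq P) :
    keyMap A (c • m) = c • keyMap A m := by
  funext p
  simp only [keyMap, Matrix.mulVec, dotProduct, Pi.smul_apply, smul_eq_mul, mul_add,
    Finset.mul_sum, mul_left_comm]

theorem keyMap_sub (A : Matrix (Fin P.kap) (Fin P.n) (Rq P)) (m m' : KeyIdx P → Rq P) :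
    keyMap A (m - m') = keyMap A m - keyMap A m' := by
  rw [eq_sub_iff_add_eq, ← keyMap_add, sub_add_cancel]

/-! ### Norms -/

theorem ofCoef_add (a b : Fin P.d → ZMod P.q) : ofCoef (a + b) = ofCoef a + ofCoef b := by
  simp [ofCoef_eq, add_smul, Finset.sum_add_distrib]

theorem ofInt_add (a b : Fin P.d → ℤ) : (ofInt (a + b) : Rq P) = ofInt a + ofInt b := by
  rw [ofInt, ofInt, ofInt, ← ofCoef_add]
  congr 1
  funext k
  simp

theorem coef_ofInt (a : Fin P.d → ℤ) (k : Fin P.d) : coef (ofInt a : Rq P) k = a k :=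
  coef_ofCoef _ _

theorem ofInt_lift (a : Rq P) : ofInt (lift a) = a := by
  refine coef_injective fun k => ?_
  rw [coef_ofInt, lift, ZMod.coe_valMinAbs]

/-- A centred representative has least absolute value in its residue class. Norm inequalities are
thus proved over the integers and survive reduction modulo `q`, with no lower bound on `q`. -/
theorem natAbs_valMinAbs_intCast_le {n : ℕ} [NeZero n] (z : ℤ) :
    (z : ZMod n).valMinAbs.natAbs ≤ z.natAbs :=
  ZMod.natAbs_min_of_le_div_two n _ _ (ZMod.coe_valMinAbs _) (ZMod.natAbs_valMinAbs_le _)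

theorem abs_valMinAbs_intCast_le {n : ℕ} [NeZero n] (z : ℤ) :
    |((z : ZMod n).valMinAbs : ℝ)| ≤ |(z : ℝ)| := by
  have h := natAbs_valMinAbs_intCast_le (n := n) z
  rw [← Int.cast_abs, ← Int.cast_abs, Int.abs_eq_natAbs, Int.abs_eq_natAbs]
  exact_mod_cast h

theorem abs_lift_ofInt_le (a : Fin P.d → ℤ) (k : Fin P.d) :
    |(lift (ofInt a : Rq P) k : ℝ)| ≤ |(a k : ℝ)| := by
  rw [lift, coef_ofInt]
  exact abs_valMinAbs_intCast_le _

theorem abs_lift_add_le (a b : Rq P) (k : Fin P.d) :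
    |(lift (a + b) k : ℝ)| ≤ |(lift a k : ℝ) + lift b k| := by
  have h := abs_lift_ofInt_le (P := P) (lift a + lift b) k
  rw [ofInt_add, ofInt_lift, ofInt_lift] at h
  simpa using h

theorem abs_lift_smul_le (r : ZMod P.q) (a : Rq P) (k : Fin P.d) :
    |(lift (r • a) k : ℝ)| ≤ |(r.valMinAbs : ℝ) * lift a k| := by
  have h := abs_valMinAbs_intCast_le (n := P.q) (r.valMinAbs * (coef a k).valMinAbs)
  push_cast [ZMod.coe_valMinAbs] at h
  rwa [lift, coef_smul, lift]

theorem abs_valMinAbs_neg (r : ZMod P.q) : |((-r).valMinAbs : ℝ)| = |(r.valMinAbs : ℝ)| := by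
  have h := ZMod.natAbs_valMinAbs_neg r
  rw [← Int.cast_abs, ← Int.cast_abs, Int.abs_eq_natAbs, Int.abs_eq_natAbs, h]

theorem abs_lift_neg (a : Rq P) (k : Fin P.d) : |(lift (-a) k : ℝ)| = |(lift a k : ℝ)| := by
  rw [lift, coef_neg, lift]
  exact abs_valMinAbs_neg _

theorem lift_zero (k : Fin P.d) : lift (0 : Rq P) k = 0 := by
  rw [lift, coef_zero, ZMod.valMinAbs_zero]

/-- The Euclidean norm of a doubly indexed real vector. -/
def nrm {ι μ : Type} [Fintype ι] [Fintype μ] (u : ι → μ → ℝ) : ℝ :=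
  Real.sqrt (∑ i, ∑ k, u i k ^ 2)

section Nrm

variable {ι μ : Type} [Fintype ι] [Fintype μ]

theorem nrm_eq (u : ι → μ → ℝ) :
    nrm u = ‖(WithLp.toLp 2 fun p : ι × μ => u p.1 p.2 : EuclideanSpace ℝ (ι × μ))‖ := by
  rw [EuclideanSpace.norm_eq, nrm, Fintype.sum_prod_type]
  simp

theorem nrm_add_le (u v : ι → μ → ℝ) : nrm (u + v) ≤ nrm u + nrm v := by
  rw [nrm_eq, nrm_eq, nrm_eq]
  exact norm_add_le (WithLp.toLp 2 fun p : ι × μ => u p.1 p.2 : EuclideanSpace ℝ (ι × μ))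
    (WithLp.toLp 2 fun p : ι × μ => v p.1 p.2)

theorem nrm_smul (r : ℝ) (u : ι → μ → ℝ) : nrm (r • u) = |r| * nrm u := by
  rw [nrm_eq, nrm_eq, ← Real.norm_eq_abs]
  exact norm_smul r (WithLp.toLp 2 fun p : ι × μ => u p.1 p.2 : EuclideanSpace ℝ (ι × μ))

theorem nrm_mono {u v : ι → μ → ℝ} (h : ∀ i k, |u i k| ≤ |v i k|) : nrm u ≤ nrm v :=
  Real.sqrt_le_sqrt <| Finset.sum_le_sum fun i _ => Finset.sum_le_sum fun k _ =>
    sq_le_sq.2 (h i k)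

theorem nrm_sq (u : ι → μ → ℝ) : nrm u ^ 2 = ∑ i, ∑ k, u i k ^ 2 :=
  Real.sq_sqrt (Finset.sum_nonneg fun _ _ => Finset.sum_nonneg fun _ _ => sq_nonneg _)

theorem nrm_nonneg (u : ι → μ → ℝ) : 0 ≤ nrm u := Real.sqrt_nonneg _

end Nrm

section L2

variable {ι : Type} [Fintype ι]

theorem l2_eq_nrm (a : ι → Rq P) : l2 a = nrm fun i k => (lift (a i) k : ℝ) := rfl

theorem l2_nonneg (a : ι → Rq P) : 0 ≤ l2 a := Real.sqrt_nonneg _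

theorem l2_add_le (a b : ι → Rq P) : l2 (a + b) ≤ l2 a + l2 b :=
  (nrm_mono fun i k => abs_lift_add_le (a i) (b i) k).trans
    (nrm_add_le (fun i k => (lift (a i) k : ℝ)) fun i k => (lift (b i) k : ℝ))

theorem l2_smul_le (r : ZMod P.q) (a : ι → Rq P) :
    l2 (r • a) ≤ |(r.valMinAbs : ℝ)| * l2 a :=
  (nrm_mono fun i k => abs_lift_smul_le r (a i) k).trans
    (nrm_smul (r.valMinAbs : ℝ) fun i k => (lift (a i) k : ℝ)).le

theorem l2_neg (a : ι → Rq P) : l2 (-a) = l2 a :=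
  le_antisymm (nrm_mono fun i k => (abs_lift_neg (a i) k).le)
    (nrm_mono fun i k => (abs_lift_neg (a i) k).ge)

theorem l2_sub_le (a b : ι → Rq P) : l2 (a - b) ≤ l2 a + l2 b := by
  rw [sub_eq_add_neg, ← l2_neg b]
  exact l2_add_le _ _

theorem l2_zero : l2 (0 : ι → Rq P) = 0 := by
  simp [l2, lift_zero]

theorem l2_pos {a : ι → Rq P} (h : a ≠ 0) : 0 < l2 a := by
  by_contra h0
  refine h (funext fun i => coef_injective fun k => ?_)
  have h1 := (Real.sqrt_eq_zero (Finset.sum_nonneg fun _ _ => Finset.sum_nonneg fun _ _ =>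
    sq_nonneg _)).1 (le_antisymm (not_lt.1 h0) (l2_nonneg a))
  rw [Finset.sum_eq_zero_iff_of_nonneg fun _ _ => Finset.sum_nonneg fun _ _ => sq_nonneg _] at h1
  have h2 := h1 i (Finset.mem_univ _)
  rw [Finset.sum_eq_zero_iff_of_nonneg fun _ _ => sq_nonneg _] at h2
  have h3 := h2 k (Finset.mem_univ _)
  rw [sq_eq_zero_iff, Int.cast_eq_zero, lift, ZMod.valMinAbs_eq_zero] at h3
  rw [h3, Pi.zero_apply, coef_zero]

theorem l2_sum_le {μ : Type} (s : Finset μ) (a : μ → ι → Rq P) :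
    l2 (∑ j ∈ s, a j) ≤ ∑ j ∈ s, l2 (a j) :=
  Finset.le_sum_of_subadditive l2 l2_zero.le l2_add_le s a

theorem sum_lift_xx_mul (a : Rq P) :
    ∑ k, (lift (xx P * a) k : ℝ) ^ 2 = ∑ k, (lift a k : ℝ) ^ 2 := by
  obtain ⟨e, he⟩ : ∃ e, P.d = e + 1 := ⟨P.d - 1, by have := P.d_pos; omega⟩
  have h1 (f : Fin P.d → ℝ) : ∑ k, f k = ∑ k : Fin (e + 1), f (Fin.cast he.symm k) :=
    Fintype.sum_equiv (finCongr he) _ _ fun k => by simp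
  -- The constant coefficient of `X a` is paired with the last coefficient of `a`, and coefficient
  -- `k + 1` of `X a` with coefficient `k` of `a`.
  rw [h1, h1, Fin.sum_univ_succ, Fin.sum_univ_castSucc, add_comm]
  congr 1
  · refine Finset.sum_congr rfl fun k _ => ?_
    rw [lift, coef_xx_mul, if_neg (by simp), lift]
    rfl
  · rw [lift, coef_xx_mul, if_pos (by simp), ← sq_abs, abs_valMinAbs_neg, sq_abs, lift]
    congr 5
    simp [he]

theorem l2_xx_pow_smul (j : ℕ) (a : ι → Rq P) : l2 (xx P ^ j • a) = l2 a := by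
  induction j with
  | zero => simp
  | succ j ih =>
    rw [← ih, pow_succ', mul_smul, l2, l2]
    congr 1
    exact Finset.sum_congr rfl fun i _ => sum_lift_xx_mul _

/-- Multiplication by a ring element increases norms by at most its `ℓ₁`-norm. -/
theorem l2_mul_le (c : Rq P) (a : ι → Rq P) : l2 (c • a) ≤ l1 c * l2 a := by
  have h : c • a = ∑ k, coef c k • xx P ^ (k : ℕ) • a := by
    conv_lhs => rw [eq_sum_xx c, Finset.sum_smul]
    simp_rw [smul_assoc]
  rw [h, l1, Finset.sum_mul]
  refine (l2_sum_le _ _).trans (Finset.sum_le_sum fun k _ => ?_)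
  refine (l2_smul_le _ _).trans_eq ?_
  rw [l2_xx_pow_smul]
  rfl

theorem l2_ofInt_le (a : ι → Fin P.d → ℤ) :
    l2 (fun i => (ofInt (a i) : Rq P)) ≤ nrm fun i k => (a i k : ℝ) :=
  nrm_mono fun i k => abs_lift_ofInt_le (a i) k

theorem natAbs_lift_le_linf (a : ι → Rq P) (i : ι) (k : Fin P.d) :
    (lift (a i) k).natAbs ≤ linf a :=
  (Finset.le_sup (f := fun k => (lift (a i) k).natAbs) (Finset.mem_univ k)).trans
    (Finset.le_sup (f := fun i => Finset.univ.sup fun k => (lift (a i) k).natAbs)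
      (Finset.mem_univ i))

theorem linf_le {a : ι → Rq P} {b : ℕ} (h : ∀ i k, (lift (a i) k).natAbs ≤ b) : linf a ≤ b :=
  Finset.sup_le fun i _ => Finset.sup_le fun k _ => h i k

theorem abs_lift_le_linf (a : ι → Rq P) (i : ι) (k : Fin P.d) :
    |(lift (a i) k : ℝ)| ≤ linf a := by
  rw [← Int.cast_abs, Int.abs_eq_natAbs]
  exact_mod_cast natAbs_lift_le_linf a i k

theorem linf_le_real {a : ι → Rq P} {b : ℝ} (hb : 0 ≤ b)
    (h : ∀ i k, |(lift (a i) k : ℝ)| ≤ b) : (linf a : ℝ) ≤ b := by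
  refine (Nat.cast_le.2 (linf_le (b := ⌊b⌋₊) fun i k => Nat.le_floor ?_)).trans
    (Nat.floor_le hb)
  have := h i k
  rwa [← Int.cast_abs, Int.abs_eq_natAbs] at this

/-- A vector with coefficients in `{-1, 0, 1}` has norm at most the root of its length. -/
theorem l2_le_of_linf_le_one {a : ι → Rq P} (h : ∀ i k, |(lift (a i) k : ℝ)| ≤ 1) :
    l2 a ≤ Real.sqrt (Fintype.card ι * P.d) := by
  refine Real.sqrt_le_sqrt ((Finset.sum_le_sum fun i _ => Finset.sum_le_sum fun k _ =>
    (sq_le_one_iff_abs_le_one _).2 (h i k)).trans ?_)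
  simp

end L2

theorem l1_sub_le (a b : Rq P) : l1 (a - b) ≤ l1 a + l1 b := by
  rw [l1, l1, l1, ← Finset.sum_add_distrib]
  refine Finset.sum_le_sum fun k _ => ?_
  rw [sub_eq_add_neg, ← abs_lift_neg b]
  exact (abs_lift_add_le a (-b) k).trans (abs_add_le _ _)

/-! ### Uniform ring elements -/

theorem ex_uniform_shift {α : Type} [Fintype α] [Nonempty α] [AddGroup α] (b : α)
    (F : α → ℝ≥0∞) :
    ex (PMF.uniformOfFintype α) (fun a => F (a + b)) = ex (PMF.uniformOfFintype α) F := by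
  unfold ex
  rw [← (Equiv.addRight b).tsum_eq fun a => PMF.uniformOfFintype α a * F a]
  exact tsum_congr fun a => by simp

theorem ex_unif_shift (b : Rq P) (F : Rq P → ℝ≥0∞) :
    ex (unif P) (fun a => F (a + b)) = ex (unif P) F := by
  rw [unif, ex_map, ex_map,
    ← ex_iid_shift ex_uniform_shift (coef b) fun v => F (ofCoef v)]
  simp_rw [ofCoef_add, ofCoef_coef]

theorem ex_iid_eval {α ι : Type} [Fintype ι] (p : PMF α) (i : ι) (F : α → ℝ≥0∞) :
    ex (iid p ι) (fun v => F (v i)) = ex p F := by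
  classical
  rw [← ex_iid_update p i]
  simp_rw [Function.update_self, ex_const]

/-- Programs sample ring elements only; the scalar challenges `δ` are read off as constant
coefficients of uniform ring elements. -/
theorem ex_unif_cst (F : ZMod P.q → ℝ≥0∞) :
    ex (unif P) (fun a => F (cst a)) = ex (PMF.uniformOfFintype (ZMod P.q)) F := by
  rw [unif, ex_map]
  simp_rw [cst, coef_ofCoef]
  exact ex_iid_eval _ _ _

theorem ex_unifZero (F : Rq P → ℝ≥0∞) :
    ex (unifZero P) F = ex (unif P) fun a => F (a - algebraMap (ZMod P.q) (Rq P) (cst a)) :=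
  ex_map _ _ _

/-- Removing the constant coefficient commutes with a translation by `b`, because `cst b = 0`.
Applied to the honest message `h`, this shows that `g` hides the term added to it. -/
theorem ex_unifZero_shift (b : Rq P) (hb : cst b = 0) (F : Rq P → ℝ≥0∞) :
    ex (unifZero P) (fun a => F (a + b)) = ex (unifZero P) F := by
  rw [ex_unifZero, ex_unifZero,
    ← ex_unif_shift b fun a => F (a - algebraMap (ZMod P.q) (Rq P) (cst a))]
  simp_rw [cst_add, hb, add_zero, sub_add_eq_add_sub]

theorem cst_of_mem_unifZero {g : Rq P} (hg : g ∈ (unifZero P).support) : cst g = 0 := by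
  obtain ⟨a, -, rfl⟩ := (PMF.mem_support_map_iff _ _ _).1 hg
  rw [cst_sub, cst_algebraMap, sub_self]

end Ring

/-! ### Moment bounds for discrete Gaussians -/

theorem summable_exp_neg_mul_int_sq {c : ℝ} (hc : 0 < c) :
    Summable fun n : ℤ => Real.exp (-c * (n : ℝ) ^ 2) := by
  have hs : 0 < Real.sqrt (1 / (2 * c)) := Real.sqrt_pos.2 (by positivity)
  refine (summable_gaussWeight hs).congr fun n => ?_
  rw [gaussWeight, Real.sq_sqrt (by positivity)]
  congr 1
  field_simp

/-- A consequence of Poisson summation: translates of the integers have smaller Gaussian mass. -/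
theorem tsum_exp_quadratic_le {a : ℝ} (ha : 0 < a) (b : ℝ) :
    ∑' n : ℤ, Real.exp (-Real.pi * a * (n : ℝ) ^ 2 + 2 * Real.pi * b * n)
      ≤ Real.exp (Real.pi * b ^ 2 / a) * ∑' n : ℤ, Real.exp (-Real.pi * a * (n : ℝ) ^ 2) := by
  have hpa : 0 < Real.pi / a := div_pos Real.pi_pos ha
  have h1 := Complex.tsum_exp_neg_quadratic (a := (a : ℂ)) (by simpa using ha) (b : ℂ)
  have h2 : (∑' n : ℤ, Complex.exp (-Real.pi * a * n ^ 2 + 2 * Real.pi * b * n))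
      = ((∑' n : ℤ, Real.exp (-Real.pi * a * (n : ℝ) ^ 2 + 2 * Real.pi * b * n) : ℝ) : ℂ) := by
    push_cast
    rfl
  -- On the dual side of Poisson summation the linear term is an imaginary shift. Taking norms
  -- discards the phases and leaves the constant factor `exp (π b² / a)`.
  have hnorm (n : ℤ) : ‖Complex.exp (-Real.pi / a * (n + Complex.I * b) ^ 2)‖
      = Real.exp (Real.pi * b ^ 2 / a) * Real.exp (-(Real.pi / a) * (n : ℝ) ^ 2) := by
    rw [Complex.norm_exp, ← Real.exp_add]
    congr 1
    have h3 : (-Real.pi / a * (n + Complex.I * b) ^ 2 : ℂ)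
        = ((-(Real.pi / a) * ((n : ℝ) ^ 2 - b ^ 2) : ℝ) : ℂ)
          + ((-(Real.pi / a) * (2 * n * b) : ℝ) : ℂ) * Complex.I := by
      push_cast
      ring_nf
      rw [Complex.I_sq]
      ring
    rw [h3, Complex.add_re, Complex.ofReal_re, Complex.re_ofReal_mul, Complex.I_re]
    field_simp
    ring
  have hsum : Summable fun n : ℤ =>
      ‖Complex.exp (-Real.pi / a * (n + Complex.I * b) ^ 2)‖ := by
    simp_rw [hnorm]
    exact (summable_exp_neg_mul_int_sq hpa).mul_left _
  have hle : ‖∑' n : ℤ, Complex.exp (-Real.pi / a * (n + Complex.I * b) ^ 2)‖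
      ≤ Real.exp (Real.pi * b ^ 2 / a) * ∑' n : ℤ, Real.exp (-(Real.pi / a) * (n : ℝ) ^ 2) := by
    refine (norm_tsum_le_tsum_norm hsum).trans_eq ?_
    simp_rw [hnorm, tsum_mul_left]
  have hnn : 0 ≤ ∑' n : ℤ, Real.exp (-Real.pi * a * (n : ℝ) ^ 2 + 2 * Real.pi * b * n) :=
    tsum_nonneg fun _ => (Real.exp_pos _).le
  have hpre : ‖(1 / (a : ℂ) ^ (1 / 2 : ℂ))‖ = 1 / a ^ (1 / 2 : ℝ) := by
    rw [norm_div, norm_one, Complex.norm_cpow_eq_rpow_re_of_pos ha]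
    norm_num
  -- Poisson summation is used a second time, at `b = 0`, to return from the dual sum to the
  -- original one; the prefactors `1 / √a` agree.
  rw [← abs_of_nonneg hnn, ← Real.norm_eq_abs, ← Complex.norm_real, ← h2, h1, norm_mul, hpre,
    Real.tsum_exp_neg_mul_int_sq ha, mul_left_comm]
  refine mul_le_mul_of_nonneg_left (hle.trans_eq ?_) (by positivity)
  simp_rw [neg_div]

theorem ex_gauss {s : ℝ} (hs : 0 < s) (F : ℤ → ℝ≥0∞) :
    ex (gauss s hs) F = (∑' z, ENNReal.ofReal (gaussWeight s z) * F z)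
      * (∑' z, ENNReal.ofReal (gaussWeight s z))⁻¹ := by
  unfold ex
  rw [← ENNReal.tsum_mul_right]
  refine tsum_congr fun z => ?_
  rw [gauss, PMF.normalize_apply]
  ring

/-- Discrete Gaussians are sub-Gaussian. -/
theorem ex_gauss_exp_le {s : ℝ} (hs : 0 < s) (t : ℝ) :
    ex (gauss s hs) (fun z => ENNReal.ofReal (Real.exp (t * z)))
      ≤ ENNReal.ofReal (Real.exp (t ^ 2 * s ^ 2 / 2)) := by
  rw [ex_gauss, ← div_eq_mul_inv]
  refine ENNReal.div_le_of_le_mul ?_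
  have h0 (z : ℤ) : ENNReal.ofReal (gaussWeight s z) * ENNReal.ofReal (Real.exp (t * z))
      = ENNReal.ofReal (Real.exp (-(z : ℝ) ^ 2 / (2 * s ^ 2)) * Real.exp (t * z)) :=
    (ENNReal.ofReal_mul (Real.exp_pos _).le).symm
  simp_rw [h0]
  rw [← ENNReal.ofReal_tsum_of_nonneg (f := gaussWeight s) (fun _ => (Real.exp_pos _).le)
    (summable_gaussWeight hs)]
  have hpos := Real.pi_pos
  have ha : 0 < 1 / (2 * Real.pi * s ^ 2) := by positivity
  -- With `a = 1 / (2 π s²)` and `b = t / (2 π)` the summand is the Gaussian weight tilted by `exp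
  -- (t z)`, and `π b² / a = t² s² / 2`.
  have h := tsum_exp_quadratic_le ha (t / (2 * Real.pi))
  have h1 (n : ℤ) : Real.exp (-Real.pi * (1 / (2 * Real.pi * s ^ 2)) * (n : ℝ) ^ 2
      + 2 * Real.pi * (t / (2 * Real.pi)) * n)
      = Real.exp (-(n : ℝ) ^ 2 / (2 * s ^ 2)) * Real.exp (t * n) := by
    rw [← Real.exp_add]
    congr 1
    field_simp
  have h2 (n : ℤ) : Real.exp (-Real.pi * (1 / (2 * Real.pi * s ^ 2)) * (n : ℝ) ^ 2)
      = gaussWeight s n := by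
    rw [gaussWeight]
    congr 1
    field_simp
  have h3 : Real.pi * (t / (2 * Real.pi)) ^ 2 / (1 / (2 * Real.pi * s ^ 2))
      = t ^ 2 * s ^ 2 / 2 := by
    field_simp
  simp_rw [h1, h2, h3] at h
  -- A divergent real sum has the default value `0`, so `h` transfers to extended reals only once
  -- summability is known. Summability follows from comparison with a wider Gaussian, by expanding
  -- `(t s - n / (2 s))² ≥ 0`.
  by_cases hsum : Summable fun n : ℤ => Real.exp (-(n : ℝ) ^ 2 / (2 * s ^ 2)) * Real.exp (t * n)
  · rw [← ENNReal.ofReal_tsum_of_nonneg (fun _ => by positivity) hsum,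
      ← ENNReal.ofReal_mul (Real.exp_pos _).le]
    exact ENNReal.ofReal_le_ofReal h
  · refine absurd ?_ hsum
    have h4 : Summable fun n : ℤ => Real.exp (t ^ 2 * s ^ 2) * Real.exp (-(1 / (4 * s ^ 2)) *
        (n : ℝ) ^ 2) := (summable_exp_neg_mul_int_sq (by positivity)).mul_left _
    refine Summable.of_nonneg_of_le (fun _ => by positivity) (fun n => ?_) h4
    rw [← Real.exp_add, ← Real.exp_add, Real.exp_le_exp]
    have h5 : 0 ≤ (t * s - n / (2 * s)) ^ 2 := sq_nonneg _
    have h6 : (t * s - n / (2 * s)) ^ 2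
      = t ^ 2 * s ^ 2 + -(1 / (4 * s ^ 2)) * (n : ℝ) ^ 2 - (-(n : ℝ) ^ 2 / (2 * s ^ 2) + t * n) := by
      field_simp
      ring
    linarith

/-- The square of a sub-Gaussian variable has an exponential moment. -/
theorem ex_exp_sq_le {α : Type} [Countable α] (p : PMF α) (X : α → ℝ) {σ : ℝ} (hσ : 0 < σ)
    (hX : ∀ t : ℝ, ex p (fun a => ENNReal.ofReal (Real.exp (t * X a)))
      ≤ ENNReal.ofReal (Real.exp (t ^ 2 * σ / 2))) :
    ex p (fun a => ENNReal.ofReal (Real.exp (X a ^ 2 / (4 * σ)))) ≤ ENNReal.ofReal (Real.sqrt 2) := by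
  open ProbabilityTheory MeasureTheory in
  set r := 1 / Real.sqrt (2 * σ) with hr
  have hr2 : r ^ 2 = 1 / (2 * σ) := by
    rw [hr, div_pow, Real.sq_sqrt (by positivity), one_pow]
  -- Linearization of the square: `exp (x² / (4 σ))` is the average of `exp (r g x)` over a standard
  -- normal `g`, where `r² = 1 / (2 σ)`. For fixed `g` the hypothesis bounds the moment by `exp (g²
  -- / 4)`, whose Gaussian average is `√2`.
  have h1 (x : ℝ) : ENNReal.ofReal (Real.exp (x ^ 2 / (4 * σ)))
      = ∫⁻ g, ENNReal.ofReal (gaussianPDFReal 0 1 g) * ENNReal.ofReal (Real.exp (r * g * x)) := by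
    have h2 (g : ℝ) : ENNReal.ofReal (gaussianPDFReal 0 1 g) * ENNReal.ofReal (Real.exp (r * g * x))
        = ENNReal.ofReal (Real.exp (x ^ 2 / (4 * σ)))
          * ENNReal.ofReal (gaussianPDFReal (r * x) 1 g) := by
      rw [← ENNReal.ofReal_mul (gaussianPDFReal_nonneg _ _ _),
        ← ENNReal.ofReal_mul (Real.exp_pos _).le, gaussianPDFReal, gaussianPDFReal, mul_assoc,
        ← Real.exp_add, mul_left_comm, ← Real.exp_add]
      congr 3
      have h3 : x ^ 2 / (4 * σ) = r ^ 2 * x ^ 2 / 2 := by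
        rw [hr2]
        field_simp
        ring
      rw [h3]
      push_cast
      ring
    simp_rw [h2]
    rw [lintegral_const_mul _ (by fun_prop), lintegral_gaussianPDFReal_eq_one _ one_ne_zero, mul_one]
  have h4 (g : ℝ) : ENNReal.ofReal (gaussianPDFReal 0 1 g) * ENNReal.ofReal (Real.exp (g ^ 2 / 4))
      = ENNReal.ofReal (Real.sqrt 2) * ENNReal.ofReal (gaussianPDFReal 0 2 g) := by
    rw [← ENNReal.ofReal_mul (gaussianPDFReal_nonneg _ _ _),
      ← ENNReal.ofReal_mul (Real.sqrt_nonneg _), gaussianPDFReal, gaussianPDFReal, mul_assoc,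
      ← Real.exp_add, ← mul_assoc]
    congr 2
    · push_cast
      rw [mul_one, Real.sqrt_mul (x := 2 * Real.pi) (by positivity) 2]
      have : Real.sqrt 2 ≠ 0 := by positivity
      field_simp
    · congr 1
      push_cast
      ring
  have h5 : ex p (fun a => ENNReal.ofReal (Real.exp (X a ^ 2 / (4 * σ))))
      = ∫⁻ g, ENNReal.ofReal (gaussianPDFReal 0 1 g)
          * ex p (fun a => ENNReal.ofReal (Real.exp (r * g * X a))) := by
    simp_rw [h1, ex, ← ENNReal.tsum_mul_left]
    rw [lintegral_tsum fun a => by fun_prop]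
    refine tsum_congr fun a => ?_
    rw [← lintegral_const_mul _ (by fun_prop)]
    refine lintegral_congr fun g => ?_
    ring
  rw [h5]
  calc _ ≤ ∫⁻ g, ENNReal.ofReal (gaussianPDFReal 0 1 g) * ENNReal.ofReal (Real.exp (g ^ 2 / 4)) := by
        refine lintegral_mono fun g => mul_le_mul_right ((hX (r * g)).trans_eq ?_) _
        congr 2
        rw [mul_pow, hr2]
        field_simp
        ring
    _ = _ := by
        simp_rw [h4]
        rw [lintegral_const_mul _ (by fun_prop),
          lintegral_gaussianPDFReal_eq_one _ two_ne_zero, mul_one]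

theorem ex_gauss_exp_sq_le {s : ℝ} (hs : 0 < s) :
    ex (gauss s hs) (fun z => ENNReal.ofReal (Real.exp ((z : ℝ) ^ 2 / (4 * s ^ 2))))
      ≤ ENNReal.ofReal (Real.sqrt 2) :=
  ex_exp_sq_le _ (fun z : ℤ => (z : ℝ)) (by positivity) fun t => ex_gauss_exp_le hs t

/-! ### Tail bounds for Gaussian vectors -/

section Vec

variable {P : Params} {ι : Type} [Fintype ι]

theorem ofReal_exp_sum (f : ι → Fin P.d → ℝ) :
    ENNReal.ofReal (Real.exp (∑ i, ∑ k, f i k)) = ∏ i, ∏ k, ENNReal.ofReal (Real.exp (f i k)) := by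
  simp_rw [Real.exp_sum]
  rw [ENNReal.ofReal_prod_of_nonneg fun _ _ => Finset.prod_nonneg fun _ _ => (Real.exp_pos _).le]
  exact Finset.prod_congr rfl fun i _ =>
    ENNReal.ofReal_prod_of_nonneg fun _ _ => (Real.exp_pos _).le

theorem ex_iid_iid_exp (p : PMF ℤ) (f : ι → Fin P.d → ℤ → ℝ) :
    ex (iid (iid p (Fin P.d)) ι)
      (fun y => ENNReal.ofReal (Real.exp (∑ i, ∑ k, f i k (y i k))))
      = ∏ i, ∏ k, ex p fun z => ENNReal.ofReal (Real.exp (f i k z)) := by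
  simp_rw [ofReal_exp_sum]
  rw [ex_iid_prod (iid p (Fin P.d)) fun i (y : Fin P.d → ℤ) =>
    ∏ k, ENNReal.ofReal (Real.exp (f i k (y k)))]
  exact Finset.prod_congr rfl fun i _ =>
    ex_iid_prod p fun k z => ENNReal.ofReal (Real.exp (f i k z))

theorem prod_prod_le_exp {g : ι → Fin P.d → ℝ≥0∞} {f : ι → Fin P.d → ℝ}
    (h : ∀ i k, g i k ≤ ENNReal.ofReal (Real.exp (f i k))) :
    ∏ i, ∏ k, g i k ≤ ENNReal.ofReal (Real.exp (∑ i, ∑ k, f i k)) := by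
  rw [ofReal_exp_sum]
  exact Finset.prod_le_prod' fun i _ => Finset.prod_le_prod' fun k _ => h i k

theorem ex_gaussVec_exp_le {s : ℝ} (hs : 0 < s) (t : ι → Fin P.d → ℝ) :
    ex (gaussVec P s hs ι) (fun y => ENNReal.ofReal (Real.exp (∑ i, ∑ k, t i k * y i k)))
      ≤ ENNReal.ofReal (Real.exp (nrm t ^ 2 * s ^ 2 / 2)) := by
  rw [gaussVec, ex_iid_iid_exp (gauss s hs) fun i k z => t i k * z]
  refine (prod_prod_le_exp fun i k => ex_gauss_exp_le hs (t i k)).trans_eq ?_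
  rw [nrm_sq]
  congr 2
  simp_rw [Finset.sum_mul, Finset.sum_div]

/-- Markov's inequality for an exponential. -/
theorem ex_ind_lt_le_exp {α : Type} (p : PMF α) (X : α → ℝ) {r a : ℝ}
    (hX : ex p (fun x => ENNReal.ofReal (Real.exp (X x))) ≤ ENNReal.ofReal (Real.exp a)) :
    ex p (fun x => ind (r < X x)) ≤ ENNReal.ofReal (Real.exp (a - r)) := by
  refine (ex_ind_le_of_le (c := ENNReal.ofReal (Real.exp (-r)))
    (F := fun x => ENNReal.ofReal (Real.exp (X x))) fun x hx => ?_).trans ?_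
  · rw [← ENNReal.ofReal_mul (Real.exp_pos _).le, ← Real.exp_add, ← ENNReal.ofReal_one]
    exact ENNReal.ofReal_le_ofReal (Real.one_le_exp (by linarith))
  · refine (mul_le_mul_right hX _).trans_eq ?_
    rw [← ENNReal.ofReal_mul (Real.exp_pos _).le, ← Real.exp_add]
    ring_nf

theorem sqrt_two_eq_exp : Real.sqrt 2 = Real.exp (Real.log 2 / 2) := by
  rw [Real.sqrt_eq_rpow, Real.rpow_def_of_pos two_pos]
  ring_nf

/-- The norm of a Gaussian vector in dimension `N` exceeds `s √(2N)` with small probability. -/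
theorem ex_gaussVec_norm_le {s : ℝ} (hs : 0 < s) :
    ex (gaussVec P s hs ι)
      (fun y => ind (s * Real.sqrt (2 * (Fintype.card ι * P.d)) < nrm fun i k => (y i k : ℝ)))
      ≤ ENNReal.ofReal ((2 : ℝ) ^ (-(Fintype.card ι * P.d / 8 : ℝ))) := by
  set N : ℝ := Fintype.card ι * P.d with hN
  have hN0 : 0 ≤ N := by positivity
  have h1 : ex (gaussVec P s hs ι)
      (fun y => ENNReal.ofReal (Real.exp (∑ i, ∑ k, (y i k : ℝ) ^ 2 / (4 * s ^ 2))))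
      ≤ ENNReal.ofReal (Real.exp (N * (Real.log 2 / 2))) := by
    rw [gaussVec, ex_iid_iid_exp (gauss s hs) fun i k z => (z : ℝ) ^ 2 / (4 * s ^ 2)]
    refine (prod_prod_le_exp fun i k => ?_).trans_eq (b := ENNReal.ofReal
      (Real.exp (∑ i : ι, ∑ k : Fin P.d, Real.log 2 / 2))) ?_
    · rw [← sqrt_two_eq_exp]
      exact ex_gauss_exp_sq_le hs
    · congr 2
      simp [hN]
      ring
  -- A norm above `s √(2N)` makes the exponent exceed `N / 2`. Markov's inequality gives `exp (N
  -- (log 2 - 1) / 2)`, which is below `2 ^ (-N / 8)` since `log 2 < 4 / 5`.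
  refine le_trans (ex_mono fun y => ind_mono fun h => ?_)
    ((ex_ind_lt_le_exp _ _ (r := N / 2) h1).trans (ENNReal.ofReal_le_ofReal ?_))
  · have h2 : (s * Real.sqrt (2 * N)) ^ 2 < nrm (fun i k => (y i k : ℝ)) ^ 2 :=
      pow_lt_pow_left₀ h (by positivity) two_ne_zero
    rw [mul_pow, Real.sq_sqrt (by positivity), nrm_sq] at h2
    simp_rw [← Finset.sum_div]
    rw [lt_div_iff₀ (by positivity)]
    linarith
  · rw [Real.rpow_def_of_pos two_pos, Real.exp_le_exp]
    have := Real.log_two_lt_d9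
    nlinarith

theorem ex_gauss_abs_le {s : ℝ} (hs : 0 < s) :
    ex (gauss s hs) (fun z => ind (16 * s < |(z : ℝ)|)) ≤ ENNReal.ofReal (2 * Real.exp (-128)) := by
  -- The tilt `16 / s` optimizes the tail bound at the threshold `16 s`: the moment has exponent
  -- `128` and the threshold contributes `-256`. The sign `e` treats both tails at once.
  have h1 (e : ℝ) (he : e ^ 2 = 1) : ex (gauss s hs) (fun z : ℤ => ind (256 < 16 / s * e * z))
      ≤ ENNReal.ofReal (Real.exp (-128)) := by
    have h2 := ex_gauss_exp_le hs (16 / s * e)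
    rw [mul_pow, he, div_pow, mul_one, div_mul_cancel₀ _ (by positivity)] at h2
    refine (ex_ind_lt_le_exp _ _ h2).trans_eq ?_
    norm_num
  rw [two_mul, ENNReal.ofReal_add (Real.exp_pos _).le (Real.exp_pos _).le]
  refine le_trans ?_ (add_le_add (h1 1 (by norm_num)) (h1 (-1) (by norm_num)))
  rw [← ex_add]
  refine ex_mono fun z => le_trans (ind_mono fun h => ?_) (ind_or_le _ _)
  rcases lt_abs.1 h with h | h
  · left
    rw [mul_one, div_mul_eq_mul_div, lt_div_iff₀ hs]
    linarith
  · right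
    rw [mul_neg_one, neg_mul, div_mul_eq_mul_div, ← neg_div, lt_div_iff₀ hs]
    linarith

theorem ind_exists_le {κ : Type} [Fintype κ] (E : κ → Prop) : ind (∃ i, E i) ≤ ∑ i, ind (E i) := by
  by_cases h : ∃ i, E i
  · obtain ⟨i, hi⟩ := h
    calc _ ≤ ind (E i) := by rw [ind_of hi]; exact ind_le_one _
      _ ≤ _ := Finset.single_le_sum (f := fun i => ind (E i)) (fun _ _ => zero_le) (Finset.mem_univ i)
  · rw [ind_not h]
    exact zero_le

theorem ex_finset_sum {α κ : Type} (p : PMF α) (s : Finset κ) (F : κ → α → ℝ≥0∞) :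
    ex p (fun a => ∑ i ∈ s, F i a) = ∑ i ∈ s, ex p (F i) := by
  classical
  induction s using Finset.induction_on with
  | empty => simp [ex_const]
  | insert i s hi ih => simp_rw [Finset.sum_insert hi, ex_add, ih]

theorem ex_gaussVec_max_le {s : ℝ} (hs : 0 < s) :
    ex (gaussVec P s hs ι) (fun y => ind (∃ i k, 16 * s < |(y i k : ℝ)|))
      ≤ ENNReal.ofReal (Fintype.card ι * P.d * (2 * Real.exp (-128))) := by
  calc _ ≤ ex (gaussVec P s hs ι) (fun y => ∑ i, ∑ k, ind (16 * s < |(y i k : ℝ)|)) :=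
        ex_mono fun y => (ind_exists_le _).trans (Finset.sum_le_sum fun i _ => ind_exists_le _)
    _ ≤ ∑ i : ι, ∑ k : Fin P.d, ENNReal.ofReal (2 * Real.exp (-128)) := by
        rw [ex_finset_sum]
        refine Finset.sum_le_sum fun i _ => ?_
        rw [ex_finset_sum]
        refine Finset.sum_le_sum fun k _ => ?_
        rw [gaussVec, ex_iid_eval (iid (gauss s hs) (Fin P.d)) i
          fun y : Fin P.d → ℤ => ind (16 * s < |(y k : ℝ)|),
          ex_iid_eval (gauss s hs) k fun z : ℤ => ind (16 * s < |(z : ℝ)|)]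
        exact ex_gauss_abs_le hs
    _ = _ := by
        simp only [Finset.sum_const, Finset.card_univ, Fintype.card_fin, nsmul_eq_mul]
        rw [← mul_assoc, ENNReal.ofReal_mul (p := (Fintype.card ι * P.d : ℝ)) (by positivity),
          ENNReal.ofReal_mul (p := (Fintype.card ι : ℝ)) (by positivity), ENNReal.ofReal_natCast,
          ENNReal.ofReal_natCast]

/-! ### Rejection sampling -/

/-- The exponent in the acceptance probability. -/
def rejExp (z v : ι → Fin P.d → ℤ) (s : ℝ) : ℝ :=
  (-2 * (∑ i, ∑ k, (z i k : ℝ) * v i k) + ∑ i, ∑ k, (v i k : ℝ) ^ 2) / (2 * s ^ 2)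

/-- The acceptance probability. -/
def acc (z v : ι → Fin P.d → ℤ) (s : ℝ) : ℝ≥0∞ :=
  min 1 (ENNReal.ofReal (1 / 3 * Real.exp (rejExp z v s)))

/-- The value `false` stands for an abort, and the test functions of interest vanish on aborted
executions. -/
theorem ex_rej (z v : ι → Fin P.d → ℤ) (s : ℝ) (F : Bool → ℝ≥0∞) (hF : F false = 0) :
    ex (rej z v s) F = acc z v s * F true := by
  unfold ex rej
  rw [tsum_bool, hF, mul_zero, zero_add]
  rfl

theorem gaussWeight_sub {s : ℝ} (z v : ℤ) :
    gaussWeight s (z - v) * Real.exp ((-2 * (z * v) + v ^ 2) / (2 * s ^ 2)) = gaussWeight s z := by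
  rw [gaussWeight, gaussWeight, ← Real.exp_add]
  congr 1
  push_cast
  ring

theorem gauss_sub {s : ℝ} (hs : 0 < s) (z v : ℤ) :
    gauss s hs (z - v) * ENNReal.ofReal (Real.exp ((-2 * (z * v) + v ^ 2) / (2 * s ^ 2)))
      = gauss s hs z := by
  rw [gauss, PMF.normalize_apply, PMF.normalize_apply, mul_right_comm,
    ← ENNReal.ofReal_mul (by exact (Real.exp_pos _).le), gaussWeight_sub]

/-- The exponential in the acceptance rule is exactly the density ratio of the centred to the
shifted Gaussian: squares are completed and the normalizing constants cancel. -/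
theorem gaussVec_sub {s : ℝ} (hs : 0 < s) (z v : ι → Fin P.d → ℤ) :
    gaussVec P s hs ι (z - v) * ENNReal.ofReal (Real.exp (rejExp z v s)) = gaussVec P s hs ι z := by
  have h : rejExp z v s
      = ∑ i, ∑ k, (-2 * ((z i k : ℝ) * v i k) + (v i k : ℝ) ^ 2) / (2 * s ^ 2) := by
    simp_rw [rejExp, ← Finset.sum_div, Finset.sum_add_distrib, ← Finset.mul_sum]
  rw [h, ofReal_exp_sum, gaussVec, iid_apply, iid_apply, ← Finset.prod_mul_distrib]
  refine Finset.prod_congr rfl fun i _ => ?_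
  rw [iid_apply, iid_apply, ← Finset.prod_mul_distrib]
  exact Finset.prod_congr rfl fun k _ => gauss_sub hs (z i k) (v i k)

theorem ex_gaussVec_shift {s : ℝ} (hs : 0 < s) (v : ι → Fin P.d → ℤ)
    (F : (ι → Fin P.d → ℤ) → ℝ≥0∞) :
    ex (gaussVec P s hs ι) (fun y => F (y + v)) = ∑' z, gaussVec P s hs ι (z - v) * F z := by
  unfold ex
  rw [← (Equiv.addRight v).tsum_eq fun z => gaussVec P s hs ι (z - v) * F z]
  exact tsum_congr fun y => by simp

/-- An accepted sample is distributed as a centred Gaussian scaled by at most `1 / 3`. -/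
theorem ex_acc_le {s : ℝ} (hs : 0 < s) (v : ι → Fin P.d → ℤ) (F : (ι → Fin P.d → ℤ) → ℝ≥0∞) :
    ex (gaussVec P s hs ι) (fun y => acc (y + v) v s * F (y + v))
      ≤ 3⁻¹ * ex (gaussVec P s hs ι) F := by
  rw [ex_gaussVec_shift hs v fun z => acc z v s * F z, ex, ← ENNReal.tsum_mul_left]
  refine ENNReal.tsum_le_tsum fun z => ?_
  calc _ ≤ gaussVec P s hs ι (z - v) * (ENNReal.ofReal (1 / 3 * Real.exp (rejExp z v s)) * F z) := by
        gcongr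
        exact min_le_right _ _
    _ = _ := by
        rw [ENNReal.ofReal_mul (by norm_num), ← gaussVec_sub hs z v, one_div,
          ENNReal.ofReal_inv_of_pos (by norm_num), ENNReal.ofReal_ofNat]
        ring

/-- The event is that the acceptance formula exceeds `1`, so that the minimum cuts it off. Under the
centred Gaussian the exponent is a sub-Gaussian linear form in `z`, plus the constant `‖v‖² / (2 s²)
≤ 1 / 242`. -/
theorem ex_rejExp_le {s : ℝ} (hs : 0 < s) (v : ι → Fin P.d → ℤ)
    (hv : nrm (fun i k => (v i k : ℝ)) ≤ s / 11) :
    ex (gaussVec P s hs ι) (fun z => ind (Real.log 3 < rejExp z v s))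
      ≤ ENNReal.ofReal (Real.exp (-72)) := by
  set V := nrm fun i k => (v i k : ℝ) with hV
  have hV0 : 0 ≤ V := nrm_nonneg _
  have hV2 : V ^ 2 ≤ s ^ 2 / 121 := by
    calc V ^ 2 ≤ (s / 11) ^ 2 := pow_le_pow_left₀ hV0 hv 2
      _ = _ := by ring
  -- The exponent is tilted by `132 = 12 · 11`, so the moment has exponent at most `12² / 2 = 72`.
  -- The threshold becomes `132 (log 3 - 1 / 242) > 144.2`, and `72 - 144.2 < -72`.
  have h := ex_gaussVec_exp_le (P := P) (ι := ι) hs fun i k => -(132 / s ^ 2) * (v i k : ℝ)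
  have h1 : nrm (fun i k => -(132 / s ^ 2) * (v i k : ℝ)) ^ 2 * s ^ 2 / 2 ≤ 72 := by
    have h2 : nrm (fun i k => -(132 / s ^ 2) * (v i k : ℝ)) = 132 / s ^ 2 * V := by
      have := nrm_smul (-(132 / s ^ 2)) fun i k => (v i k : ℝ)
      rwa [abs_neg, abs_of_pos (by positivity)] at this
    rw [h2, mul_pow]
    calc _ ≤ (132 / s ^ 2) ^ 2 * (s ^ 2 / 121) * s ^ 2 / 2 := by gcongr
      _ = 72 := by field_simp; norm_num
  refine le_trans (ex_mono fun z => ind_mono fun hz => ?_)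
    ((ex_ind_lt_le_exp _ _ (r := 144.2)
      (h.trans (ENNReal.ofReal_le_ofReal (Real.exp_le_exp.2 h1)))).trans
        (ENNReal.ofReal_le_ofReal (Real.exp_le_exp.2 (by norm_num))))
  have h3 : ∑ i, ∑ k, -(132 / s ^ 2) * (v i k : ℝ) * (z i k : ℝ)
      = 132 * (rejExp z v s - V ^ 2 / (2 * s ^ 2)) := by
    rw [rejExp, hV, nrm_sq, ← sub_div, add_sub_cancel_right]
    simp_rw [mul_assoc, ← Finset.mul_sum, mul_comm (v _ _ : ℝ)]
    field_simp
  rw [h3]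
  have h4 : V ^ 2 / (2 * s ^ 2) ≤ 1 / 242 := by
    rw [div_le_iff₀ (by positivity)]
    linarith
  have := Real.log_three_gt_d9
  linarith

/-- A short shift is accepted with probability close to `1 / 3`. -/
theorem le_ex_acc {s : ℝ} (hs : 0 < s) (v : ι → Fin P.d → ℤ)
    (hv : nrm (fun i k => (v i k : ℝ)) ≤ s / 11) :
    3⁻¹ * (1 - ENNReal.ofReal (Real.exp (-72)))
      ≤ ex (gaussVec P s hs ι) (fun y => acc (y + v) v s) := by
  have h1 := ex_ind_add_not (gaussVec P s hs ι) fun z => Real.log 3 < rejExp z v s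
  have h2 : 1 - ENNReal.ofReal (Real.exp (-72))
      ≤ ex (gaussVec P s hs ι) fun z => ind (¬Real.log 3 < rejExp z v s) := by
    rw [tsub_le_iff_left, ← h1]
    gcongr
    exact ex_rejExp_le hs v hv
  refine (mul_le_mul_right h2 _).trans ?_
  rw [ex_gaussVec_shift hs v fun z => acc z v s, ex, ← ENNReal.tsum_mul_left]
  refine ENNReal.tsum_le_tsum fun z => ?_
  -- Where the exponent is at most `log 3` the minimum is inactive, and the accepted mass is exactly
  -- a third of the centred Gaussian mass.
  by_cases hz : Real.log 3 < rejExp z v s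
  · rw [ind_not (not_not.2 hz), mul_zero, mul_zero]
    exact zero_le
  · have h3 : acc z v s = ENNReal.ofReal (1 / 3 * Real.exp (rejExp z v s)) := by
      refine min_eq_right (ENNReal.ofReal_le_one.2 ?_)
      have h4 := Real.exp_le_exp.2 (not_lt.1 hz)
      rw [Real.exp_log (by norm_num)] at h4
      linarith
    rw [ind_of hz, h3, ENNReal.ofReal_mul (by norm_num), ← gaussVec_sub hs z v, one_div,
      ENNReal.ofReal_inv_of_pos (by norm_num), ENNReal.ofReal_ofNat]
    apply le_of_eq
    ring

end Vec

/-! ### The projection by a random matrix -/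

theorem ex_bin1 (F : ℤ → ℝ≥0∞) : ex bin1 F = 4⁻¹ * (2 * F 0 + F 1 + F (-1)) := by
  rw [bin1, ex_map, ex, tsum_fintype]
  simp only [PMF.uniformOfFintype_apply, Fintype.sum_prod_type, Fin.sum_univ_two,
    Fintype.card_prod, Fintype.card_fin]
  norm_num
  ring

/-- As a difference of two fair bits, the variable has moment generating function `cosh (t / 2) ^
2`, and `cosh x ≤ exp (x² / 2)`. -/
theorem ex_bin1_exp_le (t : ℝ) :
    ex bin1 (fun z => ENNReal.ofReal (Real.exp (t * z)))
      ≤ ENNReal.ofReal (Real.exp (t ^ 2 / 4)) := by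
  have h1 : ex bin1 (fun z => ENNReal.ofReal (Real.exp (t * z)))
      = ENNReal.ofReal (Real.cosh (t / 2) ^ 2) := by
    rw [ex_bin1]
    have h2 : Real.cosh (t / 2) ^ 2 = 4⁻¹ * (2 * Real.exp (t * (0 : ℤ)) + Real.exp (t * (1 : ℤ))
        + Real.exp (t * (-1 : ℤ))) := by
      have h3 : Real.exp t = Real.exp (t / 2) ^ 2 := by rw [← Real.exp_nat_mul]; ring_nf
      have h4 : Real.exp (-t) = Real.exp (-(t / 2)) ^ 2 := by rw [← Real.exp_nat_mul]; ring_nf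
      have h5 : Real.exp (t / 2) * Real.exp (-(t / 2)) = 1 := by rw [← Real.exp_add]; simp
      rw [Real.cosh_eq]
      push_cast
      simp only [mul_zero, Real.exp_zero, mul_one, mul_neg_one, h3, h4]
      linear_combination (1 / 2 : ℝ) * h5
    rw [h2, ENNReal.ofReal_mul (by norm_num), ENNReal.ofReal_add (by positivity) (by positivity),
      ENNReal.ofReal_add (by positivity) (by positivity), ENNReal.ofReal_mul (by norm_num),
      ENNReal.ofReal_inv_of_pos (by norm_num), ENNReal.ofReal_ofNat, ENNReal.ofReal_ofNat]
  rw [h1]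
  refine ENNReal.ofReal_le_ofReal ?_
  calc Real.cosh (t / 2) ^ 2 ≤ Real.exp ((t / 2) ^ 2 / 2) ^ 2 :=
        pow_le_pow_left₀ (Real.cosh_pos _).le (Real.cosh_le_exp_half_sq _) 2
    _ = _ := by
        rw [← Real.exp_nat_mul]
        congr 1
        push_cast
        ring

section Projection

variable {P : Params} {ι : Type} [Fintype ι]

/-- By independence, a row of signs has a sub-Gaussian inner product with `w`, with variance
parameter `N / 2`; its square is then controlled by `ex_exp_sq_le`. -/
theorem ex_bin1_dot_sq_le (w : ι → Fin P.d → ℝ) {N : ℝ} (hN : 0 < N) (hw : nrm w ^ 2 ≤ N) :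
    ex (iid (iid bin1 (Fin P.d)) ι)
      (fun r => ENNReal.ofReal (Real.exp ((∑ i, ∑ k, w i k * r i k) ^ 2 / (2 * N))))
      ≤ ENNReal.ofReal (Real.sqrt 2) := by
  have h := ex_exp_sq_le (iid (iid bin1 (Fin P.d)) ι) (fun r => ∑ i, ∑ k, w i k * r i k)
    (σ := N / 2) (by positivity) fun t => ?_
  · rwa [show 4 * (N / 2) = 2 * N by ring] at h
  · simp_rw [Finset.mul_sum]
    rw [ex_iid_iid_exp bin1 fun i k z => t * (w i k * z)]
    simp_rw [← mul_assoc]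
    refine (prod_prod_le_exp fun i k => ex_bin1_exp_le (t * w i k)).trans ?_
    refine ENNReal.ofReal_le_ofReal (Real.exp_le_exp.2 ?_)
    simp_rw [mul_pow, ← Finset.sum_div, ← Finset.mul_sum, ← nrm_sq]
    have := mul_le_mul_of_nonneg_left hw (sq_nonneg t)
    linarith

theorem card_rowIdx (P : Params) : Fintype.card (RowIdx P) = 256 := by
  rw [Fintype.card_prod, Fintype.card_fin, Fintype.card_fin]
  exact Nat.div_mul_cancel P.d_dvd

/-- The centred representatives of `R m`. -/
def projInt (R : RowIdx P → KeyIdx P → Rq P) (m : KeyIdx P → Rq P) : Fin P.nb → Fin P.d → ℤ :=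
  fun b k => (rowProd R m (b, k)).valMinAbs

theorem nrm_projInt_sq (R : RowIdx P → KeyIdx P → Rq P) (m : KeyIdx P → Rq P) :
    nrm (fun b k => (projInt R m b k : ℝ)) ^ 2 = ∑ j, ((rowProd R m j).valMinAbs : ℝ) ^ 2 := by
  rw [nrm_sq, Fintype.sum_prod_type]
  rfl

/-- The matrix of the protocol. -/
abbrev projMat (P : Params) : PMF (RowIdx P → KeyIdx P → Rq P) :=
  iid (iid (polyOf P bin1) (KeyIdx P)) (RowIdx P)

theorem nrm_sq_honest_le {m : KeyIdx P → Rq P} (hm : ∀ i k, |(lift (m i) k : ℝ)| ≤ 1) :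
    l2 m ≤ Real.sqrt ((4 * P.kap + 2 * P.lam + 6) * P.d) := by
  refine (l2_le_of_linf_le_one hm).trans_eq ?_
  congr 2
  rw [Fintype.card_prod, Fintype.card_sum, Fintype.card_fin, Fintype.card_fin, Fintype.card_fin]
  push_cast
  ring

/-- The squared norm of `R m` is a sum over `256` independent rows, and centred reduction only
decreases each term. Each row has exponential moment at most `√2` at scale `2 N`, so together they
have at most `2 ^ 128`. -/
theorem ex_projInt_le {m : KeyIdx P → Rq P} (hm : ∀ i k, |(lift (m i) k : ℝ)| ≤ 1) :
    ex (projMat P) (fun R => ind (sd3 P / 11 < nrm fun b k => (projInt R m b k : ℝ)))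
      ≤ ENNReal.ofReal (Real.exp (-400)) := by
  set N : ℝ := (4 * P.kap + 2 * P.lam + 6) * P.d with hN
  have hd : (1 : ℝ) ≤ P.d := by exact_mod_cast P.d_pos
  have hκ : (0 : ℝ) ≤ P.kap := Nat.cast_nonneg _
  have hl : (0 : ℝ) ≤ P.lam := Nat.cast_nonneg _
  have hN0 : 0 < N := by positivity
  have hmN : l2 m ^ 2 ≤ N := by
    calc l2 m ^ 2 ≤ Real.sqrt N ^ 2 := pow_le_pow_left₀ (l2_nonneg _) (nrm_sq_honest_le hm) 2
      _ = N := Real.sq_sqrt hN0.le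
  have hrow (r : KeyIdx P → Fin P.d → ℤ) (R : KeyIdx P → Rq P) (hR : R = fun i => ofInt (r i)) :
      ((∑ i, ∑ k, coef (R i) k * coef (m i) k : ZMod P.q).valMinAbs : ℝ) ^ 2
        ≤ (∑ i, ∑ k, (lift (m i) k : ℝ) * r i k) ^ 2 := by
    have h0 : (∑ i, ∑ k, coef (R i) k * coef (m i) k : ZMod P.q)
        = ((∑ i, ∑ k, lift (m i) k * r i k : ℤ) : ZMod P.q) := by
      push_cast
      refine Finset.sum_congr rfl fun i _ => Finset.sum_congr rfl fun k _ => ?_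
      rw [hR, coef_ofInt, lift, ZMod.coe_valMinAbs, mul_comm]
    rw [h0]
    refine (sq_le_sq.2 (abs_valMinAbs_intCast_le _)).trans_eq ?_
    push_cast
    rfl
  have h1 : ex (projMat P)
      (fun R => ENNReal.ofReal (Real.exp (∑ j, ((rowProd R m j).valMinAbs : ℝ) ^ 2 / (2 * N))))
      ≤ ENNReal.ofReal (Real.exp (128 * Real.log 2)) := by
    simp_rw [Real.exp_sum, ENNReal.ofReal_prod_of_nonneg fun _ _ => (Real.exp_pos _).le, rowProd]
    rw [ex_iid_prod (iid (polyOf P bin1) (KeyIdx P)) fun _ (r : KeyIdx P → Rq P) =>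
      ENNReal.ofReal (Real.exp
        (((∑ i, ∑ k, coef (r i) k * coef (m i) k : ZMod P.q).valMinAbs : ℝ) ^ 2 / (2 * N)))]
    rw [Finset.prod_const, Finset.card_univ, card_rowIdx, polyOf, ex_iid_map]
    have h2 := ex_bin1_dot_sq_le (P := P) (fun i k => (lift (m i) k : ℝ)) hN0 hmN
    have h3 : ENNReal.ofReal (Real.exp (128 * Real.log 2)) = ENNReal.ofReal (Real.sqrt 2) ^ 256 := by
      rw [← ENNReal.ofReal_pow (Real.sqrt_nonneg _), sqrt_two_eq_exp, ← Real.exp_nat_mul]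
      congr 2
      push_cast
      ring
    rw [h3]
    refine pow_le_pow_left' (le_trans (ex_mono fun r => ?_) h2) _
    refine ENNReal.ofReal_le_ofReal (Real.exp_le_exp.2 ?_)
    exact div_le_div_of_nonneg_right (hrow r _ rfl) (by positivity)
  -- The constant `337` makes the threshold `500` admissible: with `M = (κ + λ + 3) d ≥ 3` one has
  -- `1000 N ≤ 4000 M ≤ 337 · 4 M² = (𝔰₃ / 11)²`. The resulting exponent `128 log 2 - 500` is below
  -- `-400`.
  refine le_trans (ex_mono fun R => ind_mono fun hR => ?_)
    ((ex_ind_lt_le_exp _ _ (r := 500) h1).trans (ENNReal.ofReal_le_ofReal (Real.exp_le_exp.2 ?_)))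
  · have h2 : (sd3 P / 11) ^ 2 < nrm (fun b k => (projInt R m b k : ℝ)) ^ 2 :=
      pow_lt_pow_left₀ hR (div_nonneg (sd3_pos P).le (by norm_num)) two_ne_zero
    rw [nrm_projInt_sq] at h2
    rw [← Finset.sum_div, lt_div_iff₀ (by positivity)]
    refine lt_of_le_of_lt ?_ h2
    have h3 : (sd3 P / 11) ^ 2 = 337 * (2 * (P.kap + P.lam + 3) * P.d) ^ 2 := by
      rw [sd3, mul_assoc, mul_div_cancel_left₀ _ (by norm_num), mul_pow,
        Real.sq_sqrt (by norm_num)]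
    rw [h3, hN]
    have h4 : (1 : ℝ) * 3 ≤ (P.kap + P.lam + 3) * P.d := by nlinarith
    have h5 : ((4 * P.kap + 2 * P.lam + 6) * P.d : ℝ) ≤ 4 * ((P.kap + P.lam + 3) * P.d) := by
      nlinarith
    have h6 : (2 * (P.kap + P.lam + 3) * P.d : ℝ) ^ 2 = 4 * ((P.kap + P.lam + 3) * P.d) ^ 2 := by
      ring
    rw [h6]
    nlinarith
  · have := Real.log_two_lt_d9
    linarith

end Projection

/-! ### Transcripts -/

section Transcripts

variable {P : Params}

/-- The transcript with the given messages in which `w` and `v` are chosen to satisfy the equations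
of the verifier. -/
def simTrans (A : Matrix (Fin P.kap) (Fin P.n) (Rq P)) (pk : Fin 2 × Fin P.n → Rq P)
    (ck : CommKey P) (f : Fin P.kap → Rq P) (u1 : Fin P.nb → Rq P) (u2 : Rq P)
    (R : RowIdx P → KeyIdx P → Rq P) (z3 : Fin P.nb → Rq P) (dd : RowIdx P → ZMod P.q) (h c : Rq P)
    (z1 : KeyIdx P → Rq P) (z2 : Fin P.n → Rq P) : Transcript P where
  f := f
  u1 := u1
  u2 := u2
  R := R
  z3 := z3
  dd := dd
  h := h
  w := ck.A3.mulVec z1 + ck.A4.mulVec z2 - c • f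
  vTop := keyMap A z1 - c • pk
  vBot := lastRow R dd z1 (c • u1 - ck.B1.mulVec z2 - c • z3) (c * u2 - dotProduct ck.B2 z2 - c * h)
  c := c
  z1 := z1
  z2 := z2

theorem lastRow_zero_left (R : RowIdx P → KeyIdx P → Rq P) (dd : RowIdx P → ZMod P.q)
    (b : Fin P.nb → Rq P) (g : Rq P) :
    lastRow R dd 0 b g = ∑ j, dd j • conjDot (unitVec j) b + g := by
  simp [lastRow, conjDot]

/-- This reconciles the form of `vBot` stored in `simTrans`, a single value of the linear form, with
the verifier's expression. -/
theorem lastRow_sub_smul (R : RowIdx P → KeyIdx P → Rq P) (dd : RowIdx P → ZMod P.q)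
    (a : KeyIdx P → Rq P) (b z3 : Fin P.nb → Rq P) (g h c : Rq P) :
    lastRow R dd a (b - c • z3) (g - c * h)
      = lastRow R dd a b g - c * (h + ∑ j, dd j • conjDot (unitVec j) z3) := by
  rw [add_comm h, ← lastRow_zero_left R, ← lastRow_smul, ← lastRow_sub, smul_zero, sub_zero]

theorem verify_simTrans {A : Matrix (Fin P.kap) (Fin P.n) (Rq P)} {pk : Fin 2 × Fin P.n → Rq P}
    {ck : CommKey P} {f : Fin P.kap → Rq P} {u1 : Fin P.nb → Rq P} {u2 : Rq P}
    {R : RowIdx P → KeyIdx P → Rq P} {z3 : Fin P.nb → Rq P} {dd : RowIdx P → ZMod P.q} {h c : Rq P}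
    {z1 : KeyIdx P → Rq P} {z2 : Fin P.n → Rq P} (hh : cst h = 0) (h1 : l2 z1 ≤ bd1 P)
    (h2 : l2 z2 ≤ bd2 P) (h3 : (linf z3 : ℝ) ≤ bd3 P) :
    Verify A pk ck (simTrans A pk ck f u1 u2 R z3 dd h c z1 z2) where
  norm1 := h1
  norm2 := h2
  norm3 := h3
  const := hh
  opening := by simp [simTrans]
  top := rfl
  bot := lastRow_sub_smul _ _ _ _ _ _ _ _

/-- The vector of polynomials with coefficients `R m`. -/
def proj (R : RowIdx P → KeyIdx P → Rq P) (m : KeyIdx P → Rq P) : Fin P.nb → Rq P :=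
  fun b => ofInt (projInt R m b)

theorem coef_proj (R : RowIdx P → KeyIdx P → Rq P) (m : KeyIdx P → Rq P) (j : RowIdx P) :
    coef (proj R m j.1) j.2 = rowProd R m j := by
  rw [proj, coef_ofInt, projInt, ZMod.coe_valMinAbs]

/-- The constant coefficient is `∑ δ_j (⟨r_j, m⟩ - (R m)_j)`. Hence the honest `h` passes the check
on its constant coefficient, and it is distributed like `g`. -/
theorem cst_lastRow_proj (R : RowIdx P → KeyIdx P → Rq P) (dd : RowIdx P → ZMod P.q)
    (m : KeyIdx P → Rq P) : cst (lastRow R dd m (-proj R m) 0) = 0 := by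
  rw [cst_lastRow]
  have h0 : cst (0 : Rq P) = 0 := coef_zero 0
  simp [coef_neg, coef_proj, h0]

/-- The transcript computed from masks `t₁, t₂, t₃` and the secret `m`. -/
def hybTrans (A : Matrix (Fin P.kap) (Fin P.n) (Rq P)) (pk : Fin 2 × Fin P.n → Rq P)
    (ck : CommKey P) (m : KeyIdx P → Rq P) (t1 : Fin P.kap → Rq P) (t2 : Fin P.nb → Rq P) (t3 : Rq P)
    (R : RowIdx P → KeyIdx P → Rq P) (z3 : Fin P.nb → Rq P) (dd : RowIdx P → ZMod P.q) (h c : Rq P)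
    (z1 : KeyIdx P → Rq P) (z2 : Fin P.n → Rq P) : Transcript P :=
  simTrans A pk ck (t1 + ck.A3.mulVec m) (t2 + (z3 - proj R m))
    (t3 + (h - lastRow R dd m (-proj R m) 0)) R z3 dd h c z1 z2

/-- The transcript of the honest prover. -/
def honestTrans (A : Matrix (Fin P.kap) (Fin P.n) (Rq P)) (ck : CommKey P) (m : KeyIdx P → Rq P)
    (s : Fin P.n → Rq P) (g : Rq P) (y1 : KeyIdx P → Rq P) (y2 : Fin P.n → Rq P)
    (y3 : Fin P.nb → Rq P) (R : RowIdx P → KeyIdx P → Rq P) (z3 : Fin P.nb → Rq P)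
    (dd : RowIdx P → ZMod P.q) (c : Rq P) (z1 : KeyIdx P → Rq P) (z2 : Fin P.n → Rq P) :
    Transcript P where
  f := ck.A3.mulVec m + ck.A4.mulVec s
  u1 := ck.B1.mulVec s + y3
  u2 := dotProduct ck.B2 s + g
  R := R
  z3 := z3
  dd := dd
  h := g + ∑ j, dd j • (conjDot (R j) m + conjDot (unitVec j) y3 - conjDot (unitVec j) z3)
  w := ck.A3.mulVec y1 + ck.A4.mulVec y2
  vTop := keyMap A y1
  vBot := lastRow R dd y1 (-(ck.B1.mulVec y2)) (-(dotProduct ck.B2 y2))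
  c := c
  z1 := z1
  z2 := z2

/-- The masks can be eliminated: `y₁ = z₁ - c m`, `y₂ = z₂ - c s` and `y₃ = z₃ - R m`. By linearity
`w` and `v` then take the values dictated by the verifier's equations, and `s` enters the other
messages only through its products with the commitment key. -/
theorem honestTrans_eq {A : Matrix (Fin P.kap) (Fin P.n) (Rq P)} {pk : Fin 2 × Fin P.n → Rq P}
    {m : KeyIdx P → Rq P} (hpk : keyMap A m = pk) (ck : CommKey P)
    (s : Fin P.n → Rq P) (g : Rq P) (y1 : KeyIdx P → Rq P) (y2 : Fin P.n → Rq P)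
    (y3 : Fin P.nb → Rq P) (R : RowIdx P → KeyIdx P → Rq P) (dd : RowIdx P → ZMod P.q) (c : Rq P) :
    honestTrans A ck m s g y1 y2 y3 R (y3 + proj R m) dd c (y1 + c • m) (y2 + c • s)
      = hybTrans A pk ck m (ck.A4.mulVec s) (ck.B1.mulVec s) (dotProduct ck.B2 s) R (y3 + proj R m) dd
        (g + lastRow R dd m (-proj R m) 0) c (y1 + c • m) (y2 + c • s) := by
  have hx : ∑ j, dd j • (conjDot (R j) m + conjDot (unitVec j) y3
      - conjDot (unitVec j) (y3 + proj R m)) = lastRow R dd m (-proj R m) 0 := by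
    simp only [lastRow, conjDot_add, conjDot_neg, add_zero, ← Finset.sum_add_distrib, ← smul_add]
    exact Finset.sum_congr rfl fun j _ => by congr 1; ring
  unfold honestTrans hybTrans simTrans
  rw [hx]
  congr 1
  · exact add_comm _ _
  · rw [add_sub_cancel_right]
  · rw [add_sub_cancel_right]
  · simp only [Matrix.mulVec_add, Matrix.mulVec_smul, smul_add]
    abel
  · rw [keyMap_add, keyMap_smul, hpk, add_sub_cancel_right]
  · have h1 : c • (ck.B1.mulVec s + (y3 + proj R m - proj R m)) - ck.B1.mulVec (y2 + c • s)
        - c • (y3 + proj R m) = -(ck.B1.mulVec y2) + c • (-proj R m) := by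
      simp only [Matrix.mulVec_add, Matrix.mulVec_smul, smul_add, smul_neg, add_sub_cancel_right]
      abel
    have h2 : c * (dotProduct ck.B2 s + (g + lastRow R dd m (-proj R m) 0
        - lastRow R dd m (-proj R m) 0)) - dotProduct ck.B2 (y2 + c • s)
        - c * (g + lastRow R dd m (-proj R m) 0)
        = -(dotProduct ck.B2 y2) + (c * 0 - c * lastRow R dd m (-proj R m) 0) := by
      simp only [dotProduct_add, dotProduct_smul, smul_eq_mul]
      ring
    rw [h1, h2, ← add_sub_assoc, add_comm (-(dotProduct ck.B2 y2)), add_sub_right_comm]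
    have h3 := lastRow_add R dd (c • m) y1 (c • -proj R m) (-(ck.B1.mulVec y2))
      (c * 0) (-(dotProduct ck.B2 y2))
    rw [lastRow_smul] at h3
    have h4 (a : KeyIdx P → Rq P) (b : Fin P.nb → Rq P) (g' x : Rq P) :
        lastRow R dd a b (g' - x) = lastRow R dd a b g' - x := by
      simp only [lastRow]
      ring
    rw [add_comm y1, add_comm (-(ck.B1.mulVec y2)), sub_add_eq_add_sub, h4, h3]
    ring

end Transcripts

section Honest

variable {P : Params}

/-- The centred representatives of a vector of ring elements. -/
def liftVec {ι : Type} (a : ι → Rq P) : ι → Fin P.d → ℤ := fun i => lift (a i)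

/-- Reduction modulo `q` of a vector of integer coefficient vectors. -/
def ofIntVec {ι : Type} (a : ι → Fin P.d → ℤ) : ι → Rq P := fun i => ofInt (a i)

theorem ofIntVec_add {ι : Type} (a b : ι → Fin P.d → ℤ) :
    (ofIntVec (a + b) : ι → Rq P) = ofIntVec a + ofIntVec b := by
  funext i
  exact ofInt_add _ _

theorem ofIntVec_liftVec {ι : Type} (a : ι → Rq P) : ofIntVec (liftVec a) = a := by
  funext i
  exact ofInt_lift _

theorem ofIntVec_projInt (R : RowIdx P → KeyIdx P → Rq P) (m : KeyIdx P → Rq P) :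
    ofIntVec (projInt R m) = proj R m := rfl

/-- A test function that vanishes on aborts removes the failing branches, so every rejection step
contributes just the factor `acc`. -/
theorem ex_honestRun (D : Dists P) (A : Matrix (Fin P.kap) (Fin P.n) (Rq P)) (ck : CommKey P)
    (m : KeyIdx P → Rq P) (G : Option (Transcript P) → ℝ≥0∞) (hG : G none = 0) :
    ex (honestRun D A ck m) G =
      ex (iid (polyOf P D.chi) (Fin P.n)) fun s =>
      ex (unifZero P) fun g =>
      ex (gaussVec P (sd1 P) (sd1_pos P) (KeyIdx P)) fun y1 =>
      ex (gaussVec P (sd2 P) (sd2_pos P) (Fin P.n)) fun y2 =>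
      ex (gaussVec P (sd3 P) (sd3_pos P) (Fin P.nb)) fun y3 =>
      ex (projMat P) fun R => acc (y3 + projInt R m) (projInt R m) (sd3 P) *
      ex (iid (PMF.uniformOfFintype (ZMod P.q)) (RowIdx P)) fun dd =>
      ex D.chal fun c => acc (y1 + liftVec (c • m)) (liftVec (c • m)) (sd1 P) *
        (acc (y2 + liftVec (c • s)) (liftVec (c • s)) (sd2 P) *
          G (some (honestTrans A ck m s g (ofIntVec y1) (ofIntVec y2) (ofIntVec y3) R
            (ofIntVec (y3 + projInt R m)) dd c (ofIntVec (y1 + liftVec (c • m)))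
            (ofIntVec (y2 + liftVec (c • s)))))) := by
  have hn {b : PMF (Option (Transcript P))} : ex (if false = false then pure none else b) G = 0 := by
    rw [if_pos rfl, ex_pure, hG]
  have ht {b : PMF (Option (Transcript P))} : ex (if true = false then pure none else b) G
      = ex b G := by
    rw [if_neg (by simp)]
  unfold honestRun
  refine (ex_bind _ _ _).trans (ex_congr fun s => ?_)
  refine (ex_bind _ _ _).trans (ex_congr fun g => ?_)
  refine (ex_bind _ _ _).trans (ex_congr fun y1 => ?_)
  refine (ex_bind _ _ _).trans (ex_congr fun y2 => ?_)
  refine (ex_bind _ _ _).trans (ex_congr fun y3 => ?_)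
  refine (ex_bind _ _ _).trans (ex_congr fun R => ?_)
  refine (ex_bind _ _ _).trans ((ex_rej _ _ _ _ hn).trans ?_)
  refine congrArg₂ (· * ·) rfl (ht.trans ?_)
  refine (ex_bind _ _ _).trans (ex_congr fun dd => ?_)
  refine (ex_bind _ _ _).trans (ex_congr fun c => ?_)
  refine (ex_bind _ _ _).trans ((ex_rej _ _ _ _ hn).trans ?_)
  refine congrArg₂ (· * ·) rfl (ht.trans ?_)
  refine (ex_bind _ _ _).trans ((ex_rej _ _ _ _ hn).trans ?_)
  refine congrArg₂ (· * ·) rfl (ht.trans ?_)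
  exact ex_pure _ _

/-- All samples are independent, so the challenges may be drawn before the Gaussian masks. Each
acceptance factor then involves a single mask, and the three rejection steps can be treated
separately. -/
theorem ex_reorder {S G Y1 Y2 Y3 R C E : Type} (ps : PMF S) (pg : PMF G) (p1 : PMF Y1) (p2 : PMF Y2)
    (p3 : PMF Y3) (pR : PMF R) (pd : PMF E) (pc : PMF C) (a3 : Y3 → R → ℝ≥0∞) (a1 : Y1 → C → ℝ≥0∞)
    (a2 : S → Y2 → C → ℝ≥0∞) (H : S → G → Y1 → Y2 → Y3 → R → E → C → ℝ≥0∞) :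
    (ex ps fun s => ex pg fun g => ex p1 fun y1 => ex p2 fun y2 => ex p3 fun y3 => ex pR fun R =>
      a3 y3 R * ex pd fun dd => ex pc fun c => a1 y1 c * (a2 s y2 c * H s g y1 y2 y3 R dd c))
    = ex ps fun s => ex pR fun R => ex pd fun dd => ex pc fun c => ex pg fun g =>
      ex p1 fun y1 => a1 y1 c * ex p2 fun y2 => a2 s y2 c * ex p3 fun y3 =>
        a3 y3 R * H s g y1 y2 y3 R dd c := by
  simp_rw [← ex_mul_left]
  simp_rw [ex_comm p3 pR, ex_comm p2 pR, ex_comm p1 pR, ex_comm pg pR]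
  simp_rw [ex_comm p3 pd, ex_comm p2 pd, ex_comm p1 pd, ex_comm pg pd]
  simp_rw [ex_comm p3 pc, ex_comm p2 pc, ex_comm p1 pc, ex_comm pg pc]
  refine ex_congr fun s => ex_congr fun R => ex_congr fun dd => ex_congr fun c => ex_congr fun g =>
    ex_congr fun y1 => ex_congr fun y2 => ex_congr fun y3 => ?_
  ring

/-- The distribution of Gaussian polynomial vectors. -/
abbrev gaussPoly (P : Params) {s : ℝ} (hs : 0 < s) (ι : Type) [Fintype ι] : PMF (ι → Rq P) :=
  iid (polyOf P (gauss s hs)) ι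

theorem ex_gaussPoly {s : ℝ} (hs : 0 < s) {ι : Type} [Fintype ι] (F : (ι → Rq P) → ℝ≥0∞) :
    ex (gaussPoly P hs ι) F = ex (gaussVec P s hs ι) fun y => F (ofIntVec y) :=
  ex_iid_map _ _ _

/-- The transcript computed from the masks, with fresh challenges and independent responses. -/
def maskRun (D : Dists P) (A : Matrix (Fin P.kap) (Fin P.n) (Rq P)) (pk : Fin 2 × Fin P.n → Rq P)
    (ck : CommKey P) (m : KeyIdx P → Rq P) (t1 : Fin P.kap → Rq P) (t2 : Fin P.nb → Rq P)
    (t3 : Rq P) : PMF (Transcript P) := do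
  let R ← projMat P
  let dd ← iid (PMF.uniformOfFintype (ZMod P.q)) (RowIdx P)
  let c ← D.chal
  let h ← unifZero P
  let z1 ← gaussPoly P (sd1_pos P) (KeyIdx P)
  let z2 ← gaussPoly P (sd2_pos P) (Fin P.n)
  let z3 ← gaussPoly P (sd3_pos P) (Fin P.nb)
  pure (hybTrans A pk ck m t1 t2 t3 R z3 dd h c z1 z2)

/-- The honest transcript without rejection steps, and with responses independent of the secret. -/
def hybRun (D : Dists P) (A : Matrix (Fin P.kap) (Fin P.n) (Rq P)) (pk : Fin 2 × Fin P.n → Rq P)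
    (ck : CommKey P) (m : KeyIdx P → Rq P) : PMF (Transcript P) := do
  let s ← iid (polyOf P D.chi) (Fin P.n)
  maskRun D A pk ck m (ck.A4.mulVec s) (ck.B1.mulVec s) (dotProduct ck.B2 s)

theorem ex_maskRun (D : Dists P) (A : Matrix (Fin P.kap) (Fin P.n) (Rq P))
    (pk : Fin 2 × Fin P.n → Rq P) (ck : CommKey P) (m : KeyIdx P → Rq P) (t1 : Fin P.kap → Rq P)
    (t2 : Fin P.nb → Rq P) (t3 : Rq P) (F : Transcript P → ℝ≥0∞) :
    ex (maskRun D A pk ck m t1 t2 t3) F =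
      ex (projMat P) fun R =>
      ex (iid (PMF.uniformOfFintype (ZMod P.q)) (RowIdx P)) fun dd =>
      ex D.chal fun c => ex (unifZero P) fun h =>
      ex (gaussVec P (sd1 P) (sd1_pos P) (KeyIdx P)) fun z1 =>
      ex (gaussVec P (sd2 P) (sd2_pos P) (Fin P.n)) fun z2 =>
      ex (gaussVec P (sd3 P) (sd3_pos P) (Fin P.nb)) fun z3 =>
        F (hybTrans A pk ck m t1 t2 t3 R (ofIntVec z3) dd h c (ofIntVec z1) (ofIntVec z2)) := by
  simp_rw [maskRun, ex_bind, ex_pure, ex_gaussPoly]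

/-- Non-aborting honest transcripts have at most a `1 / 27` of the mass of the hybrid ones. -/
theorem ex_honestRun_le (D : Dists P) {A : Matrix (Fin P.kap) (Fin P.n) (Rq P)}
    {pk : Fin 2 × Fin P.n → Rq P} (ck : CommKey P) {m : KeyIdx P → Rq P} (hpk : keyMap A m = pk)
    (G : Option (Transcript P) → ℝ≥0∞) (hG : G none = 0) :
    ex (honestRun D A ck m) G ≤ 27⁻¹ * ex (hybRun D A pk ck m) fun t => G (some t) := by
  rw [ex_honestRun D A ck m G hG, ex_reorder, hybRun, ex_bind, ← ex_mul_left]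
  refine ex_mono fun s => ?_
  rw [ex_maskRun, ← ex_mul_left]
  refine ex_mono fun R => ?_
  rw [← ex_mul_left]
  refine ex_mono fun dd => ?_
  rw [← ex_mul_left]
  refine ex_mono fun c => ?_
  -- The uniform `h` of the hybrid is matched with the honest value, which is `g` plus an element
  -- with constant coefficient `0`.
  conv_rhs => rw [← ex_unifZero_shift _ (cst_lastRow_proj R dd m)]
  rw [← ex_mul_left]
  refine ex_mono fun g => ?_
  simp_rw [ofIntVec_add, ofIntVec_liftVec, ofIntVec_projInt, honestTrans_eq hpk]
  have h27 : (27⁻¹ : ℝ≥0∞) = 3⁻¹ * (3⁻¹ * 3⁻¹) := by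
    rw [← ENNReal.mul_inv (by simp) (by simp), ← ENNReal.mul_inv (by simp) (by simp)]
    norm_num
  rw [h27, mul_assoc]
  set H := fun (y1 : KeyIdx P → Fin P.d → ℤ) (y2 : Fin P.n → Fin P.d → ℤ)
    (y3 : Fin P.nb → Fin P.d → ℤ) => G (some (hybTrans A pk ck m (ck.A4.mulVec s) (ck.B1.mulVec s)
      (dotProduct ck.B2 s) R (ofIntVec y3) dd (g + lastRow R dd m (-proj R m) 0) c (ofIntVec y1)
      (ofIntVec y2)))
  -- The three rejection bounds are nested: the remaining averages, with their factors `1 / 3`,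
  -- serve as the test function for the response treated first.
  have h1 := ex_acc_le (sd1_pos P) (liftVec (c • m)) fun y1 =>
    3⁻¹ * ex (gaussVec P (sd2 P) (sd2_pos P) (Fin P.n)) fun y2 =>
      3⁻¹ * ex (gaussVec P (sd3 P) (sd3_pos P) (Fin P.nb)) fun y3 => H y1 y2 y3
  simp_rw [ex_mul_left] at h1
  rw [mul_assoc]
  refine le_trans (ex_mono fun y1 => mul_le_mul_right ?_ _) h1
  have h2 := ex_acc_le (sd2_pos P) (liftVec (c • s)) fun y2 =>
    3⁻¹ * ex (gaussVec P (sd3 P) (sd3_pos P) (Fin P.nb)) fun y3 =>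
      H (y1 + liftVec (c • m)) y2 y3
  simp_rw [ex_mul_left] at h2
  refine le_trans (ex_mono fun y2 => mul_le_mul_right ?_ _) h2
  have h3 := ex_acc_le (sd3_pos P) (projInt R m) fun y3 =>
      H (y1 + liftVec (c • m)) (y2 + liftVec (c • s)) y3
  refine le_trans (le_of_eq (ex_congr fun y3 => ?_)) h3
  simp only [H, ofIntVec_add, ofIntVec_liftVec, ofIntVec_projInt]

theorem abs_lift_le_one_of_chi {D : Dists P} {s : Fin P.n → Rq P}
    (hs : s ∈ (iid (polyOf P D.chi) (Fin P.n)).support) (i : Fin P.n) (k : Fin P.d) :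
    |(lift (s i) k : ℝ)| ≤ 1 := by
  obtain ⟨a, ha, hsa⟩ := (PMF.mem_support_map_iff _ _ _).1 (mem_support_iid hs i)
  rw [← hsa]
  refine (abs_lift_ofInt_le a k).trans ?_
  rcases D.chi_supp _ (mem_support_iid ha k) with h | h | h <;> rw [h] <;> norm_num

theorem nrm_liftVec {ι : Type} [Fintype ι] (a : ι → Rq P) :
    (nrm fun i k => (liftVec a i k : ℝ)) = l2 a := rfl

/-- The probability that the honest prover does not abort is close to `1 / 27`. -/
theorem le_ex_honestRun_isSome (D : Dists P) (A : Matrix (Fin P.kap) (Fin P.n) (Rq P))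
    (ck : CommKey P) {m : KeyIdx P → Rq P} (hm : linf m ≤ 1) :
    27⁻¹ * ((1 - ENNReal.ofReal (Real.exp (-72))) ^ 3 * (1 - ENNReal.ofReal (Real.exp (-400))))
      ≤ ex (honestRun D A ck m) fun o => ind (o.isSome = true) := by
  have hm1 (i : KeyIdx P) (k : Fin P.d) : |(lift (m i) k : ℝ)| ≤ 1 :=
    (abs_lift_le_linf m i k).trans (by exact_mod_cast hm)
  set δ := 3⁻¹ * (1 - ENNReal.ofReal (Real.exp (-72))) with hδ
  have h27 : 27⁻¹ * ((1 - ENNReal.ofReal (Real.exp (-72))) ^ 3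
      * (1 - ENNReal.ofReal (Real.exp (-400))))
      = δ * (δ * (δ * (1 - ENNReal.ofReal (Real.exp (-400))))) := by
    have h27' : (27⁻¹ : ℝ≥0∞) = 3⁻¹ * (3⁻¹ * 3⁻¹) := by
      rw [← ENNReal.mul_inv (by simp) (by simp), ← ENNReal.mul_inv (by simp) (by simp)]
      norm_num
    rw [h27', hδ]
    ring
  rw [ex_honestRun D A ck m _ (ind_not (by simp)), ex_reorder, h27,
    ← ex_const (iid (polyOf P D.chi) (Fin P.n)) (δ * _)]
  refine ex_mono_support fun s hs => ?_
  -- The bound for the third response needs a short projection. Matrices with a long projection are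
  -- simply given the lower bound `0`.
  have hR : δ * (1 - ENNReal.ofReal (Real.exp (-400))) ≤ ex (projMat P) fun R =>
      ex (gaussVec P (sd3 P) (sd3_pos P) (Fin P.nb)) fun y3 =>
        acc (y3 + projInt R m) (projInt R m) (sd3 P) := by
    have h1 := ex_ind_add_not (projMat P) fun R =>
      sd3 P / 11 < nrm fun b k => (projInt R m b k : ℝ)
    have h2 : 1 - ENNReal.ofReal (Real.exp (-400)) ≤ ex (projMat P) fun R =>
        ind (¬sd3 P / 11 < nrm fun b k => (projInt R m b k : ℝ)) := by
      rw [tsub_le_iff_left, ← h1]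
      gcongr
      exact ex_projInt_le hm1
    refine (mul_le_mul_right h2 _).trans ?_
    rw [← ex_mul_left]
    refine ex_mono fun R => ?_
    by_cases h : sd3 P / 11 < nrm fun b k => (projInt R m b k : ℝ)
    · rw [ind_not (not_not.2 h), mul_zero]
      exact zero_le
    · rw [ind_of h, mul_one]
      exact le_ex_acc (sd3_pos P) _ (not_lt.1 h)
  refine (mul_le_mul_right (mul_le_mul_right hR _) _).trans ?_
  rw [← ex_mul_left, ← ex_mul_left]
  refine ex_mono fun R => ?_
  rw [← ex_const (iid (PMF.uniformOfFintype (ZMod P.q)) (RowIdx P)) (δ * _)]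
  refine ex_mono fun dd => ?_
  rw [← ex_const D.chal (δ * _)]
  refine ex_mono_support fun c hc => ?_
  rw [← ex_const (unifZero P) (δ * _)]
  refine ex_mono fun g => ?_
  simp_rw [Option.isSome_some, ind_of True.intro, mul_one]
  have hom : (0 : ℝ) ≤ P.om := Nat.cast_nonneg _
  have hc1 := D.chal_supp c hc
  -- Here `𝔰₁ / 11 = ω √((4κ + 2λ + 6) d)` is the product of the bounds on `‖c‖₁` and `‖m‖`.
  have hacc1 : δ ≤ ex (gaussVec P (sd1 P) (sd1_pos P) (KeyIdx P)) fun y =>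
      acc (y + liftVec (c • m)) (liftVec (c • m)) (sd1 P) := by
    refine le_ex_acc (sd1_pos P) _ ?_
    rw [nrm_liftVec]
    refine (l2_mul_le c m).trans ((mul_le_mul hc1 (nrm_sq_honest_le hm1) (l2_nonneg _) hom).trans_eq
      ?_)
    rw [sd1]
    ring
  have hacc2 : δ ≤ ex (gaussVec P (sd2 P) (sd2_pos P) (Fin P.n)) fun y =>
      acc (y + liftVec (c • s)) (liftVec (c • s)) (sd2 P) := by
    refine le_ex_acc (sd2_pos P) _ ?_
    rw [nrm_liftVec]
    refine (l2_mul_le c s).trans ((mul_le_mul hc1 (l2_le_of_linf_le_one (abs_lift_le_one_of_chi hs))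
      (l2_nonneg _) hom).trans_eq ?_)
    rw [sd2, Fintype.card_fin]
    push_cast
    ring
  simp_rw [ex_mul_right]
  exact mul_le_mul' hacc1 (mul_le_mul_left hacc2 _)

/-- The probability of aborting in excess of `26 / 27`, up to the factor `27`. -/
def abortErr : ℝ := 4 * Real.exp (-72)

/-- The factor `3 / 5` is slack: it gives `8 exp (-72) ≤ 2⁻¹⁰⁰` for zero-knowledge, and it absorbs
the factor of about `5 / 2` that appears in the completeness error. -/
theorem exp_neg_72_le : Real.exp (-72) ≤ 1 / 2 ^ 103 * (3 / 5) := by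
  have h1 : (2.718 : ℝ) ^ 72 ≤ Real.exp 72 := by
    have h2 := Real.exp_one_gt_d9
    calc (2.718 : ℝ) ^ 72 ≤ Real.exp 1 ^ 72 := by gcongr; linarith
      _ = Real.exp 72 := by rw [← Real.exp_nat_mul]; norm_num
  rw [Real.exp_neg, inv_le_comm₀ (Real.exp_pos _) (by norm_num)]
  refine le_trans ?_ h1
  norm_num

theorem le_pr_honestRun_isSome (D : Dists P) (A : Matrix (Fin P.kap) (Fin P.n) (Rq P))
    (ck : CommKey P) {m : KeyIdx P → Rq P} (hm : linf m ≤ 1) :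
    1 / 27 * (1 - abortErr) ≤ pr (honestRun D A ck m) (fun o => o.isSome = true) := by
  have h := le_ex_honestRun_isSome D A ck hm
  set x := Real.exp (-72) with hx
  have hx0 : 0 < x := Real.exp_pos _
  have hx1 : x ≤ 1 / 8 := exp_neg_72_le.trans (by norm_num)
  set y := Real.exp (-400) with hy
  have hy0 : 0 < y := Real.exp_pos _
  have hyx : y ≤ x := Real.exp_le_exp.2 (by norm_num)
  have h1 : 27⁻¹ * ((1 - ENNReal.ofReal x) ^ 3 * (1 - ENNReal.ofReal y))
      = ENNReal.ofReal (1 / 27 * ((1 - x) ^ 3 * (1 - y))) := by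
    rw [ENNReal.ofReal_mul (by norm_num), ENNReal.ofReal_mul (by apply pow_nonneg; linarith),
      ENNReal.ofReal_pow (by linarith), ENNReal.ofReal_sub _ hx0.le, ENNReal.ofReal_sub _ hy0.le,
      ENNReal.ofReal_one, one_div, ENNReal.ofReal_inv_of_pos (by norm_num), ENNReal.ofReal_ofNat]
  rw [h1, ← ofReal_pr, ENNReal.ofReal_le_ofReal_iff (by exact ENNReal.toReal_nonneg)] at h
  refine le_trans ?_ h
  -- Bernoulli's inequality; the four factors are the three rejection steps and the event of a short
  -- projection.
  have h2 : 1 - abortErr ≤ (1 - x) ^ 4 := by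
    have := one_add_mul_le_pow (a := -x) (by linarith) 4
    rw [abortErr, ← hx]
    push_cast at this
    rw [← sub_eq_add_neg] at this
    linarith
  have h3 : (1 - x) ^ 4 ≤ (1 - x) ^ 3 * (1 - y) := by
    rw [pow_succ]
    exact mul_le_mul_of_nonneg_left (by linarith) (by apply pow_nonneg; linarith)
  linarith

theorem pr_honestRun_le (D : Dists P) {A : Matrix (Fin P.kap) (Fin P.n) (Rq P)}
    {pk : Fin 2 × Fin P.n → Rq P} (ck : CommKey P) {m : KeyIdx P → Rq P} (hpk : keyMap A m = pk)
    (E : Transcript P → Prop) :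
    pr (honestRun D A ck m) (fun o => ∃ t, o = some t ∧ E t)
      ≤ 1 / 27 * pr (hybRun D A pk ck m) E := by
  have h := ex_honestRun_le D ck hpk (fun o => ind (∃ t, o = some t ∧ E t)) (ind_not (by simp))
  rw [pr_eq, pr_eq]
  refine (ENNReal.toReal_mono ?_ h).trans_eq ?_
  · exact ENNReal.mul_ne_top (by simp) (ex_ind_ne_top _ _)
  · rw [ENNReal.toReal_mul]
    simp

/-- The equations hold by construction and `h` has constant coefficient `0`, so only the three norm
checks can fail. The responses are reductions of centred Gaussians whatever `s` and the challenges
are, and the Gaussian tails are added by a union bound. -/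
theorem pr_hybRun_not_verify (D : Dists P) (A : Matrix (Fin P.kap) (Fin P.n) (Rq P))
    (pk : Fin 2 × Fin P.n → Rq P) (ck : CommKey P) (m : KeyIdx P → Rq P) :
    pr (hybRun D A pk ck m) (fun t => ¬Verify A pk ck t)
      ≤ (2 : ℝ) ^ (-((2 * P.kap + P.lam + 3) * P.d / 4 : ℝ))
        + (2 : ℝ) ^ (-((P.kap + P.lam + 3) * P.d / 8 : ℝ)) + 2 ^ 9 * Real.exp (-128) := by
  rw [pr_eq]
  refine ENNReal.toReal_le_of_le_ofReal (by positivity) ?_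
  rw [hybRun, ex_bind]
  refine ex_le_const fun s => ?_
  rw [ex_maskRun]
  refine ex_le_const fun R => ex_le_const fun dd => ex_le_const fun c => ?_
  rw [← ex_const (unifZero P) (ENNReal.ofReal _)]
  refine ex_mono_support fun h hh => ?_
  rw [ENNReal.ofReal_add (by positivity) (by positivity),
    ENNReal.ofReal_add (by positivity) (by positivity)]
  have h1 := ex_gaussVec_norm_le (P := P) (ι := KeyIdx P) (sd1_pos P)
  have h2 := ex_gaussVec_norm_le (P := P) (ι := Fin P.n) (sd2_pos P)
  have h3 := ex_gaussVec_max_le (P := P) (ι := Fin P.nb) (sd3_pos P)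
  have e1 : sd1 P * Real.sqrt (2 * (Fintype.card (KeyIdx P) * P.d)) = bd1 P := by
    rw [bd1, Fintype.card_prod, Fintype.card_sum, Fintype.card_fin, Fintype.card_fin,
      Fintype.card_fin]
    push_cast
    ring_nf
  have e1' : (2 : ℝ) ^ (-((Fintype.card (KeyIdx P) : ℝ) * P.d / 8))
      = (2 : ℝ) ^ (-((2 * P.kap + P.lam + 3) * P.d / 4 : ℝ)) := by
    rw [Fintype.card_prod, Fintype.card_sum, Fintype.card_fin, Fintype.card_fin,
      Fintype.card_fin]
    push_cast
    ring_nf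
  have e2 : sd2 P * Real.sqrt (2 * (Fintype.card (Fin P.n) * P.d)) = bd2 P := by
    rw [bd2, Fintype.card_fin]
    push_cast
    ring_nf
  have e2' : (2 : ℝ) ^ (-((Fintype.card (Fin P.n) : ℝ) * P.d / 8))
      = (2 : ℝ) ^ (-((P.kap + P.lam + 3) * P.d / 8 : ℝ)) := by
    rw [Fintype.card_fin]
    push_cast
    ring_nf
  have e3 : 16 * sd3 P = bd3 P := by
    rw [bd3, show (2 * 128 : ℝ) = 16 ^ 2 by norm_num, Real.sqrt_sq (by norm_num)]
  have e3' : (Fintype.card (Fin P.nb) : ℝ) * P.d * (2 * Real.exp (-128)) = 2 ^ 9 * Real.exp (-128) := by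
    have h4 : ((P.nb * P.d : ℕ) : ℝ) = 256 := by
      rw [Nat.div_mul_cancel P.d_dvd]
      norm_num
    rw [Fintype.card_fin]
    push_cast at h4
    rw [h4]
    ring
  rw [e1, e1'] at h1
  rw [e2, e2'] at h2
  rw [e3, e3'] at h3
  refine le_trans ?_ (add_le_add (add_le_add h1 h2) h3)
  rw [← ex_const (gaussVec P (sd1 P) (sd1_pos P) (KeyIdx P)) (ex (gaussVec P (sd2 P) _ _) _), ← ex_add,
    ← ex_const (gaussVec P (sd1 P) (sd1_pos P) (KeyIdx P)) (ex (gaussVec P (sd3 P) _ _) _), ← ex_add]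
  refine ex_mono fun z1 => ?_
  rw [← ex_const (gaussVec P (sd2 P) (sd2_pos P) (Fin P.n)) (ind (bd1 P < _)), ← ex_add,
    ← ex_const (gaussVec P (sd2 P) (sd2_pos P) (Fin P.n)) (ex (gaussVec P (sd3 P) _ _) _), ← ex_add]
  refine ex_mono fun z2 => ?_
  rw [← ex_const (gaussVec P (sd3 P) (sd3_pos P) (Fin P.nb)) (ind (bd1 P < _) + ind (bd2 P < _)),
    ← ex_add]
  refine ex_mono fun z3 => ?_
  refine le_trans (ind_mono fun hv => ?_) ((ind_or_le (_ ∨ _) _).trans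
    (add_le_add_left (ind_or_le _ _) _))
  by_contra hcon
  rw [not_or, not_or, not_lt, not_lt] at hcon
  push Not at hcon
  refine hv (verify_simTrans (cst_of_mem_unifZero hh) ((l2_ofInt_le _).trans hcon.1.1)
    ((l2_ofInt_le _).trans hcon.1.2) (linf_le_real ?_ fun i k => ?_))
  · exact mul_nonneg (Real.sqrt_nonneg _) (sd3_pos P).le
  · exact (abs_lift_ofInt_le _ _).trans (hcon.2 i k)

/-- Completeness. -/
theorem completeness (D : Dists P) (A : Matrix (Fin P.kap) (Fin P.n) (Rq P))
    (pk : Fin 2 × Fin P.n → Rq P) (ck : CommKey P) (m : KeyIdx P → Rq P) (h : HonestRel A pk m) :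
    (1 / 27 - 1 / 2 ^ 100 : ℝ) ≤ pr (honestRun D A ck m) (fun o => o.isSome = true) ∧
      (1 - complErr P) * pr (honestRun D A ck m) (fun o => o.isSome = true)
        ≤ pr (honestRun D A ck m) (fun o => ∃ t, o = some t ∧ Verify A pk ck t) := by
  have h1 := le_pr_honestRun_isSome D A ck h.1
  have h2 := exp_neg_72_le
  have h3 := (pr_honestRun_le D ck h.2 fun t => ¬Verify A pk ck t).trans
    (mul_le_mul_of_nonneg_left (pr_hybRun_not_verify D A pk ck m) (by norm_num))
  have h4 : pr (honestRun D A ck m) (fun o => o.isSome = true)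
      = pr (honestRun D A ck m) (fun o => ∃ t, o = some t ∧ Verify A pk ck t)
        + pr (honestRun D A ck m) (fun o => ∃ t, o = some t ∧ ¬Verify A pk ck t) := by
    rw [pr_eq, pr_eq, pr_eq, ← ENNReal.toReal_add (ex_ind_ne_top _ _) (ex_ind_ne_top _ _), ← ex_add]
    congr 1
    refine ex_congr fun o => ?_
    cases o with
    | none => simp [ind]
    | some t =>
      simp only [Option.isSome_some, Option.some.injEq, exists_eq_left', ind_add_ind_not]
      exact ind_of True.intro
  have hA : abortErr ≤ 4 * (1 / 2 ^ 103 * (3 / 5)) := by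
    rw [abortErr]
    linarith
  refine ⟨?_, ?_⟩
  · refine le_trans ?_ h1
    linarith
  · set a := pr (honestRun D A ck m) (fun o => o.isSome = true)
    set τ := (2 : ℝ) ^ (-((2 * P.kap + P.lam + 3) * P.d / 4 : ℝ))
        + (2 : ℝ) ^ (-((P.kap + P.lam + 3) * P.d / 8 : ℝ)) + 2 ^ 9 * Real.exp (-128) with hτ
    have hc : complErr P = τ + 1 / 2 ^ 100 := by rw [complErr]
    have hτ0 : 0 ≤ τ := by positivity
    have hτ1 : τ ≤ 5 / 2 := by
      have e1 : (2 : ℝ) ^ (-((2 * P.kap + P.lam + 3) * P.d / 4 : ℝ)) ≤ 1 :=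
        Real.rpow_le_one_of_one_le_of_nonpos one_le_two (by
          have : (0 : ℝ) ≤ (2 * P.kap + P.lam + 3) * P.d / 4 := by positivity
          linarith)
      have e2 : (2 : ℝ) ^ (-((P.kap + P.lam + 3) * P.d / 8 : ℝ)) ≤ 1 :=
        Real.rpow_le_one_of_one_le_of_nonpos one_le_two (by
          have : (0 : ℝ) ≤ (P.kap + P.lam + 3) * P.d / 8 := by positivity
          linarith)
      have e3 : Real.exp (-128) ≤ Real.exp (-72) := Real.exp_le_exp.2 (by norm_num)
      rw [hτ]
      linarith
    -- The rejected mass is at most `τ / 27`, to be compared with `(τ + 2⁻¹⁰⁰) a`, where `a` is only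
    -- known to be at least `(1 - abortErr) / 27`. This needs `(τ + 2⁻¹⁰⁰) abortErr ≤ 2⁻¹⁰⁰`, for
    -- which the crude bound `τ ≤ 5 / 2` suffices.
    have h5 : (τ + 1 / 2 ^ 100) * (1 / 27 * (1 - abortErr)) ≤ (τ + 1 / 2 ^ 100) * a :=
      mul_le_mul_of_nonneg_left h1 (by positivity)
    have hA0 : 0 ≤ abortErr := by rw [abortErr]; positivity
    have h6 : (τ + 1 / 2 ^ 100) * abortErr ≤ (5 / 2 + 1 / 2 ^ 100) * (4 * (1 / 2 ^ 103 * (3 / 5))) :=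
      mul_le_mul (by linarith) hA hA0 (by positivity)
    rw [hc]
    norm_num at h6 h5 ⊢
    linarith

end Honest

/-! ### Every program runs in polynomial time -/

theorem Params.one_le_size (P : Params) : 1 ≤ P.size :=
  le_trans (Nat.succ_le_of_lt P.d_pos) (Nat.le_add_left _ _)

theorem poly_mono (P : Params) {a b : ℕ} (h : a ≤ b) : a * P.size ^ a ≤ b * P.size ^ b :=
  Nat.mul_le_mul h (Nat.pow_le_pow_right P.one_le_size h)

theorem poly_add (P : Params) (a b : ℕ) :
    a * P.size ^ a + b * P.size ^ b ≤ (a + b) * P.size ^ (a + b) := by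
  rw [add_mul]
  exact Nat.add_le_add
    (Nat.mul_le_mul_left _ (Nat.pow_le_pow_right P.one_le_size (Nat.le_add_right _ _)))
    (Nat.mul_le_mul_left _ (Nat.pow_le_pow_right P.one_le_size (Nat.le_add_left _ _)))

theorem poly_mul (P : Params) (a b : ℕ) :
    (a * P.size ^ a) * (b * P.size ^ b) ≤ (a * b + (a + b)) * P.size ^ (a * b + (a + b)) := by
  calc _ = a * b * P.size ^ (a + b) := by rw [pow_add]; ring
    _ ≤ _ := Nat.mul_le_mul (Nat.le_add_right _ _)
      (Nat.pow_le_pow_right P.one_le_size (Nat.le_add_left _ _))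

theorem le_poly (P : Params) (k : ℕ) : k ≤ k * P.size ^ k :=
  Nat.le_mul_of_pos_right _ (Nat.pow_pos P.one_le_size)

theorem size_le_poly (P : Params) : P.size ≤ 1 * P.size ^ 1 := by simp

theorem Idx.val_poly (E : ℕ) (a : Idx) : ∃ C : ℕ, ∀ (P : Params) (env : ℕ → ℕ),
    (∀ x, env x ≤ E * P.size ^ E) → a.val P env ≤ C * P.size ^ C := by
  induction a with
  | lit k => exact ⟨k, fun P _ _ => le_poly P k⟩
  | kap => exact ⟨1, fun P _ _ => le_trans (by simp only [Idx.val, Params.size]; omega)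
      (size_le_poly P)⟩
  | lam => exact ⟨1, fun P _ _ => le_trans (by simp only [Idx.val, Params.size]; omega)
      (size_le_poly P)⟩
  | deg => exact ⟨1, fun P _ _ => le_trans (by simp only [Idx.val, Params.size]; omega)
      (size_le_poly P)⟩
  | blocks => exact ⟨256, fun P _ _ => (Nat.div_le_self _ _).trans (le_poly P 256)⟩
  | var x => exact ⟨E, fun P env h => h x⟩
  | add a b iha ihb =>
    obtain ⟨A, hA⟩ := iha
    obtain ⟨B, hB⟩ := ihb
    exact ⟨A + B, fun P env h => (Nat.add_le_add (hA P env h) (hB P env h)).trans (poly_add P A B)⟩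
  | mul a b iha ihb =>
    obtain ⟨A, hA⟩ := iha
    obtain ⟨B, hB⟩ := ihb
    exact ⟨A * B + (A + B), fun P env h =>
      (Nat.mul_le_mul (hA P env h) (hB P env h)).trans (poly_mul P A B)⟩

/-- Since the size is at least `1`, bounds of the form `C * size ^ C` are closed under sums and
products. The induction carries such a bound on all loop counters, because inner loop bounds may
depend on outer counters. -/
theorem Prog.steps_poly (p : Prog) : ∀ E : ℕ, ∃ C : ℕ, ∀ (P : Params) (env : ℕ → ℕ),
    (∀ x, env x ≤ E * P.size ^ E) → p.steps P env ≤ C * P.size ^ C := by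
  induction p with
  | seq p r ihp ihr =>
    intro E
    obtain ⟨A, hA⟩ := ihp E
    obtain ⟨B, hB⟩ := ihr E
    exact ⟨A + B, fun P env h => (Nat.add_le_add (hA P env h) (hB P env h)).trans (poly_add P A B)⟩
  | ifz a p r ihp ihr =>
    intro E
    obtain ⟨A, hA⟩ := ihp E
    obtain ⟨B, hB⟩ := ihr E
    refine ⟨1 + (A + B), fun P env h => ?_⟩
    refine (Nat.add_le_add (le_poly P 1) ((max_le ?_ ?_).trans (poly_add P A B))).trans
      (poly_add P 1 (A + B))
    · exact (hA P env h).trans (Nat.le_add_right _ _)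
    · exact (hB P env h).trans (Nat.le_add_left _ _)
  | loop x b p ih =>
    intro E
    obtain ⟨B, hB⟩ := b.val_poly E
    -- Inside the loop a counter is either an old one, bounded through `E`, or the new one, bounded
    -- by the loop bound through `B`.
    obtain ⟨A, hA⟩ := ih (E + B)
    refine ⟨1 + (B * (1 + A) + (B + (1 + A))), fun P env h => ?_⟩
    refine (Nat.add_le_add (le_poly P 1) ?_).trans (poly_add P 1 _)
    have h1 : ∀ i ∈ Finset.range (b.val P env), 1 + p.steps P (Function.update env x i)
        ≤ (1 + A) * P.size ^ (1 + A) := by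
      intro i hi
      refine (Nat.add_le_add (le_poly P 1) (hA P _ fun y => ?_)).trans (poly_add P 1 A)
      by_cases hy : y = x
      · rw [hy, Function.update_self]
        exact (Finset.mem_range.1 hi).le.trans ((hB P env h).trans
          (poly_mono P (Nat.le_add_left _ _)))
      · rw [Function.update_of_ne hy]
        exact (h y).trans (poly_mono P (Nat.le_add_right _ _))
    refine (Finset.sum_le_card_nsmul _ _ _ h1).trans ?_
    rw [Finset.card_range, smul_eq_mul]
    exact (Nat.mul_le_mul_right _ (hB P env h)).trans (poly_mul P B (1 + A))
  | _ => exact fun E => ⟨1, fun P env _ => (by simp [Prog.steps] : _ ≤ 1).trans (le_poly P 1)⟩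

theorem Prog.exists_polyTime (p : Prog) : ∃ C, p.PolyTime C := by
  obtain ⟨C, hC⟩ := p.steps_poly 0
  exact ⟨C, fun P => hC P 0 fun x => by simp⟩

theorem Prog.PolyTime.mono {p : Prog} {C C' : ℕ} (h : p.PolyTime C) (hC : C ≤ C') :
    p.PolyTime C' := fun P => (h P).trans (poly_mono P hC)

/-! ### Loops over finite index types -/

/-- The sizes that occur in the index types of the protocol. -/
inductive Dim : Type
  | two
  | kap
  | n
  | nb
  | deg

namespace Dim

/-- The value of a size. -/
def val (P : Params) : Dim → ℕ
  | two => 2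
  | kap => P.kap
  | n => P.n
  | nb => P.nb
  | deg => P.d

/-- The loop bound that expresses a size. -/
def idx : Dim → Idx
  | two => Idx.lit 2
  | kap => Idx.kap
  | n => Idx.add (Idx.add Idx.kap Idx.lam) (Idx.lit 3)
  | nb => Idx.blocks
  | deg => Idx.deg

theorem val_idx (P : Params) (env : ℕ → ℕ) (b : Dim) : b.idx.val P env = b.val P := by
  cases b <;> rfl

end Dim

/-- Shapes of index types. -/
inductive Sh : Type
  | unit
  | fin (b : Dim)
  | prod (s t : Sh)
  | sum (s t : Sh)

namespace Sh

/-- The index type of a shape. -/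
@[reducible] def T (P : Params) : Sh → Type
  | unit => Unit
  | fin b => Fin (b.val P)
  | prod s t => s.T P × t.T P
  | sum s t => s.T P ⊕ t.T P

instance fintypeT (P : Params) : (s : Sh) → Fintype (s.T P)
  | unit => inferInstanceAs (Fintype Unit)
  | fin b => inferInstanceAs (Fintype (Fin (b.val P)))
  | prod s t => @instFintypeProd _ _ (fintypeT P s) (fintypeT P t)
  | sum s t => @instFintypeSum _ _ (fintypeT P s) (fintypeT P t)

instance addrT (P : Params) : (s : Sh) → Addr (s.T P)
  | unit => inferInstanceAs (Addr Unit)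
  | fin b => inferInstanceAs (Addr (Fin (b.val P)))
  | prod s t => @instAddrProd _ _ (addrT P s) (addrT P t)
  | sum s t => @instAddrSum _ _ (addrT P s) (addrT P t)

/-- Symbolic indices. -/
@[reducible] def V : Sh → Type
  | unit => Unit
  | fin _ => Idx
  | prod s t => s.V × t.V
  | sum s t => s.V ⊕ t.V

/-- The list of index expressions that addresses the cell of a symbolic index. -/
def loc : (s : Sh) → s.V → List Idx
  | unit, _ => []
  | fin _, v => [v]
  | prod s t, v => s.loc v.1 ++ t.loc v.2
  | sum s _, Sum.inl v => Idx.lit 0 :: s.loc v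
  | sum _ t, Sum.inr v => Idx.lit 1 :: t.loc v

/-- The symbolic index `v` has the value `i`. -/
def Rel (P : Params) (env : ℕ → ℕ) : (s : Sh) → s.V → s.T P → Prop
  | unit, _, _ => True
  | fin b, v, i => v.val P env = (show Fin (b.val P) from i).val
  | prod s t, v, i => s.Rel P env v.1 i.1 ∧ t.Rel P env v.2 i.2
  | sum s _, Sum.inl v, Sum.inl i => s.Rel P env v i
  | sum _ t, Sum.inr v, Sum.inr i => t.Rel P env v i
  | sum _ _, Sum.inl _, Sum.inr _ => False
  | sum _ _, Sum.inr _, Sum.inl _ => False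

/-- The number of nested loops. -/
def depth : Sh → ℕ
  | unit => 0
  | fin _ => 1
  | prod s t => s.depth + t.depth
  | sum s t => max s.depth t.depth

/-- Running a program for all indices of a shape, with loop counters from `x` on. -/
def loop : (s : Sh) → ℕ → (s.V → Prog) → Prog
  | unit, _, body => body ()
  | fin b, x, body => Prog.loop x b.idx (body (Idx.var x))
  | prod s t, x, body => s.loop x fun v => t.loop (x + s.depth) fun w => body (v, w)
  | sum s t, x, body => Prog.seq (s.loop x fun v => body (Sum.inl v))
      (t.loop x fun v => body (Sum.inr v))

/-- All indices, in the order of the loops. -/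
def elems (P : Params) : (s : Sh) → List (s.T P)
  | unit => [()]
  | fin b => List.finRange (b.val P)
  | prod s t => (s.elems P).flatMap fun i => (t.elems P).map fun j => (i, j)
  | sum s t => (s.elems P).map Sum.inl ++ (t.elems P).map Sum.inr

/-- The loop counters and symbolic indices of all iterations. -/
def visits (P : Params) : (s : Sh) → ℕ → (ℕ → ℕ) → List ((ℕ → ℕ) × s.V)
  | unit, _, env => [(env, ())]
  | fin b, x, env => (List.finRange (b.val P)).map fun i : Fin (b.val P) =>
      (Function.update env x (i : ℕ), Idx.var x)
  | prod s t, x, env => (s.visits P x env).flatMap fun p =>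
      (t.visits P (x + s.depth) p.1).map fun r => (r.1, (p.2, r.2))
  | sum s t, x, env => ((s.visits P x env).map fun p => (p.1, Sum.inl p.2))
      ++ (t.visits P x env).map fun p => (p.1, Sum.inr p.2)

theorem map_loc {P : Params} {env : ℕ → ℕ} : ∀ {s : Sh} {v : s.V} {i : s.T P}, s.Rel P env v i →
    (s.loc v).map (Idx.val P env) = Addr.addr i
  | unit, _, _, _ => rfl
  | fin b, v, i, h => by
    change [v.val P env] = _
    rw [show v.val P env = _ from h]
    rfl
  | prod s t, v, i, h => by
    change (s.loc v.1 ++ t.loc v.2).map _ = Addr.addr i.1 ++ Addr.addr i.2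
    rw [List.map_append, map_loc h.1, map_loc h.2]
  | sum s t, Sum.inl v, Sum.inl i, h => by
    change (Idx.lit 0 :: s.loc v).map _ = 0 :: Addr.addr i
    rw [List.map_cons, map_loc (show s.Rel P env v i from h)]
    rfl
  | sum s t, Sum.inr v, Sum.inr i, h => by
    change (Idx.lit 1 :: t.loc v).map _ = 1 :: Addr.addr i
    rw [List.map_cons, map_loc (show t.Rel P env v i from h)]
    rfl
  | sum _ _, Sum.inl _, Sum.inr _, h => h.elim
  | sum _ _, Sum.inr _, Sum.inl _, h => h.elim

/-- Addresses of pairs are concatenated, so injectivity alone would not pass through the induction;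
the addresses of one shape have to form a prefix code. -/
theorem addr_prefix {P : Params} : ∀ (s : Sh) (i j : s.T P) (l l' : List ℕ),
    Addr.addr i ++ l = Addr.addr j ++ l' → i = j ∧ l = l'
  | unit, _, _, _, _, h => ⟨rfl, h⟩
  | fin b, i, j, l, l', h => by
    have h1 : (i : ℕ) :: l = (j : ℕ) :: l' := h
    rw [List.cons.injEq] at h1
    exact ⟨Fin.ext h1.1, h1.2⟩
  | prod s t, i, j, l, l', h => by
    have h1 : (Addr.addr i.1 ++ Addr.addr i.2) ++ l = (Addr.addr j.1 ++ Addr.addr j.2) ++ l' := h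
    rw [List.append_assoc, List.append_assoc] at h1
    obtain ⟨h2, h3⟩ := addr_prefix s _ _ _ _ h1
    obtain ⟨h4, h5⟩ := addr_prefix t _ _ _ _ h3
    exact ⟨Prod.ext h2 h4, h5⟩
  | sum s t, Sum.inl i, Sum.inl j, l, l', h => by
    have h1 : 0 :: (Addr.addr i ++ l) = 0 :: (Addr.addr j ++ l') := h
    obtain ⟨h2, h3⟩ := addr_prefix s _ _ _ _ (List.cons.inj h1).2
    exact ⟨congrArg _ h2, h3⟩
  | sum s t, Sum.inr i, Sum.inr j, l, l', h => by
    have h1 : 1 :: (Addr.addr i ++ l) = 1 :: (Addr.addr j ++ l') := h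
    obtain ⟨h2, h3⟩ := addr_prefix t _ _ _ _ (List.cons.inj h1).2
    exact ⟨congrArg _ h2, h3⟩
  | sum s t, Sum.inl i, Sum.inr j, l, l', h => by
    have h1 : 0 :: (Addr.addr i ++ l) = 1 :: (Addr.addr j ++ l') := h
    exact absurd (List.cons.inj h1).1 zero_ne_one
  | sum s t, Sum.inr i, Sum.inl j, l, l', h => by
    have h1 : 1 :: (Addr.addr i ++ l) = 0 :: (Addr.addr j ++ l') := h
    exact absurd (List.cons.inj h1).1 one_ne_zero

theorem addr_injective {P : Params} (s : Sh) :
    Function.Injective (Addr.addr : s.T P → List ℕ) := fun i j h =>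
  (addr_prefix s i j [] [] (by rw [h])).1

theorem nodup_elems (P : Params) : ∀ s : Sh, (s.elems P).Nodup
  | unit => List.nodup_singleton _
  | fin b => List.nodup_finRange _
  | prod s t => by
    have h := (nodup_elems P s).product (nodup_elems P t)
    exact h
  | sum s t => by
    refine List.Nodup.append ((nodup_elems P s).map Sum.inl_injective)
      ((nodup_elems P t).map Sum.inr_injective) fun x h1 h2 => ?_
    obtain ⟨i, -, rfl⟩ := List.mem_map.1 h1
    obtain ⟨j, -, h⟩ := List.mem_map.1 h2
    exact absurd h (by simp)

theorem mem_elems (P : Params) : ∀ (s : Sh) (i : s.T P), i ∈ s.elems P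
  | unit, _ => List.mem_singleton.2 rfl
  | fin _, i => List.mem_finRange i
  | prod s t, i => List.mem_flatMap.2 ⟨i.1, mem_elems P s i.1,
      List.mem_map.2 ⟨i.2, mem_elems P t i.2, rfl⟩⟩
  | sum s _, Sum.inl i => List.mem_append_left _ (List.mem_map_of_mem (mem_elems P s i))
  | sum _ t, Sum.inr i => List.mem_append_right _ (List.mem_map_of_mem (mem_elems P t i))

theorem sum_elems {P : Params} (s : Sh) {M : Type} [AddCommMonoid M] (f : s.T P → M) :
    ((s.elems P).map f).sum = ∑ i, f i := by
  classical
  rw [← List.sum_toFinset f (nodup_elems P s)]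
  refine Finset.sum_congr ?_ fun _ _ => rfl
  ext i
  simp [mem_elems P s i]

/-- A symbolic index that keeps its value when loop counters from `x` on change. -/
def Stable (P : Params) (s : Sh) (x : ℕ) (env : ℕ → ℕ) (v : s.V) (i : s.T P) : Prop :=
  ∀ env' : ℕ → ℕ, (∀ y < x, env' y = env y) → s.Rel P env' v i

theorem Stable.rel {P : Params} {s : Sh} {x : ℕ} {env : ℕ → ℕ} {v : s.V} {i : s.T P}
    (h : s.Stable P x env v i) : s.Rel P env v i := h env fun _ _ => rfl

theorem Stable.trans {P : Params} {s : Sh} {x : ℕ} {env env' : ℕ → ℕ} {v : s.V} {i : s.T P}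
    (h : s.Stable P x env v i) (he : ∀ y < x, env' y = env y) : s.Rel P env' v i := h env' he

/-- Each iteration is matched with the index it stands for. The matching remains valid when counters
beyond the depth change, so further loops can be nested inside without disturbing the outer indices.
-/
theorem forall₂_visits (P : Params) : ∀ (s : Sh) (x : ℕ) (env : ℕ → ℕ),
    List.Forall₂ (fun p i => (∀ y < x, p.1 y = env y) ∧ s.Stable P (x + s.depth) p.1 p.2 i)
      (s.visits P x env) (s.elems P)
  | unit, x, env => List.Forall₂.cons ⟨fun _ _ => rfl, fun _ _ => trivial⟩ List.Forall₂.nil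
  | fin b, x, env => by
    change List.Forall₂ _ (List.map _ _) (List.finRange (b.val P))
    rw [List.forall₂_map_left_iff, List.forall₂_same]
    refine fun i _ => ⟨fun y hy => Function.update_of_ne hy.ne _ _, fun env' h => ?_⟩
    have h1 := h x (by simp [depth])
    exact h1.trans (Function.update_self _ _ _)
  | prod s t, x, env => by
    refine List.rel_flatMap (forall₂_visits P s x env) fun p i h1 => ?_
    rw [List.forall₂_map_left_iff, List.forall₂_map_right_iff]
    refine (forall₂_visits P t (x + s.depth) p.1).imp fun r j h2 => ?_
    refine ⟨fun y hy => (h2.1 y (by omega)).trans (h1.1 y hy), fun env' h => ⟨?_, ?_⟩⟩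
    · refine h1.2 env' fun y hy => ?_
      rw [h y (by simp only [depth]; omega), h2.1 y hy]
    · refine h2.2 env' fun y hy => ?_
      rw [h y (by simp only [depth]; omega)]
  | sum s t, x, env => by
    refine List.rel_append ?_ ?_
    · rw [List.forall₂_map_left_iff, List.forall₂_map_right_iff]
      refine (forall₂_visits P s x env).imp fun r j h2 => ⟨h2.1, fun env' h => ?_⟩
      exact h2.2 env' fun y hy => h y (hy.trans_le (by simp [depth]))
    · rw [List.forall₂_map_left_iff, List.forall₂_map_right_iff]
      refine (forall₂_visits P t x env).imp fun r j h2 => ⟨h2.1, fun env' h => ?_⟩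
      exact h2.2 env' fun y hy => h y (hy.trans_le (by simp [depth]))

end Sh

section Run

variable {P : Params} (D : Dists P) (o : Option (Prover P))

theorem foldlM_flatMap {α β γ : Type} (g : γ → β → PMF γ) (f : α → List β) :
    ∀ (l : List α) (c : γ), (l.flatMap f).foldlM g c = l.foldlM (fun c a => (f a).foldlM g c) c
  | [], c => rfl
  | a :: l, c => by
    rw [List.flatMap_cons, List.foldlM_append, List.foldlM_cons]
    congr 1
    funext c'
    exact foldlM_flatMap g f l c'

/-- Nested loops are flattened into one fold over a list of iterations, so that later inductions run
over lists rather than over shapes. -/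
theorem Sh.loop_run : ∀ (s : Sh) (x : ℕ) (body : s.V → Prog) (env : ℕ → ℕ) (mem : Mem P),
    (s.loop x body).run D o env mem
      = (s.visits P x env).foldlM (fun mem p => (body p.2).run D o p.1 mem) mem
  | unit, x, body, env, mem => by
    change _ = List.foldlM _ _ [(env, ())]
    rw [List.foldlM_cons]
    exact (bind_pure _).symm
  | fin b, x, body, env, mem => by
    change List.foldlM _ _ (List.range (b.idx.val P env)) = List.foldlM _ _ (List.map _ _)
    rw [Dim.val_idx, List.foldlM_map, ← List.map_coe_finRange_eq_range, List.foldlM_map]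
  | prod s t, x, body, env, mem => by
    change (s.loop x _).run D o env mem = List.foldlM _ _ (List.flatMap _ _)
    rw [Sh.loop_run s, foldlM_flatMap]
    congr 1
    funext mem' p
    rw [Sh.loop_run t, List.foldlM_map]
  | sum s t, x, body, env, mem => by
    change ((s.loop x _).run D o env mem).bind _ = List.foldlM _ _ (_ ++ _)
    rw [Sh.loop_run s, List.foldlM_append, List.foldlM_map]
    change PMF.bind _ _ = PMF.bind _ _
    congr 1
    funext mem'
    rw [Sh.loop_run t, List.foldlM_map]

end Run

/-! ### Sampling arrays -/

section Sample

variable {P : Params} (D : Dists P) (o : Option (Prover P))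

/-- Overwriting the cell with a given address. -/
def wrAt (a : ℕ) (mem : Mem P) (l : List ℕ) (v : Rq P) : Mem P :=
  Function.update mem a (Function.update (mem a) l v)

/-- Overwriting the part of an array that is addressed by an index type. -/
def overlay {ι : Type} [Addr ι] (a : ℕ) (mem : Mem P) (v : ι → Rq P) : Mem P :=
  Function.update mem a (Function.extend Addr.addr v (mem a))

theorem overlay_of_ne {ι : Type} [Addr ι] {a b : ℕ} (h : b ≠ a) (mem : Mem P) (v : ι → Rq P) :
    overlay a mem v b = mem b := Function.update_of_ne h _ _

theorem load_overlay (s : Sh) (a : ℕ) (mem : Mem P) (v : s.T P → Rq P) :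
    load (s.T P) (overlay a mem v a) = v := by
  funext i
  rw [load, overlay, Function.update_self, (Sh.addr_injective s).extend_apply]

theorem load_store (s : Sh) (v : s.T P → Rq P) : load (s.T P) (store v) = v := by
  funext i
  rw [load, store, (Sh.addr_injective s).extend_apply]

/-- The effect of a list of assignments to distinct cells. -/
theorem foldl_wrAt (s : Sh) (a : ℕ) (v : s.T P → Rq P) : ∀ (L : List (s.T P)) (mem : Mem P), L.Nodup →
    (∀ b ≠ a, L.foldl (fun mem i => wrAt a mem (Addr.addr i) (v i)) mem b = mem b) ∧
    (∀ i ∈ L, L.foldl (fun mem i => wrAt a mem (Addr.addr i) (v i)) mem a (Addr.addr i) = v i) ∧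
    (∀ l, (∀ i ∈ L, Addr.addr i ≠ l) →
      L.foldl (fun mem i => wrAt a mem (Addr.addr i) (v i)) mem a l = mem a l)
  | [], mem, _ => ⟨fun _ _ => rfl, fun i hi => absurd hi List.not_mem_nil, fun _ _ => rfl⟩
  | i :: L, mem, hL => by
    obtain ⟨hi, hL'⟩ := List.nodup_cons.1 hL
    obtain ⟨h1, h2, h3⟩ := foldl_wrAt s a v L (wrAt a mem (Addr.addr i) (v i)) hL'
    simp only [List.foldl_cons]
    refine ⟨fun b hb => (h1 b hb).trans (Function.update_of_ne hb _ _), fun j hj => ?_,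
      fun l hl => ?_⟩
    · rcases List.mem_cons.1 hj with rfl | hj
      · rw [h3 _ fun k hk he => hi (by rwa [Sh.addr_injective s he] at hk), wrAt, Function.update_self,
          Function.update_self]
      · exact h2 j hj
    · rw [h3 l fun k hk => hl k (List.mem_cons_of_mem _ hk), wrAt, Function.update_self,
        Function.update_of_ne (hl i List.mem_cons_self).symm]

theorem foldl_elems (s : Sh) (a : ℕ) (v : s.T P → Rq P) (mem : Mem P) :
    (s.elems P).foldl (fun mem i => wrAt a mem (Addr.addr i) (v i)) mem = overlay a mem v := by
  obtain ⟨h1, h2, h3⟩ := foldl_wrAt s a v (s.elems P) mem (Sh.nodup_elems P s)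
  funext b
  by_cases hb : b = a
  · subst hb
    funext l
    rw [overlay, Function.update_self]
    by_cases hl : ∃ i : s.T P, Addr.addr i = l
    · obtain ⟨i, rfl⟩ := hl
      rw [(Sh.addr_injective s).extend_apply, h2 i (Sh.mem_elems P s i)]
    · rw [Function.extend_apply' _ _ _ hl, h3 l fun i _ hi => hl ⟨i, hi⟩]
  · rw [h1 b hb, overlay_of_ne hb]

/-- The visited addresses are distinct, so every sample hits a fresh cell and nothing is
overwritten; each newly drawn entry is identified with a coordinate of the product law by resampling
that coordinate. -/
theorem ex_foldlM_wrAt (s : Sh) (a : ℕ) (μ : PMF (Rq P)) (F : Mem P → ℝ≥0∞) :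
    ∀ (L : List (s.T P)) (mem : Mem P), L.Nodup →
    ex (L.foldlM (fun mem i => μ.map (wrAt a mem (Addr.addr i))) mem) F
      = ex (iid μ (s.T P)) fun v =>
          F (L.foldl (fun mem i => wrAt a mem (Addr.addr i) (v i)) mem)
  | [], mem, _ => by
    rw [List.foldlM_nil, ex_pure]
    exact (ex_const _ _).symm
  | i :: L, mem, hL => by
    classical
    obtain ⟨hi, hL'⟩ := List.nodup_cons.1 hL
    rw [List.foldlM_cons, ex_bind, ex_map, ← ex_iid_update μ i]
    refine ex_congr fun x => ?_
    rw [ex_foldlM_wrAt s a μ F L _ hL']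
    refine ex_congr fun v => ?_
    rw [List.foldl_cons, Function.update_self]
    congr 1
    refine List.foldl_ext _ _ _ fun mem' j hj => ?_
    rw [Function.update_of_ne fun h : j = i => hi (h ▸ hj)]

/-- Sampling all cells of an array. -/
def sampleArr (s : Sh) (a : ℕ) (smp : Loc → Prog) : Prog := s.loop 0 fun v => smp (a, s.loc v)

theorem foldlM_congr_forall₂ {α β γ : Type} {R : α → β → Prop} {f : γ → α → PMF γ}
    {g : γ → β → PMF γ} (h : ∀ a b c, R a b → f c a = g c b) {l : List α} {l' : List β}
    (hl : List.Forall₂ R l l') : ∀ c, l.foldlM f c = l'.foldlM g c := by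
  induction hl with
  | nil => exact fun _ => rfl
  | cons hab _ ih =>
    intro c
    rw [List.foldlM_cons, List.foldlM_cons, h _ _ _ hab]
    congr 1
    funext c'
    exact ih c'

/-- Sampling an array gives independent entries. -/
theorem ex_sampleArr (s : Sh) (a : ℕ) {smp : Loc → Prog} {μ : PMF (Rq P)}
    (h : ∀ l env mem, (smp l).run D o env mem = μ.map (wr env mem l)) (env : ℕ → ℕ) (mem : Mem P)
    (F : Mem P → ℝ≥0∞) :
    ex ((sampleArr s a smp).run D o env mem) F
      = ex (iid μ (s.T P)) fun v => F (overlay a mem v) := by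
  rw [sampleArr, Sh.loop_run, foldlM_congr_forall₂ (g := fun mem i =>
    μ.map (wrAt a mem (Addr.addr i))) ?_ (Sh.forall₂_visits P s 0 env) mem,
    ex_foldlM_wrAt s a μ F _ _ (Sh.nodup_elems P s)]
  · simp_rw [foldl_elems]
  · intro p i mem' hp
    rw [h]
    congr 1
    funext x
    simp only [wr, wrAt, Sh.map_loc hp.2.rel]

theorem ex_seq (p r : Prog) (env : ℕ → ℕ) (mem : Mem P) (F : Mem P → ℝ≥0∞) :
    ex ((Prog.seq p r).run D o env mem) F
      = ex (p.run D o env mem) fun mem' => ex (r.run D o env mem') F := ex_bind _ _ _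

end Sample

/-! ### Expressions -/

/-- Ring expressions over the cells of arrays, with sums over loop counters. -/
inductive Exp : Type
  | cell (a : ℕ) (l : List Idx)
  | one
  | mon (i : Idx)
  | add (a b : Exp)
  | mul (a b : Exp)
  | neg (a : Exp)
  | inv (a : Exp)
  | conj (a : Exp)
  | cst (a : Exp)
  | sum (x : ℕ) (b : Dim) (e : Exp)

namespace Exp

/-- The value of an expression. -/
def eval {P : Params} (mem : Mem P) : Exp → (ℕ → ℕ) → Rq P
  | cell a l, env => mem a (l.map (Idx.val P env))
  | one, _ => 1
  | mon i, env => xx P ^ i.val P env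
  | add a b, env => a.eval mem env + b.eval mem env
  | mul a b, env => a.eval mem env * b.eval mem env
  | neg a, env => -a.eval mem env
  | inv a, env => Ring.inverse (a.eval mem env)
  | conj a, env => KeyWF.conj P (a.eval mem env)
  | cst a, env => algebraMap (ZMod P.q) (Rq P) (KeyWF.cst (a.eval mem env))
  | sum x b e, env =>
    ((List.finRange (b.val P)).map fun i : Fin (b.val P) =>
      e.eval mem (Function.update env x (i : ℕ))).sum

/-- The arrays below `100` other than `d` are the only ones that are read. -/
def Reads (d : ℕ) : Exp → Prop
  | cell a _ => a < 100 ∧ a ≠ d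
  | add a b => a.Reads d ∧ b.Reads d
  | mul a b => a.Reads d ∧ b.Reads d
  | neg a => a.Reads d
  | inv a => a.Reads d
  | conj a => a.Reads d
  | cst a => a.Reads d
  | sum _ _ e => e.Reads d
  | _ => True

theorem eval_congr {P : Params} {mem mem' : Mem P} {d : ℕ}
    (h : ∀ a < 100, a ≠ d → mem a = mem' a) :
    ∀ (e : Exp), e.Reads d → ∀ env, e.eval mem env = e.eval mem' env
  | cell a l, he, env => by rw [eval, eval, h a he.1 he.2]
  | one, _, _ => rfl
  | mon _, _, _ => rfl
  | add a b, he, env => by rw [eval, eval, eval_congr h a he.1, eval_congr h b he.2]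
  | mul a b, he, env => by rw [eval, eval, eval_congr h a he.1, eval_congr h b he.2]
  | neg a, he, env => by rw [eval, eval, eval_congr h a he]
  | inv a, he, env => by rw [eval, eval, eval_congr h a he]
  | conj a, he, env => by rw [eval, eval, eval_congr h a he]
  | cst a, he, env => by rw [eval, eval, eval_congr h a he]
  | sum x b e, he, env => by simp only [eval, eval_congr h e he]

/-- The scratch cell number `t`. -/
def tmp (t : ℕ) : Loc := (100 + t, [])

/-- Sets a scratch cell to zero. -/
def zeroTmp (t : ℕ) : Prog :=
  Prog.seq (Prog.one (tmp t)) (Prog.seq (Prog.neg (tmp (t + 1)) (tmp t))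
    (Prog.add (tmp t) (tmp t) (tmp (t + 1))))

/-- A program that computes an expression in the scratch cell `t`. -/
def compile : Exp → ℕ → Prog
  | cell a l, t => Prog.set (tmp t) (a, l)
  | one, t => Prog.one (tmp t)
  | mon i, t => Prog.seq (Prog.one (tmp t)) (Prog.seq (Prog.gen (tmp (t + 1)))
      (Prog.loop 0 i (Prog.mul (tmp t) (tmp t) (tmp (t + 1)))))
  | add a b, t => Prog.seq (a.compile t) (Prog.seq (b.compile (t + 1))
      (Prog.add (tmp t) (tmp t) (tmp (t + 1))))
  | mul a b, t => Prog.seq (a.compile t) (Prog.seq (b.compile (t + 1))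
      (Prog.mul (tmp t) (tmp t) (tmp (t + 1))))
  | neg a, t => Prog.seq (a.compile t) (Prog.neg (tmp t) (tmp t))
  | inv a, t => Prog.seq (a.compile t) (Prog.inv (tmp t) (tmp t))
  | conj a, t => Prog.seq (a.compile t) (Prog.conj (tmp t) (tmp t))
  | cst a, t => Prog.seq (a.compile t) (Prog.cst (tmp t) (tmp t))
  | sum x b e, t => Prog.seq (zeroTmp t) (Prog.loop x b.idx
      (Prog.seq (e.compile (t + 1)) (Prog.add (tmp t) (tmp t) (tmp (t + 1)))))

end Exp

section Compile

variable {P : Params} (D : Dists P) (o : Option (Prover P))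

theorem rd_tmp (env : ℕ → ℕ) (mem : Mem P) (t : ℕ) : rd env mem (Exp.tmp t) = mem (100 + t) [] := rfl

theorem wr_tmp_self (env : ℕ → ℕ) (mem : Mem P) (t : ℕ) (v : Rq P) :
    wr env mem (Exp.tmp t) v (100 + t) [] = v := by
  simp [wr, Exp.tmp]

theorem wr_tmp_of_ne (env : ℕ → ℕ) (mem : Mem P) {t a : ℕ} (v : Rq P) (h : a ≠ 100 + t) :
    wr env mem (Exp.tmp t) v a = mem a := Function.update_of_ne h _ _

theorem run_seq_pure {p r : Prog} {env : ℕ → ℕ} {mem mem' : Mem P}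
    (h : p.run D o env mem = pure mem') :
    (Prog.seq p r).run D o env mem = r.run D o env mem' := by
  change (p.run D o env mem).bind _ = _
  rw [h]
  exact PMF.pure_bind _ _

theorem zeroTmp_run (t : ℕ) (env : ℕ → ℕ) (mem : Mem P) :
    ∃ mem', (Exp.zeroTmp t).run D o env mem = pure mem' ∧ mem' (100 + t) [] = 0 ∧
      ∀ a < 100 + t, mem' a = mem a := by
  refine ⟨_, (run_seq_pure D o rfl).trans (run_seq_pure D o rfl), ?_, fun a ha => ?_⟩
  · rw [wr_tmp_self, rd_tmp, rd_tmp, wr_tmp_of_ne _ _ _ (by omega), wr_tmp_self, rd_tmp,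
      wr_tmp_self, add_neg_cancel]
  · rw [wr_tmp_of_ne _ _ _ (by omega), wr_tmp_of_ne _ _ _ (by omega), wr_tmp_of_ne _ _ _ (by omega)]

/-- A stack discipline: evaluation at level `t` changes no array below `100 + t`. The first operand
thus survives the evaluation of the second at level `t + 1`, and the input arrays below `100` are
untouched. -/
theorem Exp.compile_run (d : ℕ) : ∀ (e : Exp), e.Reads d → ∀ (t : ℕ) (env : ℕ → ℕ) (mem : Mem P),
    ∃ mem', (e.compile t).run D o env mem = pure mem' ∧ mem' (100 + t) [] = e.eval mem env ∧
      ∀ a < 100 + t, mem' a = mem a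
  | cell a l, _, t, env, mem => ⟨_, rfl, wr_tmp_self _ _ _ _, fun _ hb => wr_tmp_of_ne _ _ _ hb.ne⟩
  | one, _, t, env, mem => ⟨_, rfl, wr_tmp_self _ _ _ _, fun _ hb => wr_tmp_of_ne _ _ _ hb.ne⟩
  | mon i, _, t, env, mem => by
    -- The loop that forms a power uses counter `0` and may shadow an outer counter. This is
    -- harmless, since its body contains no index expression and its bound is evaluated beforehand.
    have key : ∀ (L : List ℕ) (mem : Mem P), mem (100 + (t + 1)) [] = xx P →
        ∃ mem', L.foldlM (fun mem' i => (Prog.mul (tmp t) (tmp t) (tmp (t + 1))).run D o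
          (Function.update env 0 i) mem') mem = pure mem' ∧
          mem' (100 + t) [] = mem (100 + t) [] * xx P ^ L.length ∧ ∀ a < 100 + t, mem' a = mem a := by
      intro L
      induction L with
      | nil => exact fun mem _ => ⟨mem, rfl, by simp, fun _ _ => rfl⟩
      | cons j L ih =>
        intro mem hm
        obtain ⟨mem', h1, h2, h3⟩ := ih (wr (Function.update env 0 j) mem (tmp t)
          (mem (100 + t) [] * mem (100 + (t + 1)) []))
            (by rw [wr_tmp_of_ne _ _ _ (by omega), hm])
        refine ⟨mem', ?_, ?_, fun a ha => ?_⟩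
        · rw [List.foldlM_cons]
          exact (PMF.pure_bind _ _).trans h1
        · rw [h2, wr_tmp_self, hm, List.length_cons, pow_succ', mul_assoc]
        · rw [h3 a ha, wr_tmp_of_ne _ _ _ ha.ne]
    obtain ⟨mem', h1, h2, h3⟩ := key (List.range (i.val P env))
      (wr env (wr env mem (tmp t) 1) (tmp (t + 1)) (xx P)) (wr_tmp_self _ _ _ _)
    refine ⟨mem', (run_seq_pure D o rfl).trans ((run_seq_pure D o rfl).trans h1), ?_, fun a ha => ?_⟩
    · rw [h2, wr_tmp_of_ne _ _ _ (by omega), wr_tmp_self, one_mul, List.length_range, eval]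
    · rw [h3 a ha, wr_tmp_of_ne _ _ _ (by omega), wr_tmp_of_ne _ _ _ (by omega)]
  | add a b, he, t, env, mem => by
    obtain ⟨m1, h1, h2, h3⟩ := a.compile_run d he.1 t env mem
    obtain ⟨m2, h4, h5, h6⟩ := b.compile_run d he.2 (t + 1) env m1
    refine ⟨_, (run_seq_pure D o h1).trans (run_seq_pure D o h4), ?_, fun c hc => ?_⟩
    · rw [wr_tmp_self, rd_tmp, rd_tmp, h5, h6 _ (by omega), h2,
        eval_congr (fun a ha _ => h3 a (by omega)) b he.2, eval]
    · rw [wr_tmp_of_ne _ _ _ hc.ne, h6 c (by omega), h3 c hc]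
  | mul a b, he, t, env, mem => by
    obtain ⟨m1, h1, h2, h3⟩ := a.compile_run d he.1 t env mem
    obtain ⟨m2, h4, h5, h6⟩ := b.compile_run d he.2 (t + 1) env m1
    refine ⟨_, (run_seq_pure D o h1).trans (run_seq_pure D o h4), ?_, fun c hc => ?_⟩
    · rw [wr_tmp_self, rd_tmp, rd_tmp, h5, h6 _ (by omega), h2,
        eval_congr (fun a ha _ => h3 a (by omega)) b he.2, eval]
    · rw [wr_tmp_of_ne _ _ _ hc.ne, h6 c (by omega), h3 c hc]
  | neg a, he, t, env, mem => by
    obtain ⟨m1, h1, h2, h3⟩ := a.compile_run d he t env mem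
    refine ⟨_, run_seq_pure D o h1, ?_, fun c hc => ?_⟩
    · rw [wr_tmp_self, rd_tmp, h2, eval]
    · rw [wr_tmp_of_ne _ _ _ hc.ne, h3 c hc]
  | inv a, he, t, env, mem => by
    obtain ⟨m1, h1, h2, h3⟩ := a.compile_run d he t env mem
    refine ⟨_, run_seq_pure D o h1, ?_, fun c hc => ?_⟩
    · rw [wr_tmp_self, rd_tmp, h2, eval]
    · rw [wr_tmp_of_ne _ _ _ hc.ne, h3 c hc]
  | conj a, he, t, env, mem => by
    obtain ⟨m1, h1, h2, h3⟩ := a.compile_run d he t env mem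
    refine ⟨_, run_seq_pure D o h1, ?_, fun c hc => ?_⟩
    · rw [wr_tmp_self, rd_tmp, h2, eval]
    · rw [wr_tmp_of_ne _ _ _ hc.ne, h3 c hc]
  | cst a, he, t, env, mem => by
    obtain ⟨m1, h1, h2, h3⟩ := a.compile_run d he t env mem
    refine ⟨_, run_seq_pure D o h1, ?_, fun c hc => ?_⟩
    · rw [wr_tmp_self, rd_tmp, h2, eval]
    · rw [wr_tmp_of_ne _ _ _ hc.ne, h3 c hc]
  | sum x b e, he, t, env, mem => by
    have key : ∀ (L : List (Fin (b.val P))) (mem1 : Mem P), (∀ a < 100 + t, mem1 a = mem a) →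
        ∃ mem', L.foldlM (fun mem' (i : Fin (b.val P)) => (Prog.seq (e.compile (t + 1))
          (Prog.add (tmp t) (tmp t) (tmp (t + 1)))).run D o
          (Function.update env x (i : ℕ)) mem') mem1 = pure mem' ∧
          mem' (100 + t) [] = mem1 (100 + t) [] + (L.map fun i : Fin (b.val P) =>
            e.eval mem (Function.update env x (i : ℕ))).sum ∧
          ∀ a < 100 + t, mem' a = mem a := by
      intro L
      induction L with
      | nil => exact fun mem1 h => ⟨mem1, rfl, by simp, h⟩
      | cons j L ih =>
        intro mem1 hm
        obtain ⟨m1, h1, h2, h3⟩ := e.compile_run d he (t + 1) (Function.update env x (j : ℕ)) mem1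
        obtain ⟨mem', h4, h5, h6⟩ := ih (wr (Function.update env x (j : ℕ)) m1 (tmp t)
          (m1 (100 + t) [] + m1 (100 + (t + 1)) [])) fun a ha => by
            rw [wr_tmp_of_ne _ _ _ ha.ne, h3 a (by omega), hm a ha]
        refine ⟨mem', ?_, ?_, h6⟩
        · rw [List.foldlM_cons, run_seq_pure D o h1]
          exact (PMF.pure_bind _ _).trans h4
        · rw [h5, wr_tmp_self, h3 _ (by omega), h2, List.map_cons, List.sum_cons, add_assoc,
            eval_congr (fun a ha _ => hm a (by omega)) e he]
    obtain ⟨m0, h1, h2, h3⟩ := zeroTmp_run D o t env mem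
    obtain ⟨mem', h4, h5, h6⟩ := key (List.finRange (b.val P)) m0 h3
    refine ⟨mem', (run_seq_pure D o h1).trans ?_, ?_, h6⟩
    · change List.foldlM _ _ (List.range (b.idx.val P env)) = _
      rw [Dim.val_idx, ← List.map_coe_finRange_eq_range, List.foldlM_map]
      exact h4
    · rw [h5, h2, zero_add, eval]

/-- The sum of an expression over a shape, with loop counters from `x` on. -/
def Sh.sumE : (s : Sh) → ℕ → (s.V → Exp) → Exp
  | unit, _, e => e ()
  | fin b, x, e => Exp.sum x b (e (Idx.var x))
  | prod s t, x, e => s.sumE x fun v => t.sumE (x + s.depth) fun w => e (v, w)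
  | sum s t, x, e => Exp.add (s.sumE x fun v => e (Sum.inl v)) (t.sumE x fun v => e (Sum.inr v))

theorem Sh.eval_sumE_visits (mem : Mem P) : ∀ (s : Sh) (x : ℕ) (e : s.V → Exp) (env : ℕ → ℕ),
    (s.sumE x e).eval mem env = ((s.visits P x env).map fun p => (e p.2).eval mem p.1).sum
  | unit, x, e, env => by
    change _ = (List.map _ [(env, ())]).sum
    simp [Sh.sumE]
  | fin b, x, e, env => by
    change _ = (List.map _ (List.map _ _)).sum
    rw [List.map_map]
    rfl
  | prod s t, x, e, env => by
    change _ = (List.map _ (List.flatMap _ _)).sum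
    rw [Sh.sumE, Sh.eval_sumE_visits mem s, List.map_flatMap, List.flatMap, List.sum_flatten,
      List.map_map]
    congr 2
    funext p
    rw [Sh.eval_sumE_visits mem t, Function.comp_apply, List.map_map]
    rfl
  | sum s t, x, e, env => by
    change _ = (List.map _ (_ ++ _)).sum
    rw [Sh.sumE, Exp.eval, Sh.eval_sumE_visits mem s, Sh.eval_sumE_visits mem t, List.map_append,
      List.sum_append, List.map_map, List.map_map]
    rfl

theorem sum_map_congr_forall₂ {α β M : Type} [AddMonoid M] {R : α → β → Prop} {f : α → M} {g : β → M}
    (h : ∀ a b, R a b → f a = g b) {l : List α} {l' : List β} (hl : List.Forall₂ R l l') :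
    (l.map f).sum = (l'.map g).sum := by
  induction hl with
  | nil => rfl
  | cons hab _ ih => rw [List.map_cons, List.map_cons, List.sum_cons, List.sum_cons, h _ _ hab, ih]

/-- The value of the summand is asked for only at stable indices and at environments that agree
below `x`, so outer symbolic indices keep their meaning inside the sum. -/
theorem Sh.eval_sumE (s : Sh) (x : ℕ) (e : s.V → Exp) (env : ℕ → ℕ) (mem : Mem P)
    (F : s.T P → Rq P)
    (h : ∀ env' v i, (∀ y < x, env' y = env y) → s.Stable P (x + s.depth) env' v i →
      (e v).eval mem env' = F i) :
    (s.sumE x e).eval mem env = ∑ i, F i := by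
  rw [Sh.eval_sumE_visits, ← Sh.sum_elems]
  exact sum_map_congr_forall₂ (fun p i hp => h p.1 p.2 i hp.1 hp.2) (Sh.forall₂_visits P s x env)

theorem Sh.reads_sumE (d : ℕ) : ∀ (s : Sh) (x : ℕ) (e : s.V → Exp), (∀ v, (e v).Reads d) →
    (s.sumE x e).Reads d
  | unit, _, _, h => h ()
  | fin _, _, _, h => h _
  | prod s t, _, _, h => Sh.reads_sumE d s _ _ fun v => Sh.reads_sumE d t _ _ fun w => h (v, w)
  | sum s t, _, _, h => ⟨Sh.reads_sumE d s _ _ fun v => h (Sum.inl v),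
      Sh.reads_sumE d t _ _ fun v => h (Sum.inr v)⟩

/-- Assigning expressions to all cells of an array. -/
def assign (s : Sh) (a : ℕ) (e : s.V → Exp) : Prog :=
  s.loop 0 fun v => Prog.seq ((e v).compile 0) (Prog.set (a, s.loc v) (Exp.tmp 0))

/-- The expressions do not read the target array, so partial writes cannot influence later entries
and every cell is computed from the initial memory. Only the target and the scratch arrays from
`100` on may change. -/
theorem assign_run (s : Sh) (a : ℕ) (e : s.V → Exp) (ha : a < 100) (he : ∀ v, (e v).Reads a)
    (env : ℕ → ℕ) (mem : Mem P) (F : s.T P → Rq P)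
    (hF : ∀ env' v i, s.Stable P s.depth env' v i → (e v).eval mem env' = F i) :
    ∃ mem', (assign s a e).run D o env mem = pure mem' ∧ load (s.T P) (mem' a) = F ∧
      ∀ b < 100, b ≠ a → mem' b = mem b := by
  have key : ∀ (L : List ((ℕ → ℕ) × s.V)) (L' : List (s.T P)),
      List.Forall₂ (fun p i => s.Stable P s.depth p.1 p.2 i) L L' → L'.Nodup → ∀ mem1 : Mem P,
      (∀ b < 100, b ≠ a → mem1 b = mem b) →
      ∃ mem', L.foldlM (fun mem p => (Prog.seq ((e p.2).compile 0)
        (Prog.set (a, s.loc p.2) (Exp.tmp 0))).run D o p.1 mem) mem1 = pure mem' ∧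
        (∀ i ∈ L', mem' a (Addr.addr i) = F i) ∧
        (∀ i ∉ L', mem' a (Addr.addr i) = mem1 a (Addr.addr i)) ∧
        ∀ b < 100, b ≠ a → mem' b = mem b := by
    intro L L' hL
    induction hL with
    | nil => exact fun _ mem1 h => ⟨mem1, rfl, fun i hi => absurd hi List.not_mem_nil,
        fun _ _ => rfl, h⟩
    | @cons p i L L' hp _ ih =>
      intro hnd mem1 hm
      obtain ⟨hi, hnd'⟩ := List.nodup_cons.1 hnd
      obtain ⟨m1, h1, h2, h3⟩ := (e p.2).compile_run D o a (he p.2) 0 p.1 mem1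
      have hwr (v : Rq P) : wr p.1 m1 (a, s.loc p.2) v = wrAt a m1 (Addr.addr i) v := by
        simp only [wr, wrAt, Sh.map_loc hp.rel]
      obtain ⟨mem', h4, h5, h6, h7⟩ := ih hnd' (wrAt a m1 (Addr.addr i) (F i)) fun b hb hba => by
        rw [wrAt, Function.update_of_ne hba, h3 b (by omega), hm b hb hba]
      refine ⟨mem', ?_, fun j hj => ?_, fun j hj => ?_, h7⟩
      · rw [List.foldlM_cons, run_seq_pure D o h1]
        refine (PMF.pure_bind _ _).trans ?_
        rw [hwr, rd_tmp, h2, Exp.eval_congr hm _ (he p.2), hF _ _ _ hp]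
        exact h4
      · rcases List.mem_cons.1 hj with rfl | hj
        · rw [h6 _ hi, wrAt, Function.update_self, Function.update_self]
        · exact h5 j hj
      · rw [List.mem_cons, not_or] at hj
        rw [h6 j hj.2, wrAt, Function.update_self,
          Function.update_of_ne fun h => hj.1 (Sh.addr_injective s h), h3 a (by omega)]
  obtain ⟨mem', h1, h2, -, h4⟩ := key (s.visits P 0 env) (s.elems P)
    ((Sh.forall₂_visits P s 0 env).imp fun p i h => by
      have := h.2
      rwa [zero_add] at this) (Sh.nodup_elems P s) mem fun _ _ _ => rfl
  refine ⟨mem', ?_, funext fun i => h2 i (Sh.mem_elems P s i), h4⟩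
  rw [assign, Sh.loop_run]
  exact h1

end Compile

/-! ### Openings of the commitment from pairs of accepting runs -/

section Opening

variable {P : Params}

/-- The secret vector opened by two responses. -/
def Prover.openM (a : Prover P) (R : RowIdx P → KeyIdx P → Rq P) (dd : RowIdx P → ZMod P.q)
    (c c' : Rq P) : KeyIdx P → Rq P :=
  Ring.inverse (c - c') • ((a.msg4 R dd c).1 - (a.msg4 R dd c').1)

/-- The commitment randomness opened by two responses. -/
def Prover.openS (a : Prover P) (R : RowIdx P → KeyIdx P → Rq P) (dd : RowIdx P → ZMod P.q)
    (c c' : Rq P) : Fin P.n → Rq P :=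
  Ring.inverse (c - c') • ((a.msg4 R dd c).2 - (a.msg4 R dd c').2)

/-- Two accepting transcripts that differ only in the last challenge and response, with an
invertible difference of the challenges. -/
structure Opens (A : Matrix (Fin P.kap) (Fin P.n) (Rq P)) (pk : Fin 2 × Fin P.n → Rq P)
    (ck : CommKey P) (a : Prover P) (R : RowIdx P → KeyIdx P → Rq P) (dd : RowIdx P → ZMod P.q)
    (c c' : Rq P) : Prop where
  fst : Verify A pk ck (a.transcript R dd c)
  snd : Verify A pk ck (a.transcript R dd c')
  unit : IsUnit (c - c')
  norm_c : l1 (c - c') ≤ 2 * P.om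

namespace Opens

variable {A : Matrix (Fin P.kap) (Fin P.n) (Rq P)} {pk : Fin 2 × Fin P.n → Rq P} {ck : CommKey P}
  {a : Prover P} {R R' : RowIdx P → KeyIdx P → Rq P} {dd dd' : RowIdx P → ZMod P.q}
  {c c' e e' : Rq P}

theorem smul_openM (h : Opens A pk ck a R dd c c') :
    (c - c') • a.openM R dd c c' = (a.msg4 R dd c).1 - (a.msg4 R dd c').1 := by
  rw [Prover.openM, ← smul_assoc, smul_eq_mul, Ring.mul_inverse_cancel _ h.unit, one_smul]

theorem smul_openS (h : Opens A pk ck a R dd c c') :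
    (c - c') • a.openS R dd c c' = (a.msg4 R dd c).2 - (a.msg4 R dd c').2 := by
  rw [Prover.openS, ← smul_assoc, smul_eq_mul, Ring.mul_inverse_cancel _ h.unit, one_smul]

/-- Subtracting the two verification equations cancels `w`; the unit `c - c'` is then divided out.
The equation for the public key follows in the same way. -/
theorem opening (h : Opens A pk ck a R dd c c') :
    ck.A3.mulVec (a.openM R dd c c') + ck.A4.mulVec (a.openS R dd c c') = a.f := by
  refine (h.unit.smul_left_cancel).1 ?_
  have h1 := h.fst.opening
  have h2 := h.snd.opening
  simp only [Prover.transcript] at h1 h2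
  rw [smul_add, ← Matrix.mulVec_smul, ← Matrix.mulVec_smul, h.smul_openM, h.smul_openS,
    Matrix.mulVec_sub, Matrix.mulVec_sub, sub_smul, sub_add_sub_comm, h1, h2]
  abel

theorem key (h : Opens A pk ck a R dd c c') : keyMap A (a.openM R dd c c') = pk := by
  refine (h.unit.smul_left_cancel).1 ?_
  have h1 := h.fst.top
  have h2 := h.snd.top
  simp only [Prover.transcript] at h1 h2
  rw [← keyMap_smul, h.smul_openM, keyMap_sub, sub_smul]
  rw [h1] at h2
  rw [sub_eq_sub_iff_add_eq_add] at h2 ⊢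
  rw [h2]
  abel

theorem norm_m (h : Opens A pk ck a R dd c c') :
    l2 ((c - c') • a.openM R dd c c') ≤ 2 * bd1 P := by
  rw [h.smul_openM, two_mul]
  exact (l2_sub_le _ _).trans (add_le_add h.fst.norm1 h.snd.norm1)

theorem norm_s (h : Opens A pk ck a R dd c c') :
    l2 ((c - c') • a.openS R dd c c') ≤ 2 * bd2 P := by
  rw [h.smul_openS, two_mul]
  exact (l2_sub_le _ _).trans (add_le_add h.fst.norm2 h.snd.norm2)

theorem relKW (h : Opens A pk ck a R dd c c')
    (hs : (linf (a.openM R dd c c') : ℝ) ≤ 2 * bd3 P) :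
    RelKW A pk ck a.f (c - c') (a.openM R dd c c') (a.openS R dd c c') :=
  ⟨h.unit, h.norm_c, h.opening, h.norm_m, h.norm_s, h.key, hs⟩

/-- The last entry of `v` is sent before `c` and cancels in the difference of the two checks. What
is left is a linear equation for the opening itself, in which the last challenge no longer appears.
-/
theorem lastRow_eq (h : Opens A pk ck a R dd c c') :
    lastRow R dd (a.openM R dd c c') (a.u1 - ck.B1.mulVec (a.openS R dd c c'))
        (a.u2 - dotProduct ck.B2 (a.openS R dd c c'))
      = (a.msg3 R dd).1 + ∑ j, dd j • conjDot (unitVec j) (a.z3 R) := by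
  refine (h.unit.mul_right_inj).1 ?_
  have h1 := h.fst.bot
  have h2 := h.snd.bot
  simp only [Prover.transcript] at h1 h2
  rw [h1] at h2
  have h3 : (c - c') • (a.u1 - ck.B1.mulVec (a.openS R dd c c'))
      = (c • a.u1 - ck.B1.mulVec (a.msg4 R dd c).2)
        - (c' • a.u1 - ck.B1.mulVec (a.msg4 R dd c').2) := by
    rw [smul_sub, ← Matrix.mulVec_smul, h.smul_openS, Matrix.mulVec_sub, sub_smul]
    abel
  have h4 : (c - c') * (a.u2 - dotProduct ck.B2 (a.openS R dd c c'))
      = (c * a.u2 - dotProduct ck.B2 (a.msg4 R dd c).2)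
        - (c' * a.u2 - dotProduct ck.B2 (a.msg4 R dd c').2) := by
    rw [mul_sub, ← smul_eq_mul (c - c') (dotProduct _ _), ← dotProduct_smul, h.smul_openS,
      dotProduct_sub]
    ring
  rw [← lastRow_smul, h.smul_openM, h3, h4, lastRow_sub]
  linear_combination h2

end Opens

/-- The challenges for which a given opening is compatible with acceptance. -/
def Compat (ck : CommKey P) (a : Prover P) (m : KeyIdx P → Rq P) (s : Fin P.n → Rq P)
    (R : RowIdx P → KeyIdx P → Rq P) (dd : RowIdx P → ZMod P.q) : Prop :=
  (linf (a.z3 R) : ℝ) ≤ bd3 P ∧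
    ∑ j, dd j * (rowProd R m j + coef ((a.u1 - ck.B1.mulVec s) j.1) j.2 - coef (a.z3 R j.1) j.2)
      + cst (a.u2 - dotProduct ck.B2 s) = 0

namespace Opens

variable {A : Matrix (Fin P.kap) (Fin P.n) (Rq P)} {pk : Fin 2 × Fin P.n → Rq P} {ck : CommKey P}
  {a : Prover P} {R R' : RowIdx P → KeyIdx P → Rq P} {dd dd' : RowIdx P → ZMod P.q}
  {c c' e e' : Rq P}

/-- Taking constant coefficients in `lastRow_eq` removes `h` and turns the ring equation into one
affine equation over `ℤ_q` in the challenges `δ`. -/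
theorem compat (h : Opens A pk ck a R dd c c') :
    Compat ck a (a.openM R dd c c') (a.openS R dd c c') R dd := by
  refine ⟨h.fst.norm3, ?_⟩
  have h1 := congrArg cst h.lastRow_eq
  have h2 : cst (a.msg3 R dd).1 = 0 := h.fst.const
  rw [cst_lastRow, cst_add, h2, zero_add, cst_sum] at h1
  simp only [cst_smul, cst_conjDot_unitVec] at h1
  simp only [mul_sub, Finset.sum_sub_distrib]
  linear_combination h1

end Opens

theorem l2_sumElim {ι μ : Type} [Fintype ι] [Fintype μ] (a : ι → Rq P) (b : μ → Rq P) :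
    l2 (Sum.elim a b) = Real.sqrt (l2 a ^ 2 + l2 b ^ 2) := by
  rw [l2_eq_nrm a, l2_eq_nrm b, nrm_sq, nrm_sq, l2, Fintype.sum_sum_type]
  rfl

namespace Opens

variable {A : Matrix (Fin P.kap) (Fin P.n) (Rq P)} {pk : Fin 2 × Fin P.n → Rq P} {ck : CommKey P}
  {a : Prover P} {R R' : RowIdx P → KeyIdx P → Rq P} {dd dd' : RowIdx P → ZMod P.q}
  {c c' e e' : Rq P}

/-- Cross-multiplication: `x y (u - v) = y (x u) - x (y v)`, and each of the two terms has norm at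
most `2 ω · 2 B`. -/
theorem l2_mul_smul_sub_le {ι : Type} [Fintype ι] {x y : Rq P} {u v : ι → Rq P} {B : ℝ}
    (hx : l1 x ≤ 2 * P.om) (hy : l1 y ≤ 2 * P.om) (hu : l2 (x • u) ≤ 2 * B)
    (hv : l2 (y • v) ≤ 2 * B) : l2 ((x * y) • (u - v)) ≤ 8 * P.om * B := by
  have h : (x * y) • (u - v) = y • x • u - x • y • v := by
    rw [smul_sub, mul_smul, mul_smul, smul_comm x y u]
  have hom : (0 : ℝ) ≤ P.om := Nat.cast_nonneg _
  rw [h]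
  calc _ ≤ l1 y * l2 (x • u) + l1 x * l2 (y • v) :=
        (l2_sub_le _ _).trans (add_le_add (l2_mul_le _ _) (l2_mul_le _ _))
    _ ≤ 2 * P.om * (2 * B) + 2 * P.om * (2 * B) := by
        gcongr <;> exact l2_nonneg _
    _ = _ := by ring

/-- Two openings of the same `f` differ by an element of the kernel of `[A₃ | A₄]`. The product of
both challenge differences makes the difference short, and being a unit it does not annihilate it.
-/
theorem isMSIS (h : Opens A pk ck a R dd c c') (h' : Opens A pk ck a R' dd' e e')
    (hne : ¬(a.openM R dd c c' = a.openM R' dd' e e' ∧ a.openS R dd c c' = a.openS R' dd' e e')) :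
    IsMSIS (Matrix.fromCols ck.A3 ck.A4) (msisBound P)
      (Sum.elim (((c - c') * (e - e')) • (a.openM R dd c c' - a.openM R' dd' e e'))
        (((c - c') * (e - e')) • (a.openS R dd c c' - a.openS R' dd' e e'))) := by
  refine ⟨l2_pos fun h0 => hne ?_, ?_, ?_⟩
  · have hu := h.unit.mul h'.unit
    have hM : ((c - c') * (e - e')) • (a.openM R dd c c' - a.openM R' dd' e e') = 0 :=
      funext fun i => congrFun h0 (Sum.inl i)
    have hS : ((c - c') * (e - e')) • (a.openS R dd c c' - a.openS R' dd' e e') = 0 :=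
      funext fun i => congrFun h0 (Sum.inr i)
    rw [hu.smul_eq_zero, sub_eq_zero] at hM hS
    exact ⟨hM, hS⟩
  · rw [l2_sumElim, msisBound]
    have h1 := l2_mul_smul_sub_le h.norm_c h'.norm_c h.norm_m h'.norm_m
    have h2 := l2_mul_smul_sub_le h.norm_c h'.norm_c h.norm_s h'.norm_s
    have h3 : (0 : ℝ) ≤ 8 * P.om := by positivity
    rw [← Real.sqrt_sq h3, ← Real.sqrt_mul (sq_nonneg _), mul_add, ← mul_pow, ← mul_pow]
    exact Real.sqrt_le_sqrt (add_le_add (pow_le_pow_left₀ (l2_nonneg _) h1 2)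
      (pow_le_pow_left₀ (l2_nonneg _) h2 2))
  · rw [Matrix.fromCols_mulVec_sumElim, Matrix.mulVec_smul, Matrix.mulVec_smul, ← smul_add,
      Matrix.mulVec_sub, Matrix.mulVec_sub, sub_add_sub_comm, h.opening, h'.opening, sub_self,
      smul_zero]

end Opens

/-! ### Compatibility is unlikely for long openings -/

theorem abs_valMinAbs_add_le {q : ℕ} [NeZero q] (x y : ZMod q) :
    |((x + y).valMinAbs : ℝ)| ≤ |(x.valMinAbs : ℝ)| + |(y.valMinAbs : ℝ)| := by
  have h := abs_valMinAbs_intCast_le (n := q) (x.valMinAbs + y.valMinAbs)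
  push_cast [ZMod.coe_valMinAbs] at h
  exact h.trans (abs_add_le _ _)

/-- If `r` lies in the window, then `r ± μ` lie outside it, and only `b = 0`, of weight `1 / 2`, can
succeed. Otherwise `b = 0` fails, and `b = ±1` have total weight `1 / 2`. -/
theorem ex_bin1_window {B : ℝ} (r : ZMod P.q) {μ : ZMod P.q}
    (hμ : 2 * B < |(μ.valMinAbs : ℝ)|) :
    (ex bin1 fun b => ind (|((r + b * μ).valMinAbs : ℝ)| ≤ B)) ≤ 2⁻¹ := by
  have h4 : (4 : ℝ≥0∞)⁻¹ * 2 = 2⁻¹ := by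
    rw [show (4 : ℝ≥0∞) = 2 * 2 by norm_num,
      ENNReal.mul_inv (Or.inl two_ne_zero) (Or.inl ENNReal.ofNat_ne_top), mul_assoc,
      ENNReal.inv_mul_cancel two_ne_zero ENNReal.ofNat_ne_top, mul_one]
  rw [ex_bin1, ← h4]
  refine mul_le_mul_right ?_ _
  push_cast
  by_cases h0 : |(r.valMinAbs : ℝ)| ≤ B
  · have h (s : ZMod P.q) (hs : |(s.valMinAbs : ℝ)| = |(μ.valMinAbs : ℝ)|) :
        ¬|((r + s).valMinAbs : ℝ)| ≤ B := fun h1 => by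
      have h2 := abs_valMinAbs_add_le (r + s) (-r)
      rw [abs_valMinAbs_neg, add_neg_cancel_comm, hs] at h2
      linarith
    rw [ind_not (h (1 * μ) (by rw [one_mul])),
      ind_not (h (-1 * μ) (by rw [neg_one_mul, abs_valMinAbs_neg])), add_zero, add_zero]
    exact (mul_le_mul_right (ind_le_one _) _).trans (mul_one _).le
  · rw [zero_mul, add_zero, ind_not h0, mul_zero, zero_add, ← one_add_one_eq_two]
    exact add_le_add (ind_le_one _) (ind_le_one _)

/-- All entries of the row are frozen except the one that multiplies the long coefficient; that
entry alone already leaves the window with probability at least `1 / 2`. -/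
theorem ex_row_window {B : ℝ} {m : KeyIdx P → Rq P} (v : ZMod P.q) {i : KeyIdx P} {k : Fin P.d}
    (hm : 2 * B < |(lift (m i) k : ℝ)|) :
    (ex (iid (polyOf P bin1) (KeyIdx P)) fun r =>
      ind (|((∑ i, ∑ k, coef (r i) k * coef (m i) k + v).valMinAbs : ℝ)| ≤ B)) ≤ 2⁻¹ := by
  classical
  rw [polyOf, ex_iid_map, ex_iid_curry, ← ex_iid_update bin1 (i, k), ex_comm]
  refine ex_le_const fun u => le_of_eq_of_le (ex_congr fun x => ?_) (ex_bin1_window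
    (∑ p ∈ Finset.univ.erase (i, k), (u p : ZMod P.q) * coef (m p.1) p.2 + v) hm)
  congr 4
  simp only [coef_ofInt]
  rw [← Fintype.sum_prod_type' (f := fun i' k' =>
      ((Function.update u (i, k) x (i', k') : ℤ) : ZMod P.q) * coef (m i') k'),
    ← Finset.add_sum_erase _ _ (Finset.mem_univ (i, k))]
  rw [Finset.sum_congr rfl fun p hp => by rw [Function.update_of_ne (Finset.ne_of_mem_erase hp)],
    Function.update_self]
  rw [add_assoc, add_comm]

theorem ex_projMat_window {B : ℝ} {m : KeyIdx P → Rq P} (v : RowIdx P → ZMod P.q) {i : KeyIdx P}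
    {k : Fin P.d} (hm : 2 * B < |(lift (m i) k : ℝ)|) :
    (ex (projMat P) fun R => ind (∀ j, |((rowProd R m j + v j).valMinAbs : ℝ)| ≤ B))
      ≤ 2⁻¹ ^ 256 := by
  have h := ex_iid_forall (ι := RowIdx P) (iid (polyOf P bin1) (KeyIdx P)) fun j r =>
    |((∑ i, ∑ k, coef (r i) k * coef (m i) k + v j).valMinAbs : ℝ)| ≤ B
  refine h.trans_le ((Finset.prod_le_pow_card _ _ _ fun j _ => ex_row_window (v j) hm).trans ?_)
  rw [Finset.card_univ, card_rowIdx]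

/-- Given the other coordinates, a nonzero coefficient leaves only one value for `δ_j`. -/
theorem ex_linear_eq_zero_le {ι : Type} [Fintype ι] {y : ι → ZMod P.q} {j : ι} (hj : y j ≠ 0)
    (g : ZMod P.q) :
    (ex (iid (PMF.uniformOfFintype (ZMod P.q)) ι) fun dd => ind (∑ i, dd i * y i + g = 0))
      ≤ (P.q : ℝ≥0∞)⁻¹ := by
  classical
  rw [← ex_iid_update _ j, ex_comm]
  refine ex_le_const fun u => ?_
  calc _ ≤ ex (PMF.uniformOfFintype (ZMod P.q)) fun x =>
        ind (x = -(∑ i ∈ Finset.univ.erase j, u i * y i + g) / y j) := by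
        refine ex_mono fun x => ind_mono fun h => ?_
        rw [← Finset.add_sum_erase _ _ (Finset.mem_univ j), Function.update_self,
          Finset.sum_congr rfl fun p hp => by
            rw [Function.update_of_ne (Finset.ne_of_mem_erase hp)]] at h
        rw [eq_div_iff hj]
        linear_combination h
    _ = _ := by rw [ex_ind_eq, PMF.uniformOfFintype_apply, ZMod.card]

theorem exists_lift_of_linf {B : ℝ} (hB : 0 ≤ B) {m : KeyIdx P → Rq P} (h : ¬(linf m : ℝ) ≤ B) :
    ∃ i k, B < |(lift (m i) k : ℝ)| := by
  by_contra! hc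
  exact h (linf_le_real hB hc)

theorem bd3_nonneg (P : Params) : 0 ≤ bd3 P :=
  mul_nonneg (Real.sqrt_nonneg _) (sd3_pos P).le

/-- Here `m` and `s` are fixed before `R` and `δ`, while `z₃` may depend on `R` but not on `δ`. This
order of choices is what makes both error terms available. -/
theorem ex_compat_le (ck : CommKey P) (a : Prover P) {m : KeyIdx P → Rq P} (s : Fin P.n → Rq P)
    (hm : ¬(linf m : ℝ) ≤ 2 * bd3 P) :
    (ex (projMat P) fun R => ex (iid (PMF.uniformOfFintype (ZMod P.q)) (RowIdx P)) fun dd =>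
      ind (Compat ck a m s R dd)) ≤ 2⁻¹ ^ 256 + (P.q : ℝ≥0∞)⁻¹ := by
  obtain ⟨i, k, hik⟩ := exists_lift_of_linf (mul_nonneg two_pos.le (bd3_nonneg P)) hm
  set v : RowIdx P → ZMod P.q := fun j => coef ((a.u1 - ck.B1.mulVec s) j.1) j.2
  calc _ ≤ ex (projMat P) fun R =>
        ind (∀ j, |((rowProd R m j + v j).valMinAbs : ℝ)| ≤ bd3 P) + (P.q : ℝ≥0∞)⁻¹ := by
        refine ex_mono fun R => ?_
        -- If all coefficients of the affine form vanish, then `R m + v` equals the short `z₃`,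
        -- which puts every row into the window. Otherwise a nonconstant affine form in the still
        -- random `δ` has to vanish.
        by_cases h : ∀ j, rowProd R m j + v j - coef (a.z3 R j.1) j.2 = 0
        · refine le_add_right (ex_le_const fun dd => ind_mono fun hc j => ?_)
          rw [sub_eq_zero.1 (h j)]
          exact (abs_lift_le_linf (a.z3 R) j.1 j.2).trans hc.1
        · push Not at h
          obtain ⟨j, hj⟩ := h
          exact le_add_left ((ex_mono fun dd => ind_mono fun hc => hc.2).trans
            (ex_linear_eq_zero_le (y := fun j => rowProd R m j + v j - coef (a.z3 R j.1) j.2) hj _))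
    _ ≤ _ := by
        rw [ex_add, ex_const]
        exact add_le_add_left (ex_projMat_window v hik) _

end Opening

/-! ### Rules for executing programs one instruction at a time -/

/-- The shape of `KeyIdx`. -/
abbrev keySh : Sh := Sh.prod (Sh.fin Dim.two) (Sh.sum (Sh.fin Dim.kap) (Sh.fin Dim.n))

/-- The shape of `RowIdx`. -/
abbrev rowSh : Sh := Sh.prod (Sh.fin Dim.nb) (Sh.fin Dim.deg)

section Steps

variable {P : Params} (D : Dists P) (o : Option (Prover P))

/-- The predicate `Q` lets one rule serve both uses: lower bounds on expectations for the extractor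
and exact values for the simulator and the reduction. -/
theorem ex_assign_seq {Q : ℝ≥0∞ → Prop} (s : Sh) {a : ℕ} {e : s.V → Exp} {r : Prog}
    {env : ℕ → ℕ} {mem : Mem P} {G : Mem P → ℝ≥0∞} (F : s.T P → Rq P) (ha : a < 100)
    (he : ∀ v, (e v).Reads a)
    (hF : ∀ env' v i, s.Stable P s.depth env' v i → (e v).eval mem env' = F i)
    (h : ∀ mem', load (s.T P) (mem' a) = F → (∀ b < 100, b ≠ a → mem' b = mem b) →
      Q (ex (r.run D o env mem') G)) :
    Q (ex ((Prog.seq (assign s a e) r).run D o env mem) G) := by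
  obtain ⟨mem', h1, h2, h3⟩ := assign_run D o s a e ha he env mem F hF
  rw [run_seq_pure D o h1]
  exact h mem' h2 h3

theorem ex_sampleArr_seq (s : Sh) (a : ℕ) {smp : Loc → Prog} {μ : PMF (Rq P)}
    (h : ∀ l env mem, (smp l).run D o env mem = μ.map (wr env mem l)) (r : Prog) (env : ℕ → ℕ)
    (mem : Mem P) (G : Mem P → ℝ≥0∞) :
    ex ((Prog.seq (sampleArr s a smp) r).run D o env mem) G
      = ex (iid μ (s.T P)) fun v => ex (r.run D o env (overlay a mem v)) G := by
  rw [ex_seq, ex_sampleArr D o s a h]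

theorem ex_query_seq (a : Prover P) (k : ℕ) (r : Prog) (env : ℕ → ℕ) (mem : Mem P)
    (G : Mem P → ℝ≥0∞) :
    ex ((Prog.seq (Prog.query k) r).run D (some a) env mem) G
      = ex (r.run D (some a) env (a.answer k mem)) G := by
  rw [run_seq_pure D (some a) rfl]
  rfl

theorem Exp.eval_cell {s : Sh} {x a : ℕ} {env : ℕ → ℕ} {v : s.V} {i : s.T P} (mem : Mem P)
    (h : s.Stable P x env v i) :
    (Exp.cell a (s.loc v)).eval mem env = load (s.T P) (mem a) i := by
  rw [Exp.eval, Sh.map_loc h.rel, load]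

theorem Exp.eval_cell_nil (mem : Mem P) (a : ℕ) (env : ℕ → ℕ) :
    (Exp.cell a []).eval mem env = load1 (mem a) := rfl

theorem load1_eq_of_load {a : List ℕ → Rq P} {F : Unit → Rq P} (h : load (Sh.unit.T P) a = F) :
    load1 a = F () := congrFun h ()

/-- Copying an array. -/
def copy (s : Sh) (a b : ℕ) : Prog := assign s a fun v => Exp.cell b (s.loc v)

theorem ex_copy_seq {Q : ℝ≥0∞ → Prop} (s : Sh) {a b : ℕ} {r : Prog}
    {env : ℕ → ℕ} {mem : Mem P} {G : Mem P → ℝ≥0∞} (ha : a < 100) (hb : b < 100) (hab : b ≠ a)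
    (h : ∀ mem', load (s.T P) (mem' a) = load (s.T P) (mem b) →
      (∀ b < 100, b ≠ a → mem' b = mem b) → Q (ex (r.run D o env mem') G)) :
    Q (ex ((Prog.seq (copy s a b) r).run D o env mem) G) :=
  ex_assign_seq D o s (load (s.T P) (mem b)) ha (fun _ => ⟨hb, hab⟩)
    (fun _ _ _ hi => Exp.eval_cell mem hi) h

/-- The difference of two expressions. -/
def Exp.sub (a b : Exp) : Exp := Exp.add a (Exp.neg b)

theorem Exp.eval_sub (mem : Mem P) (a b : Exp) (env : ℕ → ℕ) :
    (Exp.sub a b).eval mem env = a.eval mem env - b.eval mem env := by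
  rw [Exp.sub, Exp.eval, Exp.eval, sub_eq_add_neg]

theorem ex_iid_unif_cst {ι : Type} [Fintype ι] (F : (ι → ZMod P.q) → ℝ≥0∞) :
    ex (iid (unif P) ι) (fun v => F fun i => cst (v i))
      = ex (iid (PMF.uniformOfFintype (ZMod P.q)) ι) F := by
  have h : PMF.uniformOfFintype (ZMod P.q) = (unif P).map cst :=
    PMF_ext_ex fun F => by rw [ex_map, ex_unif_cst]
  rw [h, ex_iid_map]

end Steps

/-! ### The extractor and the distribution of its output -/

section Extractor

/-- Runs the prover twice with independent last challenges and computes, in the arrays `10`, `11`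
and `12`, the opening that results if both runs are accepted. -/
def openProg (r : Prog) : Prog :=
  Prog.seq (sampleArr (Sh.prod rowSh keySh) 40 Prog.bin) <|
  Prog.seq (sampleArr rowSh 41 Prog.unif) <|
  Prog.seq (sampleArr Sh.unit 25 Prog.chal) <|
  Prog.seq (sampleArr Sh.unit 26 Prog.chal) <|
  Prog.seq (copy Sh.unit 42 25) <|
  Prog.seq (Prog.query 40) <|
  Prog.seq (copy keySh 30 51) <|
  Prog.seq (copy (Sh.fin Dim.n) 31 52) <|
  -- Only the last challenge changes before the second query, so both runs share `R` and `δ`. The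
  -- first responses were saved in the arrays `30` and `31`, because the query overwrites `51` and
  -- `52`.
  Prog.seq (copy Sh.unit 42 26) <|
  Prog.seq (Prog.query 40) <|
  Prog.seq (assign Sh.unit 10 fun _ => Exp.sub (Exp.cell 25 []) (Exp.cell 26 [])) <|
  Prog.seq (assign keySh 11 fun v => Exp.mul (Exp.inv (Exp.cell 10 []))
    (Exp.sub (Exp.cell 30 (keySh.loc v)) (Exp.cell 51 (keySh.loc v)))) <|
  Prog.seq (assign (Sh.fin Dim.n) 12 fun v => Exp.mul (Exp.inv (Exp.cell 10 []))
    (Exp.sub (Exp.cell 31 ((Sh.fin Dim.n).loc v)) (Exp.cell 52 ((Sh.fin Dim.n).loc v)))) r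

/-- The extractor: it computes two openings, and the candidate for a Module-SIS solution that comes
from their difference. -/
def extractor : Prog :=
  openProg <|
  Prog.seq (copy Sh.unit 34 10) <|
  Prog.seq (copy keySh 35 11) <|
  Prog.seq (copy (Sh.fin Dim.n) 36 12) <|
  openProg <|
  Prog.seq (assign (Sh.sum keySh (Sh.fin Dim.n)) 13 fun v => Exp.mul
    (Exp.mul (Exp.cell 34 []) (Exp.cell 10 [])) <|
    match v with
    | Sum.inl v => Exp.sub (Exp.cell 35 (keySh.loc v)) (Exp.cell 11 (keySh.loc v))
    | Sum.inr v => Exp.sub (Exp.cell 36 ((Sh.fin Dim.n).loc v))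
        (Exp.cell 12 ((Sh.fin Dim.n).loc v)))
  Prog.skip

variable {P : Params} (D : Dists P) (a : Prover P)

theorem Prover.answer_of_lt (mem : Mem P) {k b : ℕ} (hb : b < k + 3) :
    a.answer k mem b = mem b := by
  unfold Prover.answer
  repeat rw [if_neg (by omega)]

theorem Prover.answer_z1 (mem : Mem P) :
    load (KeyIdx P) (a.answer 40 mem 51) =
      (a.msg4 (fun j i => load (RowIdx P × KeyIdx P) (mem 40) (j, i))
        (fun j => cst (load (RowIdx P) (mem 41) j)) (load1 (mem 42))).1 :=
  load_store keySh _

theorem Prover.answer_z2 (mem : Mem P) :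
    load (Fin P.n) (a.answer 40 mem 52) =
      (a.msg4 (fun j i => load (RowIdx P × KeyIdx P) (mem 40) (j, i))
        (fun j => cst (load (RowIdx P) (mem 41) j)) (load1 (mem 42))).2 :=
  load_store (Sh.fin Dim.n) _

/-- The distribution of the challenges in two runs that share all but the last one. -/
def twoRuns : PMF ((RowIdx P → KeyIdx P → Rq P) × (RowIdx P → ZMod P.q) × Rq P × Rq P) := do
  let R ← projMat P
  let dd ← iid (PMF.uniformOfFintype (ZMod P.q)) (RowIdx P)
  let c ← D.chal
  let c' ← D.chal
  pure (R, dd, c, c')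

theorem ex_twoRuns
    (X : (RowIdx P → KeyIdx P → Rq P) × (RowIdx P → ZMod P.q) × Rq P × Rq P → ℝ≥0∞) :
    ex (twoRuns D) X = ex (projMat P) fun R =>
      ex (iid (PMF.uniformOfFintype (ZMod P.q)) (RowIdx P)) fun dd =>
      ex D.chal fun c => ex D.chal fun c' => X (R, dd, c, c') := by
  simp only [twoRuns, ex_bind, ex_pure]

/-- The continuation may rely on the opening in the arrays `10` to `12` and on the survival of the
arrays `32` to `39`. The latter lets the extractor keep its first opening in `34` to `36` while it
computes the second. -/
theorem le_ex_openProg (r : Prog) (env : ℕ → ℕ) (mem : Mem P) (G : Mem P → ℝ≥0∞)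
    (X : (RowIdx P → KeyIdx P → Rq P) × (RowIdx P → ZMod P.q) × Rq P × Rq P → ℝ≥0∞)
    (h : ∀ R dd c c' (mem' : Mem P), load1 (mem' 10) = c - c' →
      load (KeyIdx P) (mem' 11) = a.openM R dd c c' → load (Fin P.n) (mem' 12) = a.openS R dd c c' →
      (∀ b, 32 ≤ b → b < 40 → mem' b = mem b) →
      X (R, dd, c, c') ≤ ex (r.run D (some a) env mem') G) :
    ex (twoRuns D) X ≤ ex ((openProg r).run D (some a) env mem) G := by
  have hL : ex (twoRuns D) X = ex (iid (polyOf P bin1) ((Sh.prod rowSh keySh).T P)) fun vR =>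
      ex (iid (unif P) (rowSh.T P)) fun vd => ex (iid D.chal (Sh.unit.T P)) fun v1 =>
      ex (iid D.chal (Sh.unit.T P)) fun v2 =>
        X (fun j i => vR (j, i), fun j => cst (vd j), v1 (), v2 ()) := by
    rw [ex_twoRuns, projMat, ex_iid_curry]
    refine ex_congr fun vR => ?_
    rw [← ex_iid_unif_cst]
    refine ex_congr fun vd => ?_
    refine Eq.trans ?_ (ex_iid_unit _ _).symm
    exact ex_congr fun c => (ex_iid_unit D.chal fun v : Unit → Rq P =>
      X (fun i j => vR (i, j), fun i => cst (vd i), c, v ())).symm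
  rw [hL, openProg, ex_sampleArr_seq D _ _ 40 (fun _ _ _ => rfl)]
  refine ex_mono fun vR => ?_
  rw [ex_sampleArr_seq D _ _ 41 (fun _ _ _ => rfl)]
  refine ex_mono fun vd => ?_
  rw [ex_sampleArr_seq D _ _ 25 (fun _ _ _ => rfl)]
  refine ex_mono fun v1 => ?_
  rw [ex_sampleArr_seq D _ _ 26 (fun _ _ _ => rfl)]
  refine ex_mono fun v2 => ?_
  obtain ⟨m0, hm0⟩ : ∃ m0, m0 = overlay 26 (overlay 25 (overlay 41 (overlay 40 mem vR) vd) v1) v2 :=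
    ⟨_, rfl⟩
  rw [← hm0]
  have hR : (fun j i => load (RowIdx P × KeyIdx P) (m0 40) (j, i)) = fun j i => vR (j, i) := by
    rw [hm0, overlay_of_ne (by norm_num), overlay_of_ne (by norm_num), overlay_of_ne (by norm_num)]
    have h1 := load_overlay (Sh.prod rowSh keySh) 40 mem vR
    funext j i
    exact congrFun h1 (j, i)
  have hd : (fun j => cst (load (RowIdx P) (m0 41) j)) = fun j => cst (vd j) := by
    rw [hm0, overlay_of_ne (by norm_num), overlay_of_ne (by norm_num)]
    have h1 := load_overlay rowSh 41 (overlay 40 mem vR) vd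
    funext j
    exact congrArg cst (congrFun h1 j)
  have h25 : load1 (m0 25) = v1 () := by
    rw [hm0, overlay_of_ne (by norm_num)]
    exact congrFun (load_overlay Sh.unit 25 _ v1) ()
  have h26 : load1 (m0 26) = v2 () := by
    rw [hm0]
    exact congrFun (load_overlay Sh.unit 26 _ v2) ()
  have hrest : ∀ b, 32 ≤ b → b < 40 → m0 b = mem b := fun b hb hb' => by
    rw [hm0, overlay_of_ne (by omega), overlay_of_ne (by omega), overlay_of_ne (by omega),
      overlay_of_ne (by omega)]
  refine ex_copy_seq D _ _ (by norm_num) (by norm_num) (by norm_num) fun m1 hm1 hk1 => ?_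
  rw [ex_query_seq]
  obtain ⟨m2, hm2⟩ : ∃ m2, m2 = a.answer 40 m1 := ⟨_, rfl⟩
  have hk2 (b : ℕ) (hb : b < 43) : m2 b = m1 b := by rw [hm2, a.answer_of_lt _ hb]
  have hz1 := a.answer_z1 m1
  have hz2 := a.answer_z2 m1
  rw [← hm2, hk1 40 (by norm_num) (by norm_num), hk1 41 (by norm_num) (by norm_num), hR, hd,
    show load1 (m1 42) = v1 () from (congrFun hm1 ()).trans h25] at hz1 hz2
  rw [← hm2]
  refine ex_copy_seq D _ _ (by norm_num) (by norm_num) (by norm_num) fun m3 hm3 hk3 => ?_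
  refine ex_copy_seq D _ _ (by norm_num) (by norm_num) (by norm_num) fun m4 hm4 hk4 => ?_
  refine ex_copy_seq D _ _ (by norm_num) (by norm_num) (by norm_num) fun m5 hm5 hk5 => ?_
  rw [ex_query_seq]
  have hback (b : ℕ) (hb : b < 42) (h30 : b ≠ 30) (h31 : b ≠ 31) : m5 b = m0 b := by
    rw [hk5 b (by omega) (by omega), hk4 b (by omega) h31, hk3 b (by omega) h30, hk2 b (by omega),
      hk1 b (by omega) (by omega)]
  have h42 : load1 (m5 42) = v2 () := by
    refine (congrFun hm5 ()).trans ?_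
    rw [hk4 26 (by norm_num) (by norm_num), hk3 26 (by norm_num) (by norm_num), hk2 26 (by norm_num),
      hk1 26 (by norm_num) (by norm_num)]
    exact h26
  obtain ⟨m6, hm6⟩ : ∃ m6, m6 = a.answer 40 m5 := ⟨_, rfl⟩
  have hk6 (b : ℕ) (hb : b < 43) : m6 b = m5 b := by rw [hm6, a.answer_of_lt _ hb]
  have hz1' := a.answer_z1 m5
  have hz2' := a.answer_z2 m5
  rw [← hm6, hback 40 (by norm_num) (by norm_num) (by norm_num),
    hback 41 (by norm_num) (by norm_num) (by norm_num), hR, hd, h42] at hz1' hz2'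
  rw [← hm6]
  refine ex_assign_seq D _ _ (fun _ => v1 () - v2 ()) (by norm_num)
    (fun _ => ⟨⟨by norm_num, by norm_num⟩, by norm_num, by norm_num⟩) (fun env' _ _ _ => ?_)
    fun m7 hm7 hk7 => ?_
  · rw [Exp.eval_sub, Exp.eval_cell_nil, Exp.eval_cell_nil, hk6 _ (by norm_num),
      hk6 _ (by norm_num), hback _ (by norm_num) (by norm_num) (by norm_num),
      hback _ (by norm_num) (by norm_num) (by norm_num), h25, h26]
  have h30 : load (keySh.T P) (m6 30) = load (keySh.T P) (m2 51) := by
    rw [hk6 _ (by norm_num), hk5 _ (by norm_num) (by norm_num), hk4 _ (by norm_num) (by norm_num),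
      hm3]
  have h31 : load ((Sh.fin Dim.n).T P) (m6 31) = load ((Sh.fin Dim.n).T P) (m2 52) := by
    rw [hk6 _ (by norm_num), hk5 _ (by norm_num) (by norm_num), hm4,
      hk3 _ (by norm_num) (by norm_num)]
  refine ex_assign_seq D _ _ (a.openM (fun j i => vR (j, i)) (fun j => cst (vd j)) (v1 ()) (v2 ()))
    (by norm_num)
    (fun _ => ⟨⟨by norm_num, by norm_num⟩, ⟨by norm_num, by norm_num⟩, by norm_num, by norm_num⟩)
    (fun env' v i hi => ?_) fun m8 hm8 hk8 => ?_
  · rw [Exp.eval, Exp.eval, Exp.eval_sub, Exp.eval_cell_nil, load1_eq_of_load hm7,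
      Exp.eval_cell _ hi, Exp.eval_cell _ hi, hk7 _ (by norm_num) (by norm_num),
      hk7 _ (by norm_num) (by norm_num), h30]
    exact congrArg₂ (fun x y : KeyIdx P → Rq P => Ring.inverse (v1 () - v2 ()) * (x i - y i)) hz1 hz1'
  refine ex_assign_seq D _ _ (a.openS (fun j i => vR (j, i)) (fun j => cst (vd j)) (v1 ()) (v2 ()))
    (by norm_num)
    (fun _ => ⟨⟨by norm_num, by norm_num⟩, ⟨by norm_num, by norm_num⟩, by norm_num, by norm_num⟩)
    (fun env' v i hi => ?_) fun m9 hm9 hk9 => ?_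
  · rw [Exp.eval, Exp.eval, Exp.eval_sub, Exp.eval_cell_nil, hk8 _ (by norm_num) (by norm_num),
      load1_eq_of_load hm7,
      Exp.eval_cell _ hi, Exp.eval_cell _ hi, hk8 _ (by norm_num) (by norm_num),
      hk8 _ (by norm_num) (by norm_num), hk7 _ (by norm_num) (by norm_num),
      hk7 _ (by norm_num) (by norm_num), h31]
    exact congrArg₂ (fun x y : Fin P.n → Rq P => Ring.inverse (v1 () - v2 ()) * (x i - y i)) hz2 hz2'
  refine h _ _ _ _ m9 ?_ ?_ hm9 fun b hb hb' => ?_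
  · rw [hk9 _ (by norm_num) (by norm_num), hk8 _ (by norm_num) (by norm_num)]
    exact load1_eq_of_load hm7
  · rw [hk9 _ (by norm_num) (by norm_num)]
    exact hm8
  · rw [hk9 _ (by omega) (by omega), hk8 _ (by omega) (by omega), hk7 _ (by omega) (by omega),
      hk6 _ (by omega), hback _ (by omega) (by omega) (by omega), hrest _ hb hb']

/-- The memory left by two uses of `openProg` is summarized by two independent samples of `twoRuns`;
from here on the argument is purely probabilistic. -/
theorem le_ex_extractor (env : ℕ → ℕ) (mem : Mem P) (G : Mem P → ℝ≥0∞)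
    (X : (RowIdx P → KeyIdx P → Rq P) × (RowIdx P → ZMod P.q) × Rq P × Rq P →
      (RowIdx P → KeyIdx P → Rq P) × (RowIdx P → ZMod P.q) × Rq P × Rq P → ℝ≥0∞)
    (h : ∀ R dd c c' R' dd' e e' (mem' : Mem P), load1 (mem' 10) = e - e' →
      load (KeyIdx P) (mem' 11) = a.openM R' dd' e e' →
      load (Fin P.n) (mem' 12) = a.openS R' dd' e e' →
      load (KeyIdx P ⊕ Fin P.n) (mem' 13) =
        Sum.elim (((c - c') * (e - e')) • (a.openM R dd c c' - a.openM R' dd' e e'))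
          (((c - c') * (e - e')) • (a.openS R dd c c' - a.openS R' dd' e e')) →
      X (R, dd, c, c') (R', dd', e, e') ≤ G mem') :
    (ex (twoRuns D) fun t => ex (twoRuns D) fun t' => X t t')
      ≤ ex (extractor.run D (some a) env mem) G := by
  refine le_ex_openProg D a _ env mem G _ fun R dd c c' m1 h10 h11 h12 _ => ?_
  refine ex_copy_seq D _ _ (by norm_num) (by norm_num) (by norm_num) fun m2 hm2 hk2 => ?_
  refine ex_copy_seq D _ _ (by norm_num) (by norm_num) (by norm_num) fun m3 hm3 hk3 => ?_
  refine ex_copy_seq D _ _ (by norm_num) (by norm_num) (by norm_num) fun m4 hm4 hk4 => ?_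
  refine le_ex_openProg D a _ env m4 G _ fun R' dd' e e' m5 h10' h11' h12' hk5 => ?_
  have h34 : load1 (m5 34) = c - c' := by
    rw [hk5 _ (by norm_num) (by norm_num), hk4 _ (by norm_num) (by norm_num),
      hk3 _ (by norm_num) (by norm_num)]
    exact (congrFun hm2 ()).trans h10
  have h35 : load (KeyIdx P) (m5 35) = a.openM R dd c c' := by
    rw [hk5 _ (by norm_num) (by norm_num), hk4 _ (by norm_num) (by norm_num)]
    refine hm3.trans ?_
    rw [hk2 _ (by norm_num) (by norm_num)]
    exact h11
  have h36 : load (Fin P.n) (m5 36) = a.openS R dd c c' := by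
    rw [hk5 _ (by norm_num) (by norm_num)]
    refine hm4.trans ?_
    rw [hk3 _ (by norm_num) (by norm_num), hk2 _ (by norm_num) (by norm_num)]
    exact h12
  refine ex_assign_seq D _ _
    (Sum.elim (((c - c') * (e - e')) • (a.openM R dd c c' - a.openM R' dd' e e'))
      (((c - c') * (e - e')) • (a.openS R dd c c' - a.openS R' dd' e e')))
    (by norm_num) (fun v => ⟨⟨⟨by norm_num, by norm_num⟩, by norm_num, by norm_num⟩, ?_⟩)
    (fun env' v i hi => ?_) fun m6 hm6 hk6 => ?_
  · cases v <;> exact ⟨⟨by norm_num, by norm_num⟩, by norm_num, by norm_num⟩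
  · rw [Exp.eval, Exp.eval, Exp.eval_cell_nil, Exp.eval_cell_nil, h34, h10']
    cases v with
    | inl v =>
      cases i with
      | inl i =>
        have hi' : keySh.Stable P (Sh.sum keySh (Sh.fin Dim.n)).depth env' v i := hi
        rw [Exp.eval_sub, Exp.eval_cell _ hi', Exp.eval_cell _ hi']
        exact congrArg₂ (fun x y : KeyIdx P → Rq P => (c - c') * (e - e') * (x i - y i)) h35 h11'
      | inr i => exact hi.rel.elim
    | inr v =>
      cases i with
      | inl i => exact hi.rel.elim
      | inr i =>
        have hi' : (Sh.fin Dim.n).Stable P (Sh.sum keySh (Sh.fin Dim.n)).depth env' v i := hi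
        rw [Exp.eval_sub, Exp.eval_cell _ hi', Exp.eval_cell _ hi']
        exact congrArg₂ (fun x y : Fin P.n → Rq P => (c - c') * (e - e') * (x i - y i)) h36 h12'
  rw [show Prog.skip.run D (some a) env m6 = pure m6 from rfl, ex_pure]
  refine h R dd c c' R' dd' e e' m6 ?_ ?_ ?_ hm6
  · rw [hk6 _ (by norm_num) (by norm_num), h10']
  · rw [hk6 _ (by norm_num) (by norm_num), h11']
  · rw [hk6 _ (by norm_num) (by norm_num), h12']

end Extractor

/-! ### Success probability of the extractor -/

section Soundness

variable {P : Params} (D : Dists P)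

/-- `nonInv` as an extended non-negative real. -/
def nonInvE : ℝ≥0∞ := ⨆ c ∈ D.chal.support, D.chal.toOuterMeasure {c' | ¬IsUnit (c - c')}

theorem ex_not_isUnit_le {c : Rq P} (hc : c ∈ D.chal.support) :
    (ex D.chal fun c' => ind (¬IsUnit (c - c'))) ≤ nonInvE D := by
  rw [← toOuterMeasure_eq_ex]
  exact le_iSup₂ (f := fun c _ => D.chal.toOuterMeasure {c' | ¬IsUnit (c - c')}) c hc

theorem nonInvE_ne_top : nonInvE D ≠ ⊤ := by
  refine ne_top_of_le_ne_top ENNReal.one_ne_top (iSup₂_le fun c _ => ?_)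
  rw [toOuterMeasure_eq_ex]
  exact ex_ind_le_one _ _

/-- The bound on the probability that a long opening is compatible with the challenges. -/
def compatErr (P : Params) : ℝ≥0∞ := 2⁻¹ ^ 256 + (P.q : ℝ≥0∞)⁻¹

theorem compatErr_ne_top (P : Params) : compatErr P ≠ ⊤ :=
  ENNReal.add_ne_top.2 ⟨ENNReal.pow_ne_top (ENNReal.inv_ne_top.2 two_ne_zero),
    ENNReal.inv_ne_top.2 (Nat.cast_ne_zero.2 P.q_prime.ne_zero)⟩

theorem knowErr_eq : knowErr D = (nonInvE D + compatErr P).toReal := by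
  rw [ENNReal.toReal_add (nonInvE_ne_top D) (compatErr_ne_top P), compatErr, ENNReal.toReal_add
    (ENNReal.pow_ne_top (ENNReal.inv_ne_top.2 two_ne_zero))
    (ENNReal.inv_ne_top.2 (Nat.cast_ne_zero.2 P.q_prime.ne_zero)), ENNReal.toReal_pow,
    ENNReal.toReal_inv, ENNReal.toReal_inv, ENNReal.toReal_natCast, ENNReal.toReal_ofNat, knowErr,
    nonInv, nonInvE, inv_pow, one_div, one_div]
  ring

variable (A : Matrix (Fin P.kap) (Fin P.n) (Rq P)) (pk : Fin 2 × Fin P.n → Rq P) (ck : CommKey P)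
  (a : Prover P)

/-- The acceptance probability of a prover with fixed coins. -/
def accProb : ℝ≥0∞ :=
  ex (projMat P) fun R => ex (iid (PMF.uniformOfFintype (ZMod P.q)) (RowIdx P)) fun dd =>
    ex D.chal fun c => ind (Verify A pk ck (a.transcript R dd c))

theorem ex_play (adv : PMF (Prover P)) :
    (ex (play D adv) fun t => ind (Verify A pk ck t)) = ex adv fun a => accProb D A pk ck a := by
  simp only [play, ex_bind, ex_pure, accProb]

/-- The event that two runs with common first challenges open the commitment. -/
def OpensAt (t : (RowIdx P → KeyIdx P → Rq P) × (RowIdx P → ZMod P.q) × Rq P × Rq P) : Prop :=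
  Opens A pk ck a t.1 t.2.1 t.2.2.1 t.2.2.2

/-- For `R` and `δ` fixed, let `p` be the probability of acceptance and `η` the bound on
non-invertibility. Given an accepted `c`, an independent `c'` is accepted and has `c - c'`
invertible with probability at least `p - η`; finally `p (p - η) ≥ (p - η)²`. -/
theorem sq_le_ex_opens (R : RowIdx P → KeyIdx P → Rq P) (dd : RowIdx P → ZMod P.q) :
    ((ex D.chal fun c => ind (Verify A pk ck (a.transcript R dd c))) - nonInvE D) ^ 2
      ≤ ex D.chal fun c => ex D.chal fun c' => ind (Opens A pk ck a R dd c c') := by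
  set p := ex D.chal fun c => ind (Verify A pk ck (a.transcript R dd c)) with hp
  calc (p - nonInvE D) ^ 2 ≤ p * (p - nonInvE D) := by
        rw [sq]
        exact mul_le_mul_left tsub_le_self _
    _ = ex D.chal fun c => ind (Verify A pk ck (a.transcript R dd c)) * (p - nonInvE D) :=
        (ex_mul_right _ _ _).symm
    _ ≤ _ := by
        refine ex_mono_support fun c hc => ?_
        by_cases h : Verify A pk ck (a.transcript R dd c)
        · rw [ind_of h, one_mul, tsub_le_iff_right]
          refine le_trans ?_ (add_le_add_right (ex_not_isUnit_le D hc) _)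
          rw [← ex_add]
          refine ex_mono_support fun c' hc' => ?_
          by_cases hu : IsUnit (c - c')
          · refine le_add_right (ind_mono fun h' => ⟨h, h', hu, ?_⟩)
            rw [two_mul]
            exact (l1_sub_le c c').trans (add_le_add (D.chal_supp c hc) (D.chal_supp c' hc'))
          · rw [ind_of hu]
            exact le_add_left (ind_le_one _)
        · rw [ind_not h, zero_mul]
          exact zero_le

/-- Challenges in `X` are given up before squaring: there the conditional acceptance probability is
replaced by `0`, which costs at most the probability of `X` on average. Jensen's inequality then
lifts the bound for fixed `(R, δ)` to the average. -/
theorem sq_le_ex_twoRuns (X : (RowIdx P → KeyIdx P → Rq P) → (RowIdx P → ZMod P.q) → Prop)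
    (hX : (ex (projMat P) fun R => ex (iid (PMF.uniformOfFintype (ZMod P.q)) (RowIdx P)) fun dd =>
      ind (X R dd)) ≤ compatErr P) :
    (accProb D A pk ck a - (nonInvE D + compatErr P)) ^ 2
      ≤ ex (twoRuns D) fun t => ind (OpensAt A pk ck a t ∧ ¬X t.1 t.2.1) := by
  rw [ex_twoRuns]
  set p := fun R dd => ex D.chal fun c => ind (Verify A pk ck (a.transcript R dd c)) with hp
  have hp1 (R) (dd) : p R dd ≤ 1 := ex_ind_le_one _ _
  set w := fun R dd => p R dd - (nonInvE D + ind (X R dd)) with hw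
  have hw1 (R) (dd) : w R dd ≤ 1 := tsub_le_self.trans (hp1 R dd)
  set U := iid (PMF.uniformOfFintype (ZMod P.q)) (RowIdx P)
  have h1 : accProb D A pk ck a - (nonInvE D + compatErr P)
      ≤ ex (projMat P) fun R => ex U fun dd => w R dd := by
    rw [tsub_le_iff_right]
    refine le_trans ?_ (add_le_add_right (add_le_add_right hX _) _)
    have h2 : nonInvE D = ex (projMat P) fun _ => ex U fun _ => nonInvE D := by
      simp only [ex_const]
    rw [h2, ← ex_add, ← ex_add]
    refine ex_mono fun R => ?_
    rw [← ex_add, ← ex_add]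
    exact ex_mono fun dd => le_tsub_add
  refine (pow_le_pow_left' h1 2).trans ((sq_ex_le _ _ fun R => ex_le_const (hw1 R)).trans
    (ex_mono fun R => (sq_ex_le _ _ (hw1 R)).trans (ex_mono fun dd => ?_)))
  by_cases hX : X R dd
  · have h3 : w R dd = 0 := by
      rw [hw]
      simp only [ind_of hX]
      exact tsub_eq_zero_of_le ((hp1 R dd).trans le_add_self)
    rw [h3, zero_pow two_ne_zero]
    exact zero_le
  · have h3 : w R dd = p R dd - nonInvE D := by
      simp only [hw, ind_not hX, add_zero]
    rw [h3]
    exact (sq_le_ex_opens D A pk ck a R dd).trans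
      (ex_mono fun c => ex_mono fun c' => ind_mono fun h => ⟨h, hX⟩)

/-- The second pair `t'` opens with probability at least `Δ²`. A short opening is a witness. If it
is long, then, given `t'`, the first pair `t` opens at challenges incompatible with it with
probability at least `Δ²`; as an opening is compatible with its own challenges, the two openings
differ and solve Module-SIS. -/
theorem pow_four_le_ex_extractor (mem : Mem P) :
    (accProb D A pk ck a - (nonInvE D + compatErr P)) ^ 4
      ≤ ex (extractor.run D (some a) 0 mem) fun mem' =>
        ind (FindsMSIS ck (a, mem')) + ind (FindsWitness A pk ck (a, mem')) := by
  set Δ := accProb D A pk ck a - (nonInvE D + compatErr P) with hΔ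
  have hΔ1 : Δ ≤ 1 := tsub_le_self.trans
    (ex_le_const fun R => ex_le_const fun dd => ex_ind_le_one _ _)
  refine le_trans ?_ (le_ex_extractor D a 0 mem _ (fun t t' =>
    ind (OpensAt A pk ck a t' ∧ ((linf (a.openM t'.1 t'.2.1 t'.2.2.1 t'.2.2.2) : ℝ) ≤ 2 * bd3 P ∨
      (OpensAt A pk ck a t ∧ ¬Compat ck a (a.openM t'.1 t'.2.1 t'.2.2.1 t'.2.2.2)
        (a.openS t'.1 t'.2.1 t'.2.2.1 t'.2.2.2) t.1 t.2.1)))) ?_)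
  -- The pairs are independent, so one may condition on the one that is sampled last; its opening is
  -- then fixed while the challenges of the other pair are still random.
  · rw [ex_comm]
    have h2 := sq_le_ex_twoRuns D A pk ck a (fun _ _ => False) (by
      simp only [ind_not not_false, ex_const]
      exact zero_le)
    calc Δ ^ 4 = Δ ^ 2 * Δ ^ 2 := by ring
      _ ≤ (ex (twoRuns D) fun t' => ind (OpensAt A pk ck a t' ∧ ¬False)) * Δ ^ 2 :=
        mul_le_mul_left h2 _
      _ = ex (twoRuns D) fun t' => ind (OpensAt A pk ck a t' ∧ ¬False) * Δ ^ 2 :=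
        (ex_mul_right _ _ _).symm
      _ ≤ _ := by
        refine ex_mono fun t' => ?_
        by_cases ho : OpensAt A pk ck a t'
        · rw [ind_of ⟨ho, not_false⟩, one_mul]
          by_cases hs : (linf (a.openM t'.1 t'.2.1 t'.2.2.1 t'.2.2.2) : ℝ) ≤ 2 * bd3 P
          · simp only [ind_of (show _ ∧ (_ ∨ _) from ⟨ho, Or.inl hs⟩), ex_const]
            exact pow_le_one' hΔ1 2
          · exact (sq_le_ex_twoRuns D A pk ck a _ (ex_compat_le ck a _ hs)).trans
              (ex_mono fun t => ind_mono fun h => ⟨ho, Or.inr h⟩)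
        · rw [ind_not fun h => ho h.1, zero_mul]
          exact zero_le
  · intro R dd c c' R' dd' e e' mem' h10 h11 h12 h13
    by_cases h : OpensAt A pk ck a (R', dd', e, e') ∧
        ((linf (a.openM R' dd' e e') : ℝ) ≤ 2 * bd3 P ∨ (OpensAt A pk ck a (R, dd, c, c') ∧
          ¬Compat ck a (a.openM R' dd' e e') (a.openS R' dd' e e') R dd))
    · obtain ⟨ho, hs | ⟨ho', hc⟩⟩ := h
      · refine (ind_le_one _).trans (le_add_left (ind_of ?_).ge)
        unfold FindsWitness
        simp only [h10, h11, h12]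
        exact Opens.relKW ho hs
      · refine (ind_le_one _).trans (le_add_right (ind_of ?_).ge)
        unfold FindsMSIS
        simp only [h13]
        refine Opens.isMSIS ho' ho fun heq => hc ?_
        rw [← heq.1, ← heq.2]
        exact Opens.compat ho'
    · exact (ind_not h).trans_le zero_le

/-- Coins on which the prover succeeds with probability below the knowledge error contribute `0` by
truncation, and convexity of the fourth power averages over the rest. -/
theorem pow_four_le_pr (adv : PMF (Prover P))
    (h : knowErr D < pr (play D adv) (Verify A pk ck)) :
    (pr (play D adv) (Verify A pk ck) - knowErr D) ^ 4
      ≤ pr (extraction D extractor A pk ck adv) (FindsMSIS ck)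
        + pr (extraction D extractor A pk ck adv) (FindsWitness A pk ck) := by
  have h0 : 0 ≤ knowErr D := by
    rw [knowErr_eq]
    exact ENNReal.toReal_nonneg
  have h1 : ENNReal.ofReal (knowErr D) = nonInvE D + compatErr P := by
    rw [knowErr_eq, ENNReal.ofReal_toReal
      (ENNReal.add_ne_top.2 ⟨nonInvE_ne_top D, compatErr_ne_top P⟩)]
  have hM : 0 ≤ pr (extraction D extractor A pk ck adv) (FindsMSIS ck) := ENNReal.toReal_nonneg
  have hW : 0 ≤ pr (extraction D extractor A pk ck adv) (FindsWitness A pk ck) :=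
    ENNReal.toReal_nonneg
  refine (ENNReal.ofReal_le_ofReal_iff (add_nonneg hM hW)).1 ?_
  rw [ENNReal.ofReal_pow (sub_nonneg.2 h.le), ENNReal.ofReal_sub _ h0, h1, ofReal_pr, ex_play,
    ENNReal.ofReal_add hM hW, ofReal_pr, ofReal_pr, ← ex_add]
  refine (pow_le_pow_left' (ex_tsub_le adv _ _) 4).trans ((pow_four_ex_le adv _ fun a =>
    tsub_le_self.trans (ex_le_const fun R => ex_le_const fun dd => ex_ind_le_one _ _)).trans ?_)
  rw [extraction, ex_bind]
  refine ex_mono fun a => ?_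
  rw [ex_bind]
  simp only [ex_pure]
  exact pow_four_le_ex_extractor D A pk ck a _

end Soundness

theorem knowledge_soundness :
    ∃ (K : Prog) (e C : ℕ), 0 < e ∧ 0 < C ∧ K.PolyTime C ∧
      ∀ (P : Params) (D : Dists P) (A : Matrix (Fin P.kap) (Fin P.n) (Rq P))
        (pk : Fin 2 × Fin P.n → Rq P) (ck : CommKey P) (adv : PMF (Prover P)) (ε : ℝ),
        ε = pr (play D adv) (Verify A pk ck) → knowErr D < ε →
          (ε - knowErr D) ^ e / (C * P.size ^ C : ℝ)
              - pr (extraction D K A pk ck adv) (FindsMSIS ck)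
            ≤ pr (extraction D K A pk ck adv) (FindsWitness A pk ck) := by
  obtain ⟨C, hC⟩ := extractor.exists_polyTime
  -- The extractor succeeds without any polynomial loss. The denominator is at least `1`, and `C` is
  -- needed only for the running time.
  refine ⟨extractor, 4, C + 1, by norm_num, by omega, hC.mono (Nat.le_succ C), ?_⟩
  rintro P D A pk ck adv ε rfl h
  have h1 := pow_four_le_pr D A pk ck adv h
  have h2 : (1 : ℝ) ≤ ((C + 1 : ℕ) : ℝ) * (P.size : ℝ) ^ (C + 1) := by
    exact_mod_cast Nat.mul_pos (Nat.succ_pos C) (Nat.pow_pos P.one_le_size)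
  have h3 := div_le_self (pow_nonneg (sub_nonneg.2 h.le) 4) h2
  linarith

/-! ### Expressions for the linear maps of the protocol -/

/-- The shape of vectors of length `κ + λ + 3`. -/
abbrev nSh : Sh := Sh.fin Dim.n

/-- The shape of vectors of length `κ`. -/
abbrev kapSh : Sh := Sh.fin Dim.kap

/-- The shape of vectors of length `256 / d`. -/
abbrev nbSh : Sh := Sh.fin Dim.nb

section Linear

variable {P : Params}

theorem Exp.eval_add (mem : Mem P) (a b : Exp) (env : ℕ → ℕ) :
    (Exp.add a b).eval mem env = a.eval mem env + b.eval mem env := rfl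

theorem Exp.eval_mul (mem : Mem P) (a b : Exp) (env : ℕ → ℕ) :
    (Exp.mul a b).eval mem env = a.eval mem env * b.eval mem env := rfl

theorem Exp.eval_conj (mem : Mem P) (a : Exp) (env : ℕ → ℕ) :
    (Exp.conj a).eval mem env = KeyWF.conj P (a.eval mem env) := rfl

theorem Exp.eval_cst (mem : Mem P) (a : Exp) (env : ℕ → ℕ) :
    (Exp.cst a).eval mem env = algebraMap (ZMod P.q) (Rq P) (KeyWF.cst (a.eval mem env)) := rfl

theorem Exp.eval_mon (mem : Mem P) (i : Idx) (env : ℕ → ℕ) :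
    (Exp.mon i).eval mem env = xx P ^ i.val P env := rfl

theorem Exp.eval_cell_rel {s : Sh} {env : ℕ → ℕ} {v : s.V} {i : s.T P} (mem : Mem P) (a : ℕ)
    (h : s.Rel P env v i) : (Exp.cell a (s.loc v)).eval mem env = load (s.T P) (mem a) i := by
  rw [Exp.eval, Sh.map_loc h, load]

theorem Exp.eval_cell_prod {s t : Sh} {env : ℕ → ℕ} {v : s.V} {w : t.V} {i : s.T P} {j : t.T P}
    (mem : Mem P) (a : ℕ) (h : s.Rel P env v i) (h' : t.Rel P env w j) :
    (Exp.cell a ((Sh.prod s t).loc (v, w))).eval mem env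
      = load (s.T P × t.T P) (mem a) (i, j) :=
  Exp.eval_cell_rel (s := Sh.prod s t) mem a ⟨h, h'⟩

/-- The entry `v` of the product of the matrix in array `a` with the vector in array `b`. -/
def mulVecE (s t : Sh) (a b : ℕ) (v : s.V) : Exp :=
  -- The summation counters start above those of the outer index, so `v` keeps its value inside the
  -- sum.
  t.sumE s.depth fun w => Exp.mul (Exp.cell a ((Sh.prod s t).loc (v, w))) (Exp.cell b (t.loc w))

theorem reads_mulVecE {s t : Sh} {a b d : ℕ} (v : s.V) (ha : a < 100 ∧ a ≠ d)
    (hb : b < 100 ∧ b ≠ d) : (mulVecE s t a b v).Reads d :=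
  Sh.reads_sumE d t _ _ fun _ => ⟨ha, hb⟩

theorem eval_mulVecE {s t : Sh} {a b : ℕ} {env : ℕ → ℕ} {v : s.V} {i : s.T P} (mem : Mem P)
    (h : s.Stable P s.depth env v i) :
    (mulVecE s t a b v).eval mem env
      = ∑ j, load (s.T P × t.T P) (mem a) (i, j) * load (t.T P) (mem b) j := by
  refine Sh.eval_sumE t _ _ env mem _ fun env' w j he hw => ?_
  rw [Exp.eval_mul, Exp.eval_cell_prod mem a (h.trans he) hw.rel, Exp.eval_cell_rel mem b hw.rel]

/-- The entry `v` of `keyMap`, for the matrix in array `0` and the vector in array `21`. -/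
def keyMapE (v : (Sh.prod (Sh.fin Dim.two) nSh).V) : Exp :=
  Exp.add
    (kapSh.sumE 2 fun w => Exp.mul (Exp.cell 0 ((Sh.prod kapSh nSh).loc (w, v.2)))
      (Exp.cell 21 (keySh.loc (v.1, Sum.inl w))))
    (Exp.cell 21 (keySh.loc (v.1, Sum.inr v.2)))

theorem eval_keyMapE {env : ℕ → ℕ} {v : (Sh.prod (Sh.fin Dim.two) nSh).V}
    {i : (Sh.prod (Sh.fin Dim.two) nSh).T P} (mem : Mem P)
    (h : (Sh.prod (Sh.fin Dim.two) nSh).Stable P 2 env v i)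
    {A : Matrix (Fin P.kap) (Fin P.n) (Rq P)} {z : KeyIdx P → Rq P}
    (hA : ∀ i j, load (Fin P.kap × Fin P.n) (mem 0) (i, j) = A i j)
    (hz : load (KeyIdx P) (mem 21) = z) :
    (keyMapE v).eval mem env = keyMap A z i := by
  obtain ⟨h1, h2⟩ := h.rel
  have h3 : (Exp.cell 21 (keySh.loc (v.1, Sum.inr v.2))).eval mem env = z (i.1, Sum.inr i.2) := by
    rw [Exp.eval_cell_rel (s := keySh) (i := (i.1, Sum.inr i.2)) mem 21 ⟨h1, h2⟩]
    exact congrFun hz _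
  rw [keyMapE, Exp.eval_add, h3]
  refine congrArg (· + _) ?_
  refine Sh.eval_sumE kapSh _ _ env mem (fun k => A k i.2 * z (i.1, Sum.inl k))
    fun env' w k he hw => ?_
  obtain ⟨h1', h2'⟩ := h.trans he
  rw [Exp.eval_mul, Exp.eval_cell_prod mem 0 hw.rel h2',
    Exp.eval_cell_rel (s := keySh) (i := (i.1, Sum.inl k)) mem 21 ⟨h1', hw.rel⟩]
  exact congrArg₂ (· * ·) (hA k i.2) (congrFun hz _)

/-- The inner product of the conjugate of a row of the matrix in array `13` with the vector in
array `a`. -/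
def rowDotE (a x : ℕ) (v : rowSh.V) : Exp :=
  keySh.sumE x fun w => Exp.mul (Exp.conj (Exp.cell 13 ((Sh.prod rowSh keySh).loc (v, w))))
    (Exp.cell a (keySh.loc w))

theorem reads_rowDotE {a x d : ℕ} (v : rowSh.V) (h13 : 13 ≠ d) (ha : a < 100 ∧ a ≠ d) :
    (rowDotE a x v).Reads d :=
  Sh.reads_sumE d keySh _ _ fun _ => ⟨⟨by norm_num, h13⟩, ha⟩

theorem eval_rowDotE {env : ℕ → ℕ} {a x : ℕ} {v : rowSh.V} {j : rowSh.T P} (mem : Mem P)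
    (h : rowSh.Stable P x env v j) {R : RowIdx P → KeyIdx P → Rq P} {z : KeyIdx P → Rq P}
    (hR : ∀ j i, load (RowIdx P × KeyIdx P) (mem 13) (j, i) = R j i)
    (hz : load (KeyIdx P) (mem a) = z) :
    (rowDotE a x v).eval mem env = conjDot (R j) z := by
  refine Sh.eval_sumE keySh _ _ env mem (fun i => conj P (R j i) * z i) fun env' w i he hw => ?_
  rw [Exp.eval_mul, Exp.eval_conj, Exp.eval_cell_prod mem 13 (h.trans he) hw.rel,
    Exp.eval_cell_rel mem a hw.rel]
  exact congrArg₂ (fun x y => conj P x * y) (hR j i) (congrFun hz i)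

/-- `lastRow R dd a b 0`, for `R` and `dd` in the arrays `13` and `15`. -/
def lastRowE (a b : ℕ) : Exp :=
  rowSh.sumE 0 fun v => Exp.mul (Exp.cst (Exp.cell 15 (rowSh.loc v)))
    (Exp.add (rowDotE a 2 v) (Exp.mul (Exp.conj (Exp.mon v.2)) (Exp.cell b (nbSh.loc v.1))))

theorem reads_lastRowE {a b d : ℕ} (ha : a < 100 ∧ a ≠ d) (hb : b < 100 ∧ b ≠ d) (h13 : 13 ≠ d)
    (h15 : 15 ≠ d) : (lastRowE a b).Reads d :=
  Sh.reads_sumE d rowSh _ _ fun v => ⟨⟨by norm_num, h15⟩,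
    reads_rowDotE v h13 ha, trivial, hb⟩

theorem eval_lastRowE {env : ℕ → ℕ} {a b : ℕ} (mem : Mem P) {R : RowIdx P → KeyIdx P → Rq P}
    {dd : RowIdx P → ZMod P.q} {z : KeyIdx P → Rq P} {y : Fin P.nb → Rq P}
    (hR : ∀ j i, load (RowIdx P × KeyIdx P) (mem 13) (j, i) = R j i)
    (hd : ∀ j, cst (load (RowIdx P) (mem 15) j) = dd j)
    (hz : load (KeyIdx P) (mem a) = z) (hy : load (Fin P.nb) (mem b) = y) :
    (lastRowE a b).eval mem env = lastRow R dd z y 0 := by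
  have h0 (j : RowIdx P) : dd j • conjDot (R j) z + dd j • conjDot (unitVec j) y
      = algebraMap (ZMod P.q) (Rq P) (dd j)
        * (conjDot (R j) z + conj P (xx P ^ (j.2 : ℕ)) * y j.1) := by
    rw [← smul_add, conjDot_unitVec, Algebra.smul_def]
  rw [lastRow, add_zero, ← Finset.sum_add_distrib]
  refine Sh.eval_sumE rowSh _ _ env mem
    (fun j => dd j • conjDot (R j) z + dd j • conjDot (unitVec j) y) fun env' v j he hv => ?_
  have h1 : (Exp.cell b (nbSh.loc v.1)).eval mem env' = y j.1 :=
    (Exp.eval_cell_rel (s := nbSh) mem b hv.rel.1).trans (congrFun hy _)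
  have h2 : v.2.val P env' = (j.2 : ℕ) := hv.rel.2
  have h3 : (rowDotE a 2 v).eval mem env' = conjDot (R j) z := eval_rowDotE mem hv hR hz
  rw [Exp.eval_mul, Exp.eval_cst, Exp.eval_add, h3, Exp.eval_mul, Exp.eval_conj, Exp.eval_mon, h1, h2,
    Exp.eval_cell_rel mem 15 hv.rel]
  exact (congrArg (fun r => algebraMap (ZMod P.q) (Rq P) r * _) (hd j)).trans (h0 j).symm

/-- The entry `v` of `-proj R m`, for `R` and `m` in the arrays `13` and `6`. -/
def negProjE (v : nbSh.V) : Exp :=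
  Exp.neg ((Sh.fin Dim.deg).sumE 1 fun w =>
    Exp.mul (Exp.cst (rowDotE 6 2 (v, w))) (Exp.mon w))

theorem reads_negProjE {d : ℕ} (v : nbSh.V) (h13 : 13 ≠ d) (h6 : 6 ≠ d) : (negProjE v).Reads d :=
  Sh.reads_sumE d (Sh.fin Dim.deg) 1 (fun w =>
    Exp.mul (Exp.cst (rowDotE 6 2 (v, w))) (Exp.mon w)) fun w => ⟨reads_rowDotE (v, w) h13 ⟨by norm_num, h6⟩, trivial⟩

/-- Machines can extract constant coefficients only. The coefficients of `R m` are obtained as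
constant coefficients of the products `σ₋₁(r_j)ᵀ m` and reassembled with monomials. -/
theorem eval_negProjE {env : ℕ → ℕ} {v : nbSh.V} {b : nbSh.T P} (mem : Mem P)
    (h : nbSh.Stable P 1 env v b) {R : RowIdx P → KeyIdx P → Rq P} {m : KeyIdx P → Rq P}
    (hR : ∀ j i, load (RowIdx P × KeyIdx P) (mem 13) (j, i) = R j i)
    (hm : load (KeyIdx P) (mem 6) = m) :
    (negProjE v).eval mem env = -proj R m b := by
  rw [negProjE, Exp.eval, ← ofCoef_coef (proj R m b)]
  refine congrArg Neg.neg ?_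
  refine Sh.eval_sumE (Sh.fin Dim.deg) _ _ env mem
    (fun k : Fin P.d => algebraMap (ZMod P.q) (Rq P) (coef (proj R m b) k) * xx P ^ (k : ℕ))
    fun env' w k he hw => ?_
  have hvw : rowSh.Stable P 2 env' (v, w) (b, k) := fun env'' h' =>
    ⟨h.trans fun y hy => (h' y (by omega)).trans (he y hy), hw.trans h'⟩
  have h2 : w.val P env' = (k : ℕ) := hw.rel
  rw [Exp.eval_mul, Exp.eval_cst, Exp.eval_mon, h2, eval_rowDotE mem hvw hR hm]
  exact congrArg (fun r => algebraMap (ZMod P.q) (Rq P) r * _)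
    ((cst_conjDot_row R m (b, k)).trans (coef_proj R m (b, k)).symm)

end Linear

/-! ### Sampling challenges and responses -/

/-- Challenges, the message `h` and responses. -/
structure Coins (P : Params) where
  R : RowIdx P → KeyIdx P → Rq P
  dd : RowIdx P → ZMod P.q
  c : Rq P
  h : Rq P
  z1 : KeyIdx P → Rq P
  z2 : Fin P.n → Rq P
  z3 : Fin P.nb → Rq P

/-- Their distribution in simulated transcripts. -/
def coins {P : Params} (D : Dists P) : PMF (Coins P) := do
  let R ← projMat P
  let dd ← iid (PMF.uniformOfFintype (ZMod P.q)) (RowIdx P)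
  let c ← D.chal
  let h ← unifZero P
  let z1 ← gaussPoly P (sd1_pos P) (KeyIdx P)
  let z2 ← gaussPoly P (sd2_pos P) (Fin P.n)
  let z3 ← gaussPoly P (sd3_pos P) (Fin P.nb)
  pure ⟨R, dd, c, h, z1, z2, z3⟩

/-- The program that samples challenges, the message `h` and responses. -/
def sampleCoins (r : Prog) : Prog :=
  Prog.seq (sampleArr (Sh.prod rowSh keySh) 13 Prog.bin) <|
  Prog.seq (sampleArr rowSh 15 Prog.unif) <|
  Prog.seq (sampleArr Sh.unit 20 Prog.chal) <|
  Prog.seq (sampleArr Sh.unit 30 Prog.unif) <|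
  Prog.seq (sampleArr keySh 21 (Prog.gauss 0)) <|
  Prog.seq (sampleArr nSh 22 (Prog.gauss 1)) <|
  Prog.seq (sampleArr nbSh 14 (Prog.gauss 2)) <|
  Prog.seq (assign Sh.unit 16 fun _ => Exp.sub (Exp.cell 30 []) (Exp.cst (Exp.cell 30 []))) r

section Programs

variable {P : Params} (D : Dists P) (o : Option (Prover P))

/-- The memory `mem` contains the sampled values `w`. -/
structure HoldsCoins (mem : Mem P) (w : Coins P) : Prop where
  R : ∀ j i, load (RowIdx P × KeyIdx P) (mem 13) (j, i) = w.R j i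
  dd : ∀ j, cst (load (RowIdx P) (mem 15) j) = w.dd j
  c : load1 (mem 20) = w.c
  h : load1 (mem 16) = w.h
  z1 : load (KeyIdx P) (mem 21) = w.z1
  z2 : load (Fin P.n) (mem 22) = w.z2
  z3 : load (Fin P.nb) (mem 14) = w.z3

theorem HoldsCoins.congr {mem mem' : Mem P} {w : Coins P} (h : HoldsCoins mem w)
    (hm : ∀ b < 23, 13 ≤ b → b ≠ 17 → b ≠ 18 → b ≠ 19 → mem' b = mem b) : HoldsCoins mem' w where
  R := by rw [hm 13 (by norm_num) (by norm_num) (by norm_num) (by norm_num) (by norm_num)]; exact h.R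
  dd := by rw [hm 15 (by norm_num) (by norm_num) (by norm_num) (by norm_num) (by norm_num)]; exact h.dd
  c := by rw [hm 20 (by norm_num) (by norm_num) (by norm_num) (by norm_num) (by norm_num)]; exact h.c
  h := by rw [hm 16 (by norm_num) (by norm_num) (by norm_num) (by norm_num) (by norm_num)]; exact h.h
  z1 := by rw [hm 21 (by norm_num) (by norm_num) (by norm_num) (by norm_num) (by norm_num)]; exact h.z1
  z2 := by rw [hm 22 (by norm_num) (by norm_num) (by norm_num) (by norm_num) (by norm_num)]; exact h.z2
  z3 := by rw [hm 14 (by norm_num) (by norm_num) (by norm_num) (by norm_num) (by norm_num)]; exact h.z3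

/-- The zero-constant-term message `h` is formed from a uniform element in array `30` by subtracting
its constant coefficient, which reproduces `unifZero`. -/
theorem ex_sampleCoins (r : Prog) (env : ℕ → ℕ) (mem : Mem P) (G : Mem P → ℝ≥0∞)
    (X : Coins P → ℝ≥0∞)
    (h : ∀ (w : Coins P) (mem' : Mem P), HoldsCoins mem' w →
      (∀ b < 100, (b < 13 ∨ 30 < b) → mem' b = mem b) → ex (r.run D o env mem') G = X w) :
    ex ((sampleCoins r).run D o env mem) G = ex (coins D) X := by
  simp only [coins, ex_bind, ex_pure]
  rw [projMat, ex_iid_curry, sampleCoins, ex_sampleArr_seq D o _ 13 (fun _ _ _ => rfl)]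
  refine ex_congr fun vR => ?_
  rw [ex_sampleArr_seq D o _ 15 (fun _ _ _ => rfl), ← ex_iid_unif_cst]
  refine ex_congr fun vd => ?_
  rw [ex_sampleArr_seq D o _ 20 (fun _ _ _ => rfl)]
  refine (ex_iid_unit D.chal _).trans (ex_congr fun c => ?_)
  rw [ex_sampleArr_seq D o _ 30 (fun _ _ _ => rfl), ex_unifZero]
  refine (ex_iid_unit (unif P) _).trans (ex_congr fun g => ?_)
  rw [ex_sampleArr_seq D o _ 21 (fun _ _ _ => rfl)]
  refine ex_congr fun z1 => ?_
  rw [ex_sampleArr_seq D o _ 22 (fun _ _ _ => rfl)]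
  refine ex_congr fun z2 => ?_
  rw [ex_sampleArr_seq D o _ 14 (fun _ _ _ => rfl)]
  refine ex_congr fun z3 => ?_
  obtain ⟨m1, hm1⟩ : ∃ m1, m1 = overlay 13 mem vR := ⟨_, rfl⟩
  obtain ⟨m2, hm2⟩ : ∃ m2, m2 = overlay 15 m1 vd := ⟨_, rfl⟩
  obtain ⟨m3, hm3⟩ : ∃ m3 : Mem P, m3 = overlay 20 m2 fun _ : Sh.unit.T P => c := ⟨_, rfl⟩
  obtain ⟨m4, hm4⟩ : ∃ m4 : Mem P, m4 = overlay 30 m3 fun _ : Sh.unit.T P => g := ⟨_, rfl⟩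
  obtain ⟨m5, hm5⟩ : ∃ m5, m5 = overlay 21 m4 z1 := ⟨_, rfl⟩
  obtain ⟨m6, hm6⟩ : ∃ m6, m6 = overlay 22 m5 z2 := ⟨_, rfl⟩
  obtain ⟨m7, hm7⟩ : ∃ m7, m7 = overlay 14 m6 z3 := ⟨_, rfl⟩
  have k1 (b : ℕ) (hb : b ≠ 13) : m1 b = mem b := by rw [hm1, overlay_of_ne hb]
  have k2 (b : ℕ) (hb : b ≠ 15) : m2 b = m1 b := by rw [hm2, overlay_of_ne hb]
  have k3 (b : ℕ) (hb : b ≠ 20) : m3 b = m2 b := by rw [hm3, overlay_of_ne hb]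
  have k4 (b : ℕ) (hb : b ≠ 30) : m4 b = m3 b := by rw [hm4, overlay_of_ne hb]
  have k5 (b : ℕ) (hb : b ≠ 21) : m5 b = m4 b := by rw [hm5, overlay_of_ne hb]
  have k6 (b : ℕ) (hb : b ≠ 22) : m6 b = m5 b := by rw [hm6, overlay_of_ne hb]
  have k7 (b : ℕ) (hb : b ≠ 14) : m7 b = m6 b := by rw [hm7, overlay_of_ne hb]
  have l1 : load ((Sh.prod rowSh keySh).T P) (m1 13) = vR := by rw [hm1, load_overlay]
  have l2 : load (rowSh.T P) (m2 15) = vd := by rw [hm2, load_overlay]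
  have l3 : load1 (m3 20) = c := by rw [hm3]; exact congrFun (load_overlay Sh.unit 20 m2 _) ()
  have l4 : load1 (m4 30) = g := by rw [hm4]; exact congrFun (load_overlay Sh.unit 30 m3 _) ()
  have l5 : load (keySh.T P) (m5 21) = z1 := by rw [hm5, load_overlay]
  have l6 : load (nSh.T P) (m6 22) = z2 := by rw [hm6, load_overlay]
  have l7 : load (nbSh.T P) (m7 14) = z3 := by rw [hm7, load_overlay]
  rw [← hm1, ← hm2, ← hm3, ← hm4, ← hm5, ← hm6, ← hm7]
  refine ex_assign_seq D o (Q := (· = _)) Sh.unit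
    (fun _ => g - algebraMap (ZMod P.q) (Rq P) (cst g)) (by norm_num)
    (fun _ => ⟨⟨by norm_num, by norm_num⟩, by norm_num, by norm_num⟩) (fun env' _ _ _ => ?_)
    fun m8 l8 k8 => h _ m8 ⟨?_, ?_, ?_, ?_, ?_, ?_, ?_⟩ fun b hb hb' => ?_
  · rw [Exp.eval_sub, Exp.eval_cst, Exp.eval_cell_nil, k7 _ (by norm_num), k6 _ (by norm_num),
      k5 _ (by norm_num), l4]
  · rw [k8 _ (by norm_num) (by norm_num), k7 _ (by norm_num), k6 _ (by norm_num),
      k5 _ (by norm_num), k4 _ (by norm_num), k3 _ (by norm_num), k2 _ (by norm_num)]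
    exact fun j i => congrFun l1 (j, i)
  · rw [k8 _ (by norm_num) (by norm_num), k7 _ (by norm_num), k6 _ (by norm_num),
      k5 _ (by norm_num), k4 _ (by norm_num), k3 _ (by norm_num)]
    exact fun j => congrArg cst (congrFun l2 j)
  · rw [k8 _ (by norm_num) (by norm_num), k7 _ (by norm_num), k6 _ (by norm_num),
      k5 _ (by norm_num), k4 _ (by norm_num), l3]
  · exact load1_eq_of_load l8
  · rw [k8 _ (by norm_num) (by norm_num), k7 _ (by norm_num), k6 _ (by norm_num)]
    exact l5
  · rw [k8 _ (by norm_num) (by norm_num), k7 _ (by norm_num)]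
    exact l6
  · rw [k8 _ (by norm_num) (by norm_num)]
    exact l7
  · rw [k8 _ hb (by omega), k7 _ (by omega), k6 _ (by omega), k5 _ (by omega), k4 _ (by omega),
      k3 _ (by omega), k2 _ (by omega), k1 _ (by omega)]

/-! ### Completing a transcript -/

/-- The program that computes `w` and `v` from the rest of the transcript. -/
def finish : Prog :=
  Prog.seq (assign kapSh 17 fun v => Exp.sub
    (Exp.add (mulVecE kapSh keySh 2 21 v) (mulVecE kapSh nSh 3 22 v))
    (Exp.mul (Exp.cell 20 []) (Exp.cell 10 (kapSh.loc v)))) <|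
  Prog.seq (assign (Sh.prod (Sh.fin Dim.two) nSh) 18 fun v => Exp.sub (keyMapE v)
    (Exp.mul (Exp.cell 20 []) (Exp.cell 1 ((Sh.prod (Sh.fin Dim.two) nSh).loc v)))) <|
  Prog.seq (assign nbSh 31 fun v => Exp.sub
    (Exp.sub (Exp.mul (Exp.cell 20 []) (Exp.cell 11 (nbSh.loc v))) (mulVecE nbSh nSh 4 22 v))
    (Exp.mul (Exp.cell 20 []) (Exp.cell 14 (nbSh.loc v)))) <|
  Prog.seq (assign Sh.unit 19 fun v => Exp.add (lastRowE 21 31) (Exp.sub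
    (Exp.sub (Exp.mul (Exp.cell 20 []) (Exp.cell 12 [])) (mulVecE Sh.unit nSh 5 22 v))
    (Exp.mul (Exp.cell 20 []) (Exp.cell 16 []))))
  Prog.skip

/-- The memory `mem` contains the statement and the first message. -/
structure HoldsFirst (mem : Mem P) (A : Matrix (Fin P.kap) (Fin P.n) (Rq P))
    (pk : Fin 2 × Fin P.n → Rq P) (ck : CommKey P) (f : Fin P.kap → Rq P) (u1 : Fin P.nb → Rq P)
    (u2 : Rq P) : Prop where
  A : ∀ i j, load (Fin P.kap × Fin P.n) (mem 0) (i, j) = A i j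
  pk : load (Fin 2 × Fin P.n) (mem 1) = pk
  ck : readCommKey mem = ck
  f : load (Fin P.kap) (mem 10) = f
  u1 : load (Fin P.nb) (mem 11) = u1
  u2 : load1 (mem 12) = u2

theorem readCommKey_congr {mem mem' : Mem P} (h : ∀ b, 2 ≤ b → b < 6 → mem' b = mem b) :
    readCommKey mem' = readCommKey mem := by
  unfold readCommKey
  rw [h 2 (by norm_num) (by norm_num), h 3 (by norm_num) (by norm_num),
    h 4 (by norm_num) (by norm_num), h 5 (by norm_num) (by norm_num)]

/-- The simulated transcript for given challenges and responses. -/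
def simOf (A : Matrix (Fin P.kap) (Fin P.n) (Rq P)) (pk : Fin 2 × Fin P.n → Rq P)
    (ck : CommKey P) (f : Fin P.kap → Rq P) (u1 : Fin P.nb → Rq P) (u2 : Rq P) (w : Coins P) :
    Transcript P :=
  simTrans A pk ck f u1 u2 w.R w.z3 w.dd w.h w.c w.z1 w.z2

theorem lastRow_add_right (R : RowIdx P → KeyIdx P → Rq P) (dd : RowIdx P → ZMod P.q)
    (a : KeyIdx P → Rq P) (b : Fin P.nb → Rq P) (g : Rq P) :
    lastRow R dd a b 0 + g = lastRow R dd a b g := by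
  rw [lastRow, lastRow, add_zero]

/-- This last stage is shared: the simulator and the reduction differ only in the first message they
supply, and `w` and `v` are recovered from the verifier's equations in both cases. -/
theorem ex_finish (env : ℕ → ℕ) {mem : Mem P} (G : Mem P → ℝ≥0∞) (Y : ℝ≥0∞)
    {A : Matrix (Fin P.kap) (Fin P.n) (Rq P)} {pk : Fin 2 × Fin P.n → Rq P} {ck : CommKey P}
    {f : Fin P.kap → Rq P} {u1 : Fin P.nb → Rq P} {u2 : Rq P} {w : Coins P}
    (hf : HoldsFirst mem A pk ck f u1 u2) (hw : HoldsCoins mem w)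
    (h : ∀ mem', readCommKey mem' = ck → readTranscript mem' = simOf A pk ck f u1 u2 w → G mem' = Y) :
    ex (finish.run D o env mem) G = Y := by
  obtain ⟨hA, hpk, hck, hf10, hu1, hu2⟩ := hf
  have hA3 (i j) : load (Fin P.kap × KeyIdx P) (mem 2) (i, j) = ck.A3 i j := by rw [← hck]; rfl
  have hA4 (i j) : load (Fin P.kap × Fin P.n) (mem 3) (i, j) = ck.A4 i j := by rw [← hck]; rfl
  have hB1 (i j) : load (Fin P.nb × Fin P.n) (mem 4) (i, j) = ck.B1 i j := by rw [← hck]; rfl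
  have hB2 (j) : load (Fin P.n) (mem 5) j = ck.B2 j := by rw [← hck]; rfl
  refine ex_assign_seq D o (Q := (· = _)) kapSh (ck.A3.mulVec w.z1 + ck.A4.mulVec w.z2 - w.c • f)
    (by norm_num) (fun v => ⟨⟨reads_mulVecE v (by norm_num) (by norm_num),
      reads_mulVecE v (by norm_num) (by norm_num)⟩, ⟨by norm_num, by norm_num⟩, by norm_num,
      by norm_num⟩) (fun env' v i hi => ?_) fun m1 l1 k1 => ?_
  · rw [Exp.eval_sub, Exp.eval_add, Exp.eval_mul, eval_mulVecE mem hi, eval_mulVecE mem hi,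
      Exp.eval_cell_nil, hw.c, Exp.eval_cell_rel mem 10 hi.rel]
    refine congrArg₂ _ (congrArg₂ _ (Finset.sum_congr rfl fun j _ => ?_)
      (Finset.sum_congr rfl fun j _ => ?_)) (congrArg _ (congrFun hf10 i))
    · exact congrArg₂ _ (hA3 i j) (congrFun hw.z1 j)
    · exact congrArg₂ _ (hA4 i j) (congrFun hw.z2 j)
  refine ex_assign_seq D o (Q := (· = _)) (Sh.prod (Sh.fin Dim.two) nSh)
    (keyMap A w.z1 - w.c • pk) (by norm_num) (fun v => ⟨⟨Sh.reads_sumE 18 kapSh _ _ fun _ =>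
      ⟨⟨by norm_num, by norm_num⟩, by norm_num, by norm_num⟩, by norm_num, by norm_num⟩,
      ⟨by norm_num, by norm_num⟩, by norm_num, by norm_num⟩) (fun env' v i hi => ?_)
    fun m2 l2 k2 => ?_
  · rw [Exp.eval_sub, eval_keyMapE m1 hi (A := A) (z := w.z1)
      (by rw [k1 _ (by norm_num) (by norm_num)]; exact hA)
      (by rw [k1 _ (by norm_num) (by norm_num)]; exact hw.z1), Exp.eval_mul, Exp.eval_cell_nil,
      k1 _ (by norm_num) (by norm_num), hw.c, Exp.eval_cell_rel m1 1 hi.rel,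
      k1 _ (by norm_num) (by norm_num)]
    exact congrArg (fun x => _ - w.c * x) (congrFun hpk i)
  have k12 (b : ℕ) (hb : b < 100) (h17 : b ≠ 17) (h18 : b ≠ 18) : m2 b = mem b := by
    rw [k2 b hb h18, k1 b hb h17]
  refine ex_assign_seq D o (Q := (· = _)) nbSh (w.c • u1 - ck.B1.mulVec w.z2 - w.c • w.z3)
    (by norm_num) (fun v => ⟨⟨⟨⟨by norm_num, by norm_num⟩, by norm_num, by norm_num⟩,
      reads_mulVecE v (by norm_num) (by norm_num)⟩, ⟨by norm_num, by norm_num⟩, by norm_num,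
      by norm_num⟩) (fun env' v i hi => ?_) fun m3 l3 k3 => ?_
  · rw [Exp.eval_sub, Exp.eval_sub, Exp.eval_mul, Exp.eval_mul, eval_mulVecE m2 hi,
      Exp.eval_cell_nil, k12 _ (by norm_num) (by norm_num) (by norm_num), hw.c,
      Exp.eval_cell_rel m2 11 hi.rel, Exp.eval_cell_rel m2 14 hi.rel,
      k12 _ (by norm_num) (by norm_num) (by norm_num),
      k12 _ (by norm_num) (by norm_num) (by norm_num),
      k12 _ (by norm_num) (by norm_num) (by norm_num),
      k12 _ (by norm_num) (by norm_num) (by norm_num)]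
    refine congrArg₂ _ (congrArg₂ _ (congrArg _ (congrFun hu1 i))
      (Finset.sum_congr rfl fun j _ => ?_)) (congrArg _ (congrFun hw.z3 i))
    exact congrArg₂ _ (hB1 i j) (congrFun hw.z2 j)
  have k13 (b : ℕ) (hb : b < 31) (h17 : b ≠ 17) (h18 : b ≠ 18) : m3 b = mem b := by
    rw [k3 b (by omega) (by omega), k12 b (by omega) h17 h18]
  have hw3 : HoldsCoins m3 w := hw.congr fun b hb _ h17 h18 _ => k13 b (by omega) h17 h18
  refine ex_assign_seq D o (Q := (· = _)) Sh.unit (fun _ => lastRow w.R w.dd w.z1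
      (w.c • u1 - ck.B1.mulVec w.z2 - w.c • w.z3)
      (w.c * u2 - dotProduct ck.B2 w.z2 - w.c * w.h))
    (by norm_num) (fun v => ⟨reads_lastRowE (by norm_num) (by norm_num) (by norm_num) (by norm_num),
      ⟨⟨⟨by norm_num, by norm_num⟩, by norm_num, by norm_num⟩,
      reads_mulVecE v (by norm_num) (by norm_num)⟩, ⟨by norm_num, by norm_num⟩, by norm_num,
      by norm_num⟩) (fun env' v i hi => ?_) fun m4 l4 k4 => ?_
  · rw [Exp.eval_add, eval_lastRowE m3 hw3.R hw3.dd hw3.z1 l3, Exp.eval_sub, Exp.eval_sub,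
      Exp.eval_mul, Exp.eval_mul, eval_mulVecE m3 hi, Exp.eval_cell_nil, Exp.eval_cell_nil, Exp.eval_cell_nil, hw3.c,
      hw3.h, ← lastRow_add_right _ _ _ _ (_ - _), k13 12 (by norm_num) (by norm_num) (by norm_num),
      k13 5 (by norm_num) (by norm_num) (by norm_num), hu2]
    refine congrArg (fun x => _ + (_ - x - _)) (Finset.sum_congr rfl fun j _ => ?_)
    exact congrArg₂ _ (hB2 j) (congrFun hw3.z2 j)
  have k14 (b : ℕ) (hb : b < 31) (h17 : b ≠ 17) (h18 : b ≠ 18) (h19 : b ≠ 19) : m4 b = mem b := by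
    rw [k4 b (by omega) h19, k13 b hb h17 h18]
  have hw4 : HoldsCoins m4 w := hw.congr fun b hb _ h17 h18 h19 => k14 b (by omega) h17 h18 h19
  rw [show Prog.skip.run D o env m4 = pure m4 from rfl, ex_pure]
  refine h m4 ?_ ?_
  · rw [readCommKey_congr fun b _ hb => k14 b (by omega) (by omega) (by omega) (by omega), hck]
  · simp only [readTranscript, simOf, simTrans, Transcript.mk.injEq]
    refine ⟨?_, ?_, ?_, funext fun j => funext fun i => hw4.R j i, hw4.z3, funext hw4.dd, hw4.h,
      ?_, ?_, ?_, hw4.c, hw4.z1, hw4.z2⟩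
    · rw [k14 10 (by norm_num) (by norm_num) (by norm_num) (by norm_num)]
      exact hf10
    · rw [k14 11 (by norm_num) (by norm_num) (by norm_num) (by norm_num)]
      exact hu1
    · rw [k14 12 (by norm_num) (by norm_num) (by norm_num) (by norm_num)]
      exact hu2
    · rw [k4 17 (by norm_num) (by norm_num), k3 17 (by norm_num) (by norm_num),
        k2 17 (by norm_num) (by norm_num)]
      exact l1
    · rw [k4 18 (by norm_num) (by norm_num), k3 18 (by norm_num) (by norm_num)]
      exact l2
    · exact load1_eq_of_load l4

end Programs

/-! ### The simulator and the reduction to Module-LWE -/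

/-- The shape of `LweRow`. -/
abbrev lweSh : Sh := Sh.sum kapSh (Sh.sum nbSh Sh.unit)

/-- The simulator: the first message is uniform. -/
def simulator : Prog :=
  Prog.seq (sampleArr kapSh 10 Prog.unif) <|
  Prog.seq (sampleArr nbSh 11 Prog.unif) <|
  Prog.seq (sampleArr Sh.unit 12 Prog.unif) <|
  sampleCoins finish

/-- The reduction to Module-LWE: the matrix of the instance provides `A₄, B', B''`, and its vector
masks the first message. -/
def reduction : Prog :=
  Prog.seq (sampleArr (Sh.prod kapSh keySh) 2 Prog.unif) <|
  Prog.seq (assign (Sh.prod kapSh nSh) 3 fun v =>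
    Exp.cell 7 ((Sh.prod lweSh nSh).loc (Sum.inl v.1, v.2))) <|
  Prog.seq (assign (Sh.prod nbSh nSh) 4 fun v =>
    Exp.cell 7 ((Sh.prod lweSh nSh).loc (Sum.inr (Sum.inl v.1), v.2))) <|
  Prog.seq (assign nSh 5 fun v =>
    Exp.cell 7 ((Sh.prod lweSh nSh).loc (Sum.inr (Sum.inr ()), v))) <|
  sampleCoins <|
  Prog.seq (assign kapSh 10 fun v =>
    Exp.add (Exp.cell 8 (lweSh.loc (Sum.inl v))) (mulVecE kapSh keySh 2 6 v)) <|
  Prog.seq (assign nbSh 32 negProjE) <|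
  Prog.seq (assign nbSh 11 fun v => Exp.add (Exp.cell 8 (lweSh.loc (Sum.inr (Sum.inl v))))
    (Exp.add (Exp.cell 14 (nbSh.loc v)) (Exp.cell 32 (nbSh.loc v)))) <|
  Prog.seq (assign Sh.unit 12 fun _ => Exp.add (Exp.cell 8 (lweSh.loc (Sum.inr (Sum.inr ()))))
    (Exp.sub (Exp.cell 16 []) (lastRowE 6 32)))
  finish

section Reduction

variable {P : Params} (D : Dists P) (A : Matrix (Fin P.kap) (Fin P.n) (Rq P))
  (pk : Fin 2 × Fin P.n → Rq P) (m : KeyIdx P → Rq P)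

theorem commKey_eq {a b : CommKey P} (h2 : a.A3 = b.A3) (h3 : a.A4 = b.A4) (h4 : a.B1 = b.B1)
    (h5 : a.B2 = b.B2) : a = b := by
  obtain ⟨_, _, _, _⟩ := a
  obtain ⟨_, _, _, _⟩ := b
  cases h2
  cases h3
  cases h4
  cases h5
  rfl

theorem readCommKey_inputMem (ck : CommKey P) : readCommKey (inputMem A pk ck) = ck := by
  have h2 := load_store (P := P) (Sh.prod kapSh keySh) fun p => ck.A3 p.1 p.2
  have h3 := load_store (P := P) (Sh.prod kapSh nSh) fun p => ck.A4 p.1 p.2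
  have h4 := load_store (P := P) (Sh.prod nbSh nSh) fun p => ck.B1 p.1 p.2
  have h5 := load_store (P := P) nSh ck.B2
  exact commKey_eq (funext fun i => funext fun j => congrFun h2 (i, j))
    (funext fun i => funext fun j => congrFun h3 (i, j))
    (funext fun i => funext fun j => congrFun h4 (i, j)) h5

/-- The program samples all its messages independently of `m`; its output is a uniform first message
completed by `simOf`. -/
theorem ex_simulator (ck : CommKey P) (H : Transcript P → ℝ≥0∞) :
    (ex (simulator.run D none 0 (inputMem A pk ck)) fun mem => H (readTranscript mem))
      = ex (iid (unif P) (Fin P.kap)) fun f => ex (iid (unif P) (Fin P.nb)) fun u1 =>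
        ex (unif P) fun u2 => ex (coins D) fun w => H (simOf A pk ck f u1 u2 w) := by
  rw [simulator, ex_sampleArr_seq D _ _ 10 (fun _ _ _ => rfl)]
  refine ex_congr fun f => ?_
  rw [ex_sampleArr_seq D _ _ 11 (fun _ _ _ => rfl)]
  refine ex_congr fun u1 => ?_
  rw [ex_sampleArr_seq D _ _ 12 (fun _ _ _ => rfl)]
  refine (ex_iid_unit (unif P) _).trans (ex_congr fun u2 => ?_)
  obtain ⟨m1, hm1⟩ : ∃ m1, m1 = overlay 10 (inputMem A pk ck) f := ⟨_, rfl⟩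
  obtain ⟨m2, hm2⟩ : ∃ m2, m2 = overlay 11 m1 u1 := ⟨_, rfl⟩
  obtain ⟨m3, hm3⟩ : ∃ m3 : Mem P, m3 = overlay 12 m2 fun _ : Sh.unit.T P => u2 := ⟨_, rfl⟩
  rw [← hm1, ← hm2, ← hm3]
  have k (b : ℕ) (hb : b < 10) : m3 b = inputMem A pk ck b := by
    rw [hm3, overlay_of_ne (by omega), hm2, overlay_of_ne (by omega), hm1, overlay_of_ne (by omega)]
  refine ex_sampleCoins D none _ 0 m3 _ _ fun w m4 hw k4 => ?_
  have k' (b : ℕ) (hb : b < 10) : m4 b = inputMem A pk ck b := by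
    rw [k4 b (by omega) (by omega), k b hb]
  refine ex_finish D none 0 _ _ (A := A) (pk := pk) (ck := ck) (f := f) (u1 := u1) (u2 := u2)
    ⟨?_, ?_, ?_, ?_, ?_, ?_⟩ hw fun mem' _ hr => congrArg H hr
  · rw [k' 0 (by norm_num)]
    exact fun i j => congrFun (load_store (Sh.prod kapSh nSh) fun p => A p.1 p.2) (i, j)
  · rw [k' 1 (by norm_num)]
    exact load_store (Sh.prod (Sh.fin Dim.two) nSh) pk
  · rw [readCommKey_congr fun b _ hb => k' b (by omega), readCommKey_inputMem]
  · rw [k4 10 (by norm_num) (by norm_num), hm3, overlay_of_ne (by norm_num), hm2,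
      overlay_of_ne (by norm_num), hm1]
    exact load_overlay kapSh 10 _ f
  · rw [k4 11 (by norm_num) (by norm_num), hm3, overlay_of_ne (by norm_num), hm2]
    exact load_overlay nbSh 11 _ u1
  · rw [k4 12 (by norm_num) (by norm_num), hm3]
    exact congrFun (load_overlay Sh.unit 12 m2 _) ()

/-- The memory on which the reduction is run. -/
def lweMem (M : Matrix (LweRow P) (Fin P.n) (Rq P)) (t : LweRow P → Rq P) : Mem P := fun k =>
  if k = 0 then store fun p : Fin P.kap × Fin P.n => A p.1 p.2
  else if k = 1 then store pk
  else if k = 6 then store m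
  else if k = 7 then store fun p : LweRow P × Fin P.n => M p.1 p.2
  else if k = 8 then store t
  else 0

/-- The commitment parameters built from `A₃` and the Module-LWE matrix. -/
def lweCommKey (A3 : Matrix (Fin P.kap) (KeyIdx P) (Rq P))
    (M : Matrix (LweRow P) (Fin P.n) (Rq P)) : CommKey P :=
  ⟨A3, fun i => M (Sum.inl i), fun b => M (Sum.inr (Sum.inl b)), M (Sum.inr (Sum.inr ()))⟩

/-- The transcript computed from masks, for given challenges and responses. -/
def hybOf (ck : CommKey P) (t1 : Fin P.kap → Rq P) (t2 : Fin P.nb → Rq P) (t3 : Rq P)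
    (w : Coins P) : Transcript P :=
  hybTrans A pk ck m t1 t2 t3 w.R w.z3 w.dd w.h w.c w.z1 w.z2

theorem hybOf_eq (ck : CommKey P) (t1 : Fin P.kap → Rq P) (t2 : Fin P.nb → Rq P) (t3 : Rq P)
    (w : Coins P) : hybOf A pk m ck t1 t2 t3 w = simOf A pk ck (t1 + ck.A3.mulVec m)
      (t2 + (w.z3 - proj w.R m)) (t3 + (w.h - lastRow w.R w.dd m (-proj w.R m) 0)) w := rfl

/-- The instance supplies `A₄`, `B'`, `B''` and the masks, while `A₃`, which is not part of it, is
sampled by the reduction. Knowing `m`, the reduction adds to the masks the terms of the first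
message that depend on the secret. -/
theorem ex_reduction (M : Matrix (LweRow P) (Fin P.n) (Rq P)) (t : LweRow P → Rq P)
    (H : CommKey P → Transcript P → ℝ≥0∞) :
    (ex (reduction.run D none 0 (lweMem A pk m M t)) fun mem =>
        H (readCommKey mem) (readTranscript mem))
      = ex (iid (iid (unif P) (KeyIdx P)) (Fin P.kap)) fun A3 => ex (coins D) fun w =>
        H (lweCommKey A3 M) (hybOf A pk m (lweCommKey A3 M) (fun i => t (Sum.inl i))
          (fun b => t (Sum.inr (Sum.inl b))) (t (Sum.inr (Sum.inr ()))) w) := by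
  rw [reduction, ex_iid_curry, ex_sampleArr_seq D _ _ 2 (fun _ _ _ => rfl)]
  refine ex_congr fun A3 => ?_
  obtain ⟨m1, hm1⟩ : ∃ m1, m1 = overlay 2 (lweMem A pk m M t) A3 := ⟨_, rfl⟩
  rw [← hm1]
  have k1 (b : ℕ) (hb : b ≠ 2) : m1 b = lweMem A pk m M t b := by rw [hm1, overlay_of_ne hb]
  have h7 (r : LweRow P) (j : Fin P.n) : load (LweRow P × Fin P.n) (m1 7) (r, j) = M r j := by
    rw [k1 7 (by norm_num)]
    exact congrFun (load_store (Sh.prod lweSh nSh) fun p => M p.1 p.2) (r, j)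
  refine ex_assign_seq D none (Q := (· = _)) (Sh.prod kapSh nSh) (fun p => M (Sum.inl p.1) p.2)
    (by norm_num) (fun _ => ⟨by norm_num, by norm_num⟩) (fun env' v i hi => ?_) fun m2 l2 k2 => ?_
  · exact (Exp.eval_cell_prod (s := lweSh) (i := Sum.inl i.1) m1 7 hi.rel.1 hi.rel.2).trans
      (h7 (Sum.inl i.1) i.2)
  refine ex_assign_seq D none (Q := (· = _)) (Sh.prod nbSh nSh)
    (fun p => M (Sum.inr (Sum.inl p.1)) p.2)
    (by norm_num) (fun _ => ⟨by norm_num, by norm_num⟩) (fun env' v i hi => ?_) fun m3 l3 k3 => ?_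
  · refine (Exp.eval_cell_prod (s := lweSh) (i := Sum.inr (Sum.inl i.1)) m2 7 hi.rel.1
      hi.rel.2).trans ?_
    rw [k2 7 (by norm_num) (by norm_num)]
    exact h7 (Sum.inr (Sum.inl i.1)) i.2
  refine ex_assign_seq D none (Q := (· = _)) nSh (M (Sum.inr (Sum.inr ())))
    (by norm_num) (fun _ => ⟨by norm_num, by norm_num⟩) (fun env' v i hi => ?_) fun m4 l4 k4 => ?_
  · refine (Exp.eval_cell_prod (s := lweSh) (v := Sum.inr (Sum.inr ()))
      (i := Sum.inr (Sum.inr ())) m3 7 trivial hi.rel).trans ?_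
    rw [k3 7 (by norm_num) (by norm_num), k2 7 (by norm_num) (by norm_num)]
    exact h7 (Sum.inr (Sum.inr ())) i
  refine ex_sampleCoins D none _ 0 m4 _ _ fun w m5 hw k5 => ?_
  have k15 (b : ℕ) (hb : b < 13) (h2 : b ≠ 2) (h3 : b ≠ 3) (h4 : b ≠ 4) (h5 : b ≠ 5) :
      m5 b = lweMem A pk m M t b := by
    rw [k5 b (by omega) (by omega), k4 b (by omega) h5, k3 b (by omega) h4, k2 b (by omega) h3, k1 b h2]
  have hck : readCommKey m5 = lweCommKey (fun i j => A3 (i, j)) M := by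
    refine commKey_eq ?_ ?_ ?_ ?_ <;> dsimp only [readCommKey, lweCommKey]
    · rw [k5 2 (by norm_num) (by norm_num), k4 2 (by norm_num) (by norm_num),
        k3 2 (by norm_num) (by norm_num), k2 2 (by norm_num) (by norm_num), hm1]
      exact funext fun i => funext fun j =>
        congrFun (load_overlay (Sh.prod kapSh keySh) 2 (lweMem A pk m M t) A3) (i, j)
    · rw [k5 3 (by norm_num) (by norm_num), k4 3 (by norm_num) (by norm_num),
        k3 3 (by norm_num) (by norm_num)]
      exact funext fun i => funext fun j => congrFun l2 (i, j)
    · rw [k5 4 (by norm_num) (by norm_num), k4 4 (by norm_num) (by norm_num)]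
      exact funext fun i => funext fun j => congrFun l3 (i, j)
    · rw [k5 5 (by norm_num) (by norm_num)]
      exact l4
  obtain ⟨ck, hck'⟩ : ∃ ck, ck = lweCommKey (fun i j => A3 (i, j)) M := ⟨_, rfl⟩
  rw [← hck'] at hck
  refine Eq.trans ?_ (congrArg (fun ck => H ck (hybOf A pk m ck (fun i => t (Sum.inl i))
    (fun b => t (Sum.inr (Sum.inl b))) (t (Sum.inr (Sum.inr ()))) w)) hck')
  have hA3 (i j) : load (Fin P.kap × KeyIdx P) (m5 2) (i, j) = ck.A3 i j := by rw [← hck]; rfl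
  have ht (r : LweRow P) : load (LweRow P) (m5 8) r = t r := by
    rw [k15 8 (by norm_num) (by norm_num) (by norm_num) (by norm_num) (by norm_num)]
    exact congrFun (load_store lweSh t) r
  have hm : load (KeyIdx P) (m5 6) = m := by
    rw [k15 6 (by norm_num) (by norm_num) (by norm_num) (by norm_num) (by norm_num)]
    exact load_store keySh m
  refine ex_assign_seq D none (Q := (· = _)) kapSh ((fun i => t (Sum.inl i)) + ck.A3.mulVec m)
    (by norm_num) (fun v => ⟨⟨by norm_num, by norm_num⟩, reads_mulVecE v (by norm_num) (by norm_num)⟩)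
    (fun env' v i hi => ?_) fun m6 l6 k6 => ?_
  · rw [Exp.eval_add, eval_mulVecE m5 hi,
      Exp.eval_cell_rel (s := lweSh) (i := Sum.inl i) m5 8 hi.rel]
    refine congrArg₂ _ (ht (Sum.inl i)) (Finset.sum_congr rfl fun j _ => ?_)
    exact congrArg₂ _ (hA3 i j) (congrFun hm j)
  have hw6 : HoldsCoins m6 w := hw.congr fun b hb hb' _ _ _ => k6 b (by omega) (by omega)
  refine ex_assign_seq D none (Q := (· = _)) nbSh (-proj w.R m) (by norm_num)
    (fun v => reads_negProjE v (by norm_num) (by norm_num)) (fun env' v i hi => ?_) fun m7 l7 k7 => ?_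
  · exact eval_negProjE m6 hi hw6.R (by rw [k6 6 (by norm_num) (by norm_num)]; exact hm)
  have hw7 : HoldsCoins m7 w := hw6.congr fun b hb hb' _ _ _ => k7 b (by omega) (by omega)
  refine ex_assign_seq D none (Q := (· = _)) nbSh
    ((fun b => t (Sum.inr (Sum.inl b))) + (w.z3 - proj w.R m)) (by norm_num)
    (fun v => ⟨⟨by norm_num, by norm_num⟩, ⟨by norm_num, by norm_num⟩, by norm_num, by norm_num⟩)
    (fun env' v i hi => ?_) fun m8 l8 k8 => ?_
  · rw [Exp.eval_add, Exp.eval_add, Exp.eval_cell_rel m7 14 hi.rel, Exp.eval_cell_rel m7 32 hi.rel, l7,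
      Exp.eval_cell_rel (s := lweSh) (i := Sum.inr (Sum.inl i)) m7 8 hi.rel,
      k7 8 (by norm_num) (by norm_num), k6 8 (by norm_num) (by norm_num), sub_eq_add_neg]
    exact congrArg₂ _ (ht _) (congrArg₂ _ (congrFun hw7.z3 i) rfl)
  have hw8 : HoldsCoins m8 w := hw7.congr fun b hb hb' _ _ _ => k8 b (by omega) (by omega)
  refine ex_assign_seq D none (Q := (· = _)) Sh.unit
    (fun _ => t (Sum.inr (Sum.inr ())) + (w.h - lastRow w.R w.dd m (-proj w.R m) 0)) (by norm_num)
    (fun v => ⟨⟨by norm_num, by norm_num⟩, ⟨by norm_num, by norm_num⟩,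
      reads_lastRowE (by norm_num) (by norm_num) (by norm_num) (by norm_num)⟩)
    (fun env' v i hi => ?_) fun m9 l9 k9 => ?_
  · rw [Exp.eval_add, Exp.eval_sub, eval_lastRowE m8 hw8.R hw8.dd (z := m) (y := -proj w.R m)
      (by rw [k8 6 (by norm_num) (by norm_num), k7 6 (by norm_num) (by norm_num),
            k6 6 (by norm_num) (by norm_num)]; exact hm)
      (by rw [k8 32 (by norm_num) (by norm_num)]; exact l7), Exp.eval_cell_nil, hw8.h,
      Exp.eval_cell_rel (s := lweSh) (v := Sum.inr (Sum.inr ()))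
        (i := Sum.inr (Sum.inr ())) m8 8 trivial,
      k8 8 (by norm_num) (by norm_num), k7 8 (by norm_num) (by norm_num),
      k6 8 (by norm_num) (by norm_num)]
    exact congrArg (· + _) (ht _)
  have hw9 : HoldsCoins m9 w := hw8.congr fun b hb hb' _ _ _ => k9 b (by omega) (by omega)
  have k59 (b : ℕ) (hb : b < 10) : m9 b = m5 b := by
    rw [k9 b (by omega) (by omega), k8 b (by omega) (by omega), k7 b (by omega) (by omega),
      k6 b (by omega) (by omega)]
  refine ex_finish D none 0 _ _ (A := A) (pk := pk) (ck := ck) ⟨?_, ?_, ?_, ?_, ?_, ?_⟩ hw9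
    fun mem' hc hr => congrArg₂ H hc hr
  · rw [k59 0 (by norm_num), k15 0 (by norm_num) (by norm_num) (by norm_num) (by norm_num)
      (by norm_num)]
    exact fun i j => congrFun (load_store (Sh.prod kapSh nSh) fun p => A p.1 p.2) (i, j)
  · rw [k59 1 (by norm_num), k15 1 (by norm_num) (by norm_num) (by norm_num) (by norm_num)
      (by norm_num)]
    exact load_store (Sh.prod (Sh.fin Dim.two) nSh) pk
  · rw [readCommKey_congr fun b _ hb => k59 b (by omega), hck]
  · rw [k9 10 (by norm_num) (by norm_num), k8 10 (by norm_num) (by norm_num),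
      k7 10 (by norm_num) (by norm_num)]
    exact l6
  · rw [k9 11 (by norm_num) (by norm_num)]
    exact l8
  · exact load1_eq_of_load l9

end Reduction

/-! ### Honest, hybrid and simulated views -/

section ZeroKnowledge

variable {P : Params} (D : Dists P) (A : Matrix (Fin P.kap) (Fin P.n) (Rq P))
  (pk : Fin 2 × Fin P.n → Rq P) (m : KeyIdx P → Rq P)

theorem ex_unifCommKey (F : CommKey P → ℝ≥0∞) :
    ex (unifCommKey P) F = ex (iid (iid (unif P) (KeyIdx P)) (Fin P.kap)) fun A3 =>
      ex (iid (iid (unif P) (Fin P.n)) (Fin P.kap)) fun A4 =>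
      ex (iid (iid (unif P) (Fin P.n)) (Fin P.nb)) fun B1 =>
      ex (iid (unif P) (Fin P.n)) fun B2 => F ⟨A3, A4, B1, B2⟩ := by
  simp only [unifCommKey, ex_bind, ex_pure]

theorem ex_iid_lweRow {α : Type} (p : PMF α) (F : (LweRow P → α) → ℝ≥0∞) :
    ex (iid p (LweRow P)) F = ex (iid p (Fin P.kap)) fun a => ex (iid p (Fin P.nb)) fun b =>
      ex p fun c => F (Sum.elim a (Sum.elim b fun _ => c)) := by
  rw [ex_iid_sum]
  refine ex_congr fun a => ?_
  rw [ex_iid_sum]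
  exact ex_congr fun b => ex_iid_unit _ _

theorem ex_hybRun_eq (ck : CommKey P) (F : Transcript P → ℝ≥0∞) :
    ex (hybRun D A pk ck m) F = ex (iid (polyOf P D.chi) (Fin P.n)) fun s => ex (coins D) fun w =>
      F (hybOf A pk m ck (ck.A4.mulVec s) (ck.B1.mulVec s) (dotProduct ck.B2 s) w) := by
  simp only [hybRun, maskRun, coins, ex_bind, ex_pure, hybOf]

/-- Uniform masks hide the first message. -/
theorem ex_mask (ck : CommKey P) (F : Transcript P → ℝ≥0∞) :
    (ex (iid (unif P) (Fin P.kap)) fun t1 => ex (iid (unif P) (Fin P.nb)) fun t2 =>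
      ex (unif P) fun t3 => ex (coins D) fun w => F (hybOf A pk m ck t1 t2 t3 w))
    = ex (iid (unif P) (Fin P.kap)) fun t1 => ex (iid (unif P) (Fin P.nb)) fun t2 =>
      ex (unif P) fun t3 => ex (coins D) fun w => F (simOf A pk ck t1 t2 t3 w) := by
  have hcomm (X : (Fin P.kap → Rq P) → (Fin P.nb → Rq P) → Rq P → Coins P → ℝ≥0∞) :
      (ex (iid (unif P) (Fin P.kap)) fun t1 => ex (iid (unif P) (Fin P.nb)) fun t2 =>
        ex (unif P) fun t3 => ex (coins D) fun w => X t1 t2 t3 w)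
      = ex (coins D) fun w => ex (iid (unif P) (Fin P.kap)) fun t1 =>
        ex (iid (unif P) (Fin P.nb)) fun t2 => ex (unif P) fun t3 => X t1 t2 t3 w := by
    rw [ex_comm (coins D)]
    refine ex_congr fun t1 => ?_
    rw [ex_comm (coins D)]
    refine ex_congr fun t2 => ?_
    rw [ex_comm (coins D)]
  rw [hcomm, hcomm]
  refine ex_congr fun w => ?_
  simp only [hybOf_eq]
  rw [ex_iid_shift ex_unif_shift (ck.A3.mulVec m) fun t1 => ex (iid (unif P) (Fin P.nb)) fun t2 =>
    ex (unif P) fun t3 => F (simOf A pk ck t1 (t2 + (w.z3 - proj w.R m))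
      (t3 + (w.h - lastRow w.R w.dd m (-proj w.R m) 0)) w)]
  refine ex_congr fun t1 => ?_
  rw [ex_iid_shift ex_unif_shift (w.z3 - proj w.R m) fun t2 =>
    ex (unif P) fun t3 => F (simOf A pk ck t1 t2
      (t3 + (w.h - lastRow w.R w.dd m (-proj w.R m) 0)) w)]
  refine ex_congr fun t2 => ?_
  exact ex_unif_shift _ fun t3 => F (simOf A pk ck t1 t2 t3 w)

variable (dist : CommKey P → Transcript P → PMF Bool)

/-- The probability that the distinguisher outputs `b`. -/
def distProb (b : Bool) (ck : CommKey P) (t : Transcript P) : ℝ≥0∞ :=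
  ex (dist ck t) fun x => ind (x = b)

/-- The probability that the distinguisher outputs `b` on a hybrid transcript. -/
def hybProb (b : Bool) : ℝ≥0∞ :=
  ex (unifCommKey P) fun ck => ex (hybRun D A pk ck m) fun t => distProb dist b ck t

/-- The probability that the distinguisher outputs `true` on a simulated transcript. -/
def simProb : ℝ≥0∞ :=
  ex (unifCommKey P) fun ck => ex (iid (unif P) (Fin P.kap)) fun f =>
    ex (iid (unif P) (Fin P.nb)) fun u1 => ex (unif P) fun u2 => ex (coins D) fun w =>
      distProb dist true ck (simOf A pk ck f u1 u2 w)

theorem pr_simView :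
    pr (simView D simulator A pk dist) (· = true) = (simProb D A pk dist).toReal := by
  rw [pr_eq, simView, ex_bind, simProb]
  refine congrArg _ (ex_congr fun ck => ?_)
  rw [ex_bind]
  exact ex_simulator D A pk ck (distProb dist true ck)

theorem ex_lweAdversary (M : Matrix (LweRow P) (Fin P.n) (Rq P)) (t : LweRow P → Rq P) :
    (ex (lweAdversary D reduction A pk m dist M t) fun b => ind (b = true))
      = ex (iid (iid (unif P) (KeyIdx P)) (Fin P.kap)) fun A3 => ex (coins D) fun w =>
        distProb dist true (lweCommKey A3 M) (hybOf A pk m (lweCommKey A3 M) (fun i => t (Sum.inl i))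
          (fun b => t (Sum.inr (Sum.inl b))) (t (Sum.inr (Sum.inr ()))) w) := by
  rw [lweAdversary, ex_bind]
  exact ex_reduction D A pk m M t (distProb dist true)

/-- On a vector `M s` the reduction outputs a hybrid transcript; on a uniform vector its masks hide
the secret by `ex_mask` and the transcript is simulated. The remaining work is to reorder
independent samples. -/
theorem mlweAdv_eq :
    mlweAdv D (lweAdversary D reduction A pk m dist)
      = |(hybProb D A pk m dist true).toReal - (simProb D A pk dist).toReal| := by
  rw [mlweAdv, pr_eq, pr_eq]
  congr 3
  · rw [ex_bind, ex_iid_lweRow, hybProb, ex_unifCommKey]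
    refine Eq.trans (ex_congr fun A4 => ?_) (ex_comm _ _ _)
    refine Eq.trans (ex_congr fun B1 => ?_) (ex_comm _ _ _)
    refine Eq.trans (ex_congr fun B2 => ?_) (ex_comm _ _ _)
    simp only [ex_bind, ex_hybRun_eq]
    refine (ex_congr fun s => ex_lweAdversary D A pk m dist _ _).trans ?_
    exact ex_comm _ _ _
  · rw [ex_bind, ex_iid_lweRow, simProb, ex_unifCommKey]
    refine Eq.trans (ex_congr fun A4 => ?_) (ex_comm _ _ _)
    refine Eq.trans (ex_congr fun B1 => ?_) (ex_comm _ _ _)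
    refine Eq.trans (ex_congr fun B2 => ?_) (ex_comm _ _ _)
    rw [ex_bind]
    refine (ex_congr fun t => ex_lweAdversary D A pk m dist _ t).trans ?_
    refine (ex_comm _ _ _).trans (ex_congr fun A3 => ?_)
    rw [ex_iid_lweRow]
    exact ex_mask D A pk m ⟨A3, A4, B1, B2⟩ (distProb dist true ⟨A3, A4, B1, B2⟩)

theorem distProb_add (ck : CommKey P) (t : Transcript P) :
    distProb dist true ck t + distProb dist false ck t = 1 := by
  rw [distProb, distProb, ← ex_add]
  refine (ex_congr fun b => ?_).trans (ex_const (dist ck t) 1)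
  cases b
  · rw [ind_not Bool.false_ne_true, ind_of rfl, zero_add]
  · rw [ind_of rfl, ind_not Bool.true_eq_false_eq_False, add_zero]

theorem hybProb_add : hybProb D A pk m dist true + hybProb D A pk m dist false = 1 := by
  simp only [hybProb, ← ex_add, distProb_add, ex_const]

/-- The probability that the honest prover does not abort and the distinguisher outputs `b`. -/
def realProb (b : Bool) : ℝ≥0∞ :=
  ex (unifCommKey P) fun ck => ex (honestRun D A ck m) fun o => o.elim 0 (distProb dist b ck)

theorem realProb_le (hpk : keyMap A m = pk) (b : Bool) :
    realProb D A m dist b ≤ 27⁻¹ * hybProb D A pk m dist b := by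
  rw [realProb, hybProb, ← ex_mul_left]
  exact ex_mono fun ck => ex_honestRun_le D ck hpk _ rfl

theorem ex_realView (F : Option Bool → ℝ≥0∞) :
    ex (realView D A m dist) F = ex (unifCommKey P) fun ck => ex (honestRun D A ck m) fun o =>
      o.elim (F none) fun t => ex (dist ck t) fun b => F (some b) := by
  rw [realView, ex_bind]
  refine ex_congr fun ck => ?_
  rw [ex_bind]
  refine ex_congr fun o => ?_
  cases o with
  | none => exact ex_pure _ _
  | some t => exact ex_map _ _ _

theorem pr_realView :
    pr (realView D A m dist) (· = some true) = (realProb D A m dist true).toReal := by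
  rw [pr_eq, ex_realView]
  simp only [ind_not (show ¬(none : Option Bool) = some true from nofun), Option.some.injEq]
  rfl

theorem ex_realView_isSome :
    (ex (realView D A m dist) fun o => ind (o.isSome = true))
      = ex (unifCommKey P) fun ck => ex (honestRun D A ck m) fun o => ind (o.isSome = true) := by
  rw [ex_realView]
  refine ex_congr fun ck => ex_congr fun o => ?_
  cases o with
  | none => rfl
  | some t => exact (ex_congr fun b => ind_of rfl).trans ((ex_const (dist ck t) 1).trans
      (ind_of rfl).symm)

theorem realProb_add : realProb D A m dist true + realProb D A m dist false
    = ex (realView D A m dist) fun o => ind (o.isSome = true) := by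
  rw [ex_realView_isSome, realProb, realProb, ← ex_add]
  refine ex_congr fun ck => ?_
  rw [← ex_add]
  refine ex_congr fun o => ?_
  cases o with
  | none => exact (add_zero _).trans (ind_not Bool.false_ne_true).symm
  | some t => exact (distProb_add dist ck t).trans (ind_of rfl).symm

theorem le_ex_realView_isSome (hm : linf m ≤ 1) :
    ENNReal.ofReal (1 / 27 * (1 - abortErr))
      ≤ ex (realView D A m dist) fun o => ind (o.isSome = true) := by
  rw [ex_realView_isSome, ← ex_const (unifCommKey P) (ENNReal.ofReal _)]
  refine ex_mono fun ck => ?_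
  rw [← ofReal_pr]
  exact ENNReal.ofReal_le_ofReal (le_pr_honestRun_isSome D A ck hm)

/-- Conditioning on an event of probability close to `1 / 27` that has bounded density. -/
theorem abs_div_sub_le {x y H e : ℝ} (hx : x ≤ 1 / 27 * H) (hy : y ≤ 1 / 27 * (1 - H)) (hH0 : 0 ≤ H)
    (hH1 : H ≤ 1) (he : e ≤ 1 / 2) (hxy : 1 / 27 * (1 - e) ≤ x + y) :
    |x / (x + y) - H| ≤ 2 * e := by
  have he0 : 0 ≤ e := by linarith
  have hs : 0 < x + y := by linarith
  rw [abs_le]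
  -- One side bounds the outcome of mass `y`, at most `(1 - H) / (1 - e)` after conditioning, the
  -- other the outcome of mass `x`, at most `H / (1 - e)`; for `e ≤ 1 / 2` the factor `1 / (1 - e)`
  -- is at most `1 + 2 e`.
  constructor
  · rw [le_sub_iff_add_le, le_div_iff₀ hs]
    nlinarith [mul_nonneg hH0 he0, mul_nonneg (sub_nonneg.2 hH1) he0]
  · rw [sub_le_iff_le_add, div_le_iff₀ hs]
    nlinarith [mul_nonneg hH0 he0, mul_nonneg (sub_nonneg.2 hH1) he0]

/-- The density bound is applied to both outputs of the distinguisher. Two upper bounds on the parts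
and a lower bound on the total mass determine the conditional probability up to `2 · abortErr = 8
exp (-72)`. -/
theorem abs_realView_sub_le (h : HonestRel A pk m) :
    |pr (realView D A m dist) (· = some true) / pr (realView D A m dist) (fun o => o.isSome = true)
      - (hybProb D A pk m dist true).toReal| ≤ 1 / 2 ^ 100 := by
  have hH := hybProb_add D A pk m dist
  have hHt : hybProb D A pk m dist true ≠ ⊤ :=
    ne_top_of_le_ne_top ENNReal.one_ne_top (le_self_add.trans hH.le)
  have hHf : hybProb D A pk m dist false ≠ ⊤ :=
    ne_top_of_le_ne_top ENNReal.one_ne_top (le_add_self.trans hH.le)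
  have hR := realProb_add D A m dist
  have hR1 : realProb D A m dist true + realProb D A m dist false ≤ 1 :=
    hR.trans_le (ex_ind_le_one _ _)
  have hRt : realProb D A m dist true ≠ ⊤ :=
    ne_top_of_le_ne_top ENNReal.one_ne_top (le_self_add.trans hR1)
  have hRf : realProb D A m dist false ≠ ⊤ :=
    ne_top_of_le_ne_top ENNReal.one_ne_top (le_add_self.trans hR1)
  have hle (b : Bool) (hb : hybProb D A pk m dist b ≠ ⊤) :
      (realProb D A m dist b).toReal ≤ 1 / 27 * (hybProb D A pk m dist b).toReal := by
    have h1 := ENNReal.toReal_mono (ENNReal.mul_ne_top (by simp) hb) (realProb_le D A pk m dist h.2 b)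
    rwa [ENNReal.toReal_mul, ENNReal.toReal_inv, ENNReal.toReal_ofNat, ← one_div] at h1
  have hH' : (hybProb D A pk m dist true).toReal + (hybProb D A pk m dist false).toReal = 1 := by
    rw [← ENNReal.toReal_add hHt hHf, hH, ENNReal.toReal_one]
  have hD : pr (realView D A m dist) (fun o => o.isSome = true)
      = (realProb D A m dist true).toReal + (realProb D A m dist false).toReal := by
    rw [pr_eq, ← hR, ENNReal.toReal_add hRt hRf]
  have he := exp_neg_72_le
  have hlow : 1 / 27 * (1 - abortErr)
      ≤ (realProb D A m dist true).toReal + (realProb D A m dist false).toReal := by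
    rw [← ENNReal.toReal_add hRt hRf]
    refine (ENNReal.ofReal_le_iff_le_toReal (ENNReal.add_ne_top.2 ⟨hRt, hRf⟩)).1 ?_
    rw [hR]
    exact le_ex_realView_isSome D A m dist h.1
  rw [pr_realView, hD]
  refine (abs_div_sub_le (hle true hHt) ?_ ENNReal.toReal_nonneg ?_ ?_ hlow).trans ?_
  · rw [← eq_sub_iff_add_eq'.2 hH']
    exact hle false hHf
  · rw [← hH']
    exact le_add_of_nonneg_right ENNReal.toReal_nonneg
  · rw [abortErr]
    refine (mul_le_mul_of_nonneg_left he (by norm_num)).trans ?_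
    norm_num
  · rw [abortErr]
    refine (mul_le_mul_of_nonneg_left (mul_le_mul_of_nonneg_left he (by norm_num))
      (by norm_num)).trans ?_
    norm_num

end ZeroKnowledge

theorem zero_knowledge :
    ∃ (S Q : Prog) (C : ℕ), S.PolyTime C ∧ Q.PolyTime C ∧
      ∀ (P : Params) (D : Dists P) (A : Matrix (Fin P.kap) (Fin P.n) (Rq P))
        (pk : Fin 2 × Fin P.n → Rq P) (m : KeyIdx P → Rq P)
        (dist : CommKey P → Transcript P → PMF Bool), HonestRel A pk m →
          hvzkAdv D S A pk m dist ≤ mlweAdv D (lweAdversary D Q A pk m dist) + 1 / 2 ^ 100 := by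
  obtain ⟨C, hC⟩ := simulator.exists_polyTime
  obtain ⟨C', hC'⟩ := reduction.exists_polyTime
  refine ⟨simulator, reduction, max C C', hC.mono (le_max_left _ _), hC'.mono (le_max_right _ _), ?_⟩
  intro P D A pk m dist h
  rw [hvzkAdv, mlweAdv_eq, pr_simView, add_comm]
  -- The triangle inequality through the hybrid: the first distance is statistical, the second is
  -- exactly the Module-LWE advantage.
  exact (abs_sub_le _ (hybProb D A pk m dist true).toReal _).trans
    (add_le_add_left (abs_realView_sub_le D A pk m dist h) _)

end KeyWF

end

theorem mainTheorem10 :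
    -- completeness
    (∀ (P : KeyWF.Params) (D : KeyWF.Dists P)
      (A : Matrix (Fin P.kap) (Fin P.n) (KeyWF.Rq P)) (pk : Fin 2 × Fin P.n → KeyWF.Rq P)
      (ck : KeyWF.CommKey P) (m : KeyWF.KeyIdx P → KeyWF.Rq P),
      KeyWF.HonestRel A pk m →
        (1 / 27 - 1 / 2 ^ 100 : ℝ)
            ≤ KeyWF.pr (KeyWF.honestRun D A ck m) (fun o => o.isSome = true) ∧
        (1 - KeyWF.complErr P) * KeyWF.pr (KeyWF.honestRun D A ck m) (fun o => o.isSome = true)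
            ≤ KeyWF.pr (KeyWF.honestRun D A ck m)
                (fun o => ∃ t, o = some t ∧ KeyWF.Verify A pk ck t)) ∧
    -- knowledge soundness
    (∃ (K : KeyWF.Prog) (e C : ℕ), 0 < e ∧ 0 < C ∧ K.PolyTime C ∧
      ∀ (P : KeyWF.Params) (D : KeyWF.Dists P)
        (A : Matrix (Fin P.kap) (Fin P.n) (KeyWF.Rq P)) (pk : Fin 2 × Fin P.n → KeyWF.Rq P)
        (ck : KeyWF.CommKey P) (adv : PMF (KeyWF.Prover P)) (ε : ℝ),
        ε = KeyWF.pr (KeyWF.play D adv) (KeyWF.Verify A pk ck) →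
        KeyWF.knowErr D < ε →
          (ε - KeyWF.knowErr D) ^ e / (C * P.size ^ C : ℝ)
              - KeyWF.pr (KeyWF.extraction D K A pk ck adv) (KeyWF.FindsMSIS ck)
            ≤ KeyWF.pr (KeyWF.extraction D K A pk ck adv) (KeyWF.FindsWitness A pk ck)) ∧
    -- honest-verifier zero-knowledge
    (∃ (S Q : KeyWF.Prog) (C : ℕ), S.PolyTime C ∧ Q.PolyTime C ∧
      ∀ (P : KeyWF.Params) (D : KeyWF.Dists P)
        (A : Matrix (Fin P.kap) (Fin P.n) (KeyWF.Rq P)) (pk : Fin 2 × Fin P.n → KeyWF.Rq P)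
        (m : KeyWF.KeyIdx P → KeyWF.Rq P)
        (dist : KeyWF.CommKey P → KeyWF.Transcript P → PMF Bool),
        KeyWF.HonestRel A pk m →
          KeyWF.hvzkAdv D S A pk m dist
            ≤ KeyWF.mlweAdv D (KeyWF.lweAdversary D Q A pk m dist) + 1 / 2 ^ 100) :=
  ⟨fun _ D A pk ck m h => KeyWF.completeness D A pk ck m h, KeyWF.knowledge_soundness,
    KeyWF.zero_knowledge⟩
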